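/- A lattice $\Lambda\subseteq\mathbb R^n$ is the set of integer combinations of the columns of a real matrix $B$ with linearly independent columns; $\mathrm{rank}(\Lambda)$ is the number of columns and $\det(\Lambda)=\sqrt{\det(B^{T}B)}$. For $\Lambda\neq\{0\}$ let $\mathrm{nd}(\Lambda)=\det(\Lambda)^{1/\mathrm{rank}(\Lambda)}$ be its normalized determinant. The dual lattice is $\Lambda^*=\{x\in\mathrm{span}(\Lambda):\langle x,y\rangle\in\mathbb Z\ \forall y\in\Lambda\}$. A sublattice $\Lambda'\subseteq\Lambda$ is primitive if $\Lambda'=\Lambda\cap W$ for some subspace $W$; then $\Lambda/\Lambda'$ denotes the orthogonal projection of $\Lambda$ onto $\mathrm{span}(\Lambda')^\perp$. Let $t\ge 1$. A lattice $\Lambda$ is $t$-stable if $\mathrm{nd}(\tilde\Lambda)\ge t^{-1}$ for all nonzero sublattices $\tilde\Lambda\subseteq\Lambda$ and for all nonzero sublattices $\tilde\Lambda\subseteq\Lambda^*$. A $t$-stable filtration of $\Lambda$ is a strictly increasing chain $\{0\}=\Lambda_0\subset\cdots\subset\Lambda_k=\Lambda$ of lattices, each primitive in the next, such that the numbers $r_i=\mathrm{nd}(\Lambda_i/\Lambda_{i-1})$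 satisfy $r_1<\cdots<r_k$ and every lattice $\frac1{r_i}(\Lambda_i/\Lambda_{i-1})$, $1\le i\le k$, is $t$-stable. It is well-separated if moreover $r_i\le\frac12 r_{i+2}$ for $1\le i\le k-2$. **Theorem.** (1) Let $t\ge1$ and let $\{0\}=\Lambda_0\subset\cdots\subset\Lambda_k=\Lambda$ be a $t$-stable filtration of a lattice $\Lambda\subseteq\mathbb R^n$. Then there are indices $0=\ell(0)<\cdots<\ell(\tilde k)=k$ such that $\Lambda_{\ell(0)}\subset\cdots\subset\Lambda_{\ell(\tilde k)}$ is a well-separated $2t$-stable filtration of $\Lambda$. That is, the numbers $\tilde r_i=\mathrm{nd}(\Lambda_{\ell(i)}/\Lambda_{\ell(i-1)})$ satisfy $\tilde r_1<\cdots<\tilde r_{\tilde k}$ and $\tilde r_i\le\frac12\tilde r_{i+2}$ for $1\le i\le\tilde k-2$, and every lattice $\frac1{\tilde r_i}(\Lambda_{\ell(i)}/\Lambda_{\ell(i-1)})$, $1\le i\le\tilde k$, is $2t$-stable. (2) Such indices can be computed in polynomial time: there are one program for an integer random access machine with logarithmic cost and one polynomial $p$ such that, for all $n$, $k$, $t\geq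 1$ and every $t$-stable filtration as in (1) in which each $\Lambda_i$ is given by a basis consisting of vectors in $\mathbb Q^n$, the program, run on the list of these bases, halts with total cost at most $p(\text{encoding length of the input})$ and outputs a list $\ell(0),\ldots,\ell(\tilde k)$ as in (1). (3) In particular, every lattice $\Lambda\subseteq\mathbb R^n$ has a well-separated $2$-stable filtration. -/

import Mathlib

open scoped Pointwise

/-! Lattices in Euclidean space. -/

/-- `b` is a basis of the lattice `L`: its vectors are linearly independent over `ℝ` and `L` is the
set of their integer combinations. -/
def IsLatticeBasis {n m : ℕ} (b : Fin m → EuclideanSpace ℝ (Fin n))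
    (L : Submodule ℤ (EuclideanSpace ℝ (Fin n))) : Prop :=
  LinearIndependent ℝ b ∧ Submodule.span ℤ (Set.range b) = L

/-- A lattice (not necessarily of full rank) in `ℝⁿ`. -/
def IsLattice {n : ℕ} (L : Submodule ℤ (EuclideanSpace ℝ (Fin n))) : Prop :=
  ∃ (m : ℕ) (b : Fin m → EuclideanSpace ℝ (Fin n)), IsLatticeBasis b L

/-- The rank of a lattice. -/
noncomputable def latticeRank {n : ℕ} (L : Submodule ℤ (EuclideanSpace ℝ (Fin n))) : ℕ :=
  Module.finrank ℤ L

open Classical in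
/-- The determinant `√(det (BᵀB))` of a lattice, for a basis `B` (any basis, see
`latticeDet_eq`); the value off lattices is irrelevant. -/
noncomputable def latticeDet {n : ℕ} (L : Submodule ℤ (EuclideanSpace ℝ (Fin n))) : ℝ :=
  if h : IsLattice L then √(Matrix.gram ℝ h.choose_spec.choose).det else 0

theorem IsLatticeBasis.exists_matrix {n m m' : ℕ} {b : Fin m → EuclideanSpace ℝ (Fin n)}
    {b' : Fin m' → EuclideanSpace ℝ (Fin n)} {L : Submodule ℤ (EuclideanSpace ℝ (Fin n))}
    (hb : IsLatticeBasis b L) (hb' : IsLatticeBasis b' L) :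
    ∃ U : Matrix (Fin m') (Fin m) ℤ, ∀ j, b' j = ∑ i, (U j i : ℝ) • b i := by
  have h : ∀ j, ∃ c : Fin m → ℤ, ∑ i, c i • b i = b' j := by
    intro j
    have hj : b' j ∈ Submodule.span ℤ (Set.range b) := by
      rw [hb.2, ← hb'.2]
      exact Submodule.subset_span ⟨j, rfl⟩
    exact (Submodule.mem_span_range_iff_exists_fun ℤ).1 hj
  choose U hU using h
  refine ⟨Matrix.of U, fun j => ?_⟩
  rw [← hU j]
  exact Finset.sum_congr rfl fun i _ => (Int.cast_smul_eq_zsmul ℝ (U j i) (b i)).symm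

theorem IsLatticeBasis.gram_det_eq {n m m' : ℕ} {b : Fin m → EuclideanSpace ℝ (Fin n)}
    {b' : Fin m' → EuclideanSpace ℝ (Fin n)} {L : Submodule ℤ (EuclideanSpace ℝ (Fin n))}
    (hb : IsLatticeBasis b L) (hb' : IsLatticeBasis b' L) :
    (Matrix.gram ℝ b').det = (Matrix.gram ℝ b).det := by
  have key : ∀ {k k' : ℕ} {c : Fin k → EuclideanSpace ℝ (Fin n)}
      {c' : Fin k' → EuclideanSpace ℝ (Fin n)},
      IsLatticeBasis c L → IsLatticeBasis c' L → k ≤ k' := by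
    intro k k' c c' hc hc'
    have h1 : Submodule.span ℝ (Set.range c) ≤ Submodule.span ℝ (Set.range c') := by
      rw [Submodule.span_le]
      rintro _ ⟨j, rfl⟩
      obtain ⟨U, hU⟩ := hc'.exists_matrix hc
      rw [hU j]
      exact Submodule.sum_mem _ fun i _ =>
        Submodule.smul_mem _ _ (Submodule.subset_span ⟨i, rfl⟩)
    have h2 := Submodule.finrank_mono h1
    rw [finrank_span_eq_card hc.1, finrank_span_eq_card hc'.1] at h2
    simpa using h2
  obtain rfl : m = m' := le_antisymm (key hb hb') (key hb' hb)
  obtain ⟨U, hU⟩ := hb.exists_matrix hb'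
  obtain ⟨V, hV⟩ := hb'.exists_matrix hb
  have hVU : V * U = 1 := by
    ext j l
    have h1 : ∑ l, (((V * U) j l : ℤ) : ℝ) • b l = ∑ l, (((1 : Matrix _ _ ℤ) j l : ℤ) : ℝ) • b l := by
      have : ∑ l, (((1 : Matrix (Fin m) (Fin m) ℤ) j l : ℤ) : ℝ) • b l = b j := by
        simp [Matrix.one_apply]
      rw [this, hV j]
      simp_rw [hU, Finset.smul_sum, Matrix.mul_apply]
      rw [Finset.sum_comm]
      simp [Finset.sum_smul, mul_smul]
    have h2 := Fintype.linearIndependent_iff.1 hb.1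
      (fun l => (((V * U) j l : ℤ) : ℝ) - (((1 : Matrix _ _ ℤ) j l : ℤ) : ℝ))
      (by simp only [sub_smul, Finset.sum_sub_distrib, h1, sub_self]) l
    exact_mod_cast sub_eq_zero.1 h2
  have hG : Matrix.gram ℝ b' =
      U.map (Int.cast : ℤ → ℝ) * Matrix.gram ℝ b * (U.map (Int.cast : ℤ → ℝ)).transpose := by
    ext i j
    simp only [Matrix.gram_apply, Matrix.mul_apply, Matrix.map_apply, Matrix.transpose_apply]
    rw [hU i, hU j, inner_sum]
    refine Finset.sum_congr rfl fun l _ => ?_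
    rw [sum_inner, Finset.sum_mul]
    refine Finset.sum_congr rfl fun l' _ => ?_
    rw [real_inner_smul_left, real_inner_smul_right]
    ring
  have hd : (U.map (Int.cast : ℤ → ℝ)).det * (U.map (Int.cast : ℤ → ℝ)).det = 1 := by
    have h1 : (U.map (Int.cast : ℤ → ℝ)).det = ((U.det : ℤ) : ℝ) :=
      ((Int.castRingHom ℝ).map_det U).symm
    have h2 : IsUnit U.det := by
      refine IsUnit.of_mul_eq_one V.det ?_
      rw [mul_comm, ← Matrix.det_mul, hVU, Matrix.det_one]
    rw [h1]
    rcases Int.isUnit_iff.1 h2 with h | h <;> simp [h]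
  rw [hG, Matrix.det_mul, Matrix.det_mul, Matrix.det_transpose]
  linear_combination (Matrix.gram ℝ b).det * hd

/-- The determinant may be computed from any basis of the lattice. -/
theorem latticeDet_eq {n m : ℕ} {b : Fin m → EuclideanSpace ℝ (Fin n)}
    {L : Submodule ℤ (EuclideanSpace ℝ (Fin n))} (hb : IsLatticeBasis b L) :
    latticeDet L = √(Matrix.gram ℝ b).det := by
  have h : IsLattice L := ⟨m, b, hb⟩
  rw [latticeDet, dif_pos h, hb.gram_det_eq h.choose_spec.choose_spec]

/-- The normalized determinant `nd(L) = det(L)^{1 / rank(L)}`. -/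
noncomputable def normDet {n : ℕ} (L : Submodule ℤ (EuclideanSpace ℝ (Fin n))) : ℝ :=
  latticeDet L ^ (1 / (latticeRank L : ℝ))

/-- The dual lattice `L* = {x ∈ span L | ⟨x, y⟩ ∈ ℤ for all y ∈ L}`. -/
noncomputable def dualLattice {n : ℕ} (L : Submodule ℤ (EuclideanSpace ℝ (Fin n))) :
    Submodule ℤ (EuclideanSpace ℝ (Fin n)) where
  carrier := {x | x ∈ Submodule.span ℝ (L : Set (EuclideanSpace ℝ (Fin n))) ∧
    ∀ y ∈ L, ∃ z : ℤ, inner ℝ x y = (z : ℝ)}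
  zero_mem' := ⟨Submodule.zero_mem _, fun y _ => ⟨0, by simp⟩⟩
  add_mem' := by
    rintro x x' ⟨hx, hx2⟩ ⟨hx', hx2'⟩
    refine ⟨Submodule.add_mem _ hx hx', fun y hy => ?_⟩
    obtain ⟨z, hz⟩ := hx2 y hy
    obtain ⟨z', hz'⟩ := hx2' y hy
    exact ⟨z + z', by rw [inner_add_left, hz, hz']; push_cast; rfl⟩
  smul_mem' := by
    rintro c x ⟨hx, hx2⟩
    refine ⟨?_, fun y hy => ?_⟩
    · rw [← Int.cast_smul_eq_zsmul ℝ c x]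
      exact Submodule.smul_mem _ _ hx
    · obtain ⟨z, hz⟩ := hx2 y hy
      refine ⟨c * z, ?_⟩
      rw [← Int.cast_smul_eq_zsmul ℝ c x, real_inner_smul_left, hz]
      push_cast
      rfl

/-- `L'` is a primitive sublattice of `L`: it is the intersection of `L` with a subspace. -/
def IsPrimitive {n : ℕ} (L' L : Submodule ℤ (EuclideanSpace ℝ (Fin n))) : Prop :=
  ∃ W : Submodule ℝ (EuclideanSpace ℝ (Fin n)), L ⊓ W.restrictScalars ℤ = L'

/-- The quotient lattice `L / L'`: the orthogonal projection of `L` to `span(L')ᗮ`. -/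
noncomputable def quotLattice {n : ℕ} (L L' : Submodule ℤ (EuclideanSpace ℝ (Fin n))) :
    Submodule ℤ (EuclideanSpace ℝ (Fin n)) :=
  L.map ((Submodule.span ℝ (L' : Set (EuclideanSpace ℝ (Fin n))))ᗮ.starProjection.toLinearMap
    |>.restrictScalars ℤ)

/-- `t`-stability (for `t ≥ 1`). The normalized determinant of the zero lattice is not defined, so
the (nonzero) sublattices are considered. -/
structure IsTStable {n : ℕ} (t : ℝ) (L : Submodule ℤ (EuclideanSpace ℝ (Fin n))) : Prop where
  le_normDet : ∀ M ≤ L, IsLattice M → M ≠ ⊥ → t⁻¹ ≤ normDet M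
  le_normDet_dual : ∀ M ≤ dualLattice L, IsLattice M → M ≠ ⊥ → t⁻¹ ≤ normDet M

/-- For a chain `F 0 ⊂ F 1 ⊂ ⋯ ⊂ F k`, the normalized determinant of `F (i + 1) / F i`. (The index
`i : Fin k` starts at `0`.) -/
noncomputable def quotNormDet {n k : ℕ}
    (F : Fin (k + 1) → Submodule ℤ (EuclideanSpace ℝ (Fin n))) (i : Fin k) : ℝ :=
  normDet (quotLattice (F i.succ) (F i.castSucc))

/-- `{0} = F 0 ⊂ F 1 ⊂ ⋯ ⊂ F k = L` is a `t`-stable filtration of `L`. That each member is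
primitive in the next one is what makes the quotient lattices meaningful. -/
structure IsStableFiltration {n k : ℕ} (t : ℝ) (L : Submodule ℤ (EuclideanSpace ℝ (Fin n)))
    (F : Fin (k + 1) → Submodule ℤ (EuclideanSpace ℝ (Fin n))) : Prop where
  bot : F 0 = ⊥
  top : F (Fin.last k) = L
  strictMono : StrictMono F
  primitive : ∀ i : Fin k, IsPrimitive (F i.castSucc) (F i.succ)
  quotNormDet_strictMono : StrictMono (quotNormDet F)
  stable : ∀ i : Fin k,
    IsTStable t ((quotNormDet F i)⁻¹ • quotLattice (F i.succ) (F i.castSucc))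

/-- A `t`-stable filtration is well-separated if also `r_i ≤ r_{i+2} / 2` for all `i`. -/
structure IsWellSeparatedFiltration {n k : ℕ} (t : ℝ)
    (L : Submodule ℤ (EuclideanSpace ℝ (Fin n)))
    (F : Fin (k + 1) → Submodule ℤ (EuclideanSpace ℝ (Fin n))) : Prop
    extends IsStableFiltration t L F where
  separated : ∀ i j : Fin k, (j : ℕ) = i + 2 → quotNormDet F i ≤ quotNormDet F j / 2

/-! A random access machine over the integers with logarithmic cost.

The memory consists of countably many named arrays of integers. Programs are structured programs.
Every operation is charged the bit lengths of all the numbers that it handles, addresses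
included, so that running times agree with those of Turing machines up to a polynomial. -/

/-- The number of binary digits of `|z|`. -/
def bitLength (z : ℤ) : ℕ := Nat.size z.natAbs

/-- `σ a i` is the content of cell `i` of array `a`. -/
abbrev RamMem : Type := ℕ → ℤ → ℤ

/-- Integer expressions. `read a e` is the content of cell `e` of array `a`. -/
inductive RamExpr : Type
  | const (z : ℤ)
  | read (a : ℕ) (e : RamExpr)
  | add (e₁ e₂ : RamExpr)
  | sub (e₁ e₂ : RamExpr)
  | mul (e₁ e₂ : RamExpr)
  | div (e₁ e₂ : RamExpr)

/-- The value of an expression; division is integer division with remainder (and `x / 0 = 0`). -/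
def RamExpr.val (σ : RamMem) : RamExpr → ℤ
  | const z => z
  | read a e => σ a (e.val σ)
  | add e₁ e₂ => e₁.val σ + e₂.val σ
  | sub e₁ e₂ => e₁.val σ - e₂.val σ
  | mul e₁ e₂ => e₁.val σ * e₂.val σ
  | div e₁ e₂ => e₁.val σ / e₂.val σ

/-- The cost of evaluating an expression. -/
def RamExpr.cost (σ : RamMem) : RamExpr → ℕ
  | const z => 1 + bitLength z
  | read a e => e.cost σ + 1 + bitLength (e.val σ) + bitLength (σ a (e.val σ))
  | add e₁ e₂ => e₁.cost σ + e₂.cost σ + 1 + bitLength (e₁.val σ) + bitLength (e₂.val σ)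
  | sub e₁ e₂ => e₁.cost σ + e₂.cost σ + 1 + bitLength (e₁.val σ) + bitLength (e₂.val σ)
  | mul e₁ e₂ => e₁.cost σ + e₂.cost σ + 1 + bitLength (e₁.val σ) + bitLength (e₂.val σ)
  | div e₁ e₂ => e₁.cost σ + e₂.cost σ + 1 + bitLength (e₁.val σ) + bitLength (e₂.val σ)

/-- Programs. `write a e₁ e₂` stores `e₂` in cell `e₁` of array `a`; `ifPos` and `whilePos` test
whether the expression is positive. -/
inductive RamProg : Type
  | skip
  | write (a : ℕ) (e₁ e₂ : RamExpr)
  | seq (P Q : RamProg)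
  | ifPos (e : RamExpr) (P Q : RamProg)
  | whilePos (e : RamExpr) (P : RamProg)

/-- `RamExec P σ c τ`: started in memory `σ`, the program `P` halts after a run of total cost `c`
in memory `τ`. -/
inductive RamExec : RamProg → RamMem → ℕ → RamMem → Prop
  | skip (σ : RamMem) : RamExec .skip σ 1 σ
  | write (a : ℕ) (e₁ e₂ : RamExpr) (σ : RamMem) :
      RamExec (.write a e₁ e₂) σ
        (e₁.cost σ + e₂.cost σ + 1 + bitLength (e₁.val σ) + bitLength (e₂.val σ))
        (Function.update σ a (Function.update (σ a) (e₁.val σ) (e₂.val σ)))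
  | seq {P Q : RamProg} {σ τ υ : RamMem} {c d : ℕ} :
      RamExec P σ c τ → RamExec Q τ d υ → RamExec (.seq P Q) σ (c + d) υ
  | ifPos_true {e : RamExpr} {P Q : RamProg} {σ τ : RamMem} {c : ℕ} :
      0 < e.val σ → RamExec P σ c τ →
      RamExec (.ifPos e P Q) σ (e.cost σ + 1 + bitLength (e.val σ) + c) τ
  | ifPos_false {e : RamExpr} {P Q : RamProg} {σ τ : RamMem} {c : ℕ} :
      e.val σ ≤ 0 → RamExec Q σ c τ →
      RamExec (.ifPos e P Q) σ (e.cost σ + 1 + bitLength (e.val σ) + c) τ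
  | whilePos_true {e : RamExpr} {P : RamProg} {σ τ υ : RamMem} {c d : ℕ} :
      0 < e.val σ → RamExec P σ c τ → RamExec (.whilePos e P) τ d υ →
      RamExec (.whilePos e P) σ (e.cost σ + 1 + bitLength (e.val σ) + c + d) υ
  | whilePos_false {e : RamExpr} {P : RamProg} {σ : RamMem} :
      e.val σ ≤ 0 → RamExec (.whilePos e P) σ (e.cost σ + 1 + bitLength (e.val σ)) σ

/-- The initial memory on the input `w`: cell `0` of array `0` holds the length of `w`, the
first cells of array `1` hold `w`, and all other cells hold `0`. -/
def ramInput (w : List ℤ) : RamMem := fun a i =>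
  if a = 0 ∧ i = 0 then (w.length : ℤ)
  else if a = 1 ∧ 0 ≤ i then w.getD i.toNat 0
  else 0

/-- The memory `σ` presents the output `w`, in the same format as the input. -/
def RamOutput (σ : RamMem) (w : List ℤ) : Prop :=
  σ 0 0 = (w.length : ℤ) ∧ ∀ i : Fin w.length, σ 1 ((i : ℕ) : ℤ) = w.get i

/-- The encoding length of a list of integers: every entry has its binary digits, a sign and a
separator. -/
def encodingLength (w : List ℤ) : ℕ := (w.map fun z => bitLength z + 2).sum

/-! Chains of rational lattices as inputs. -/

/-- The lattice in `ℝⁿ` that is generated by rational vectors. -/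
noncomputable def ratLattice {n m : ℕ} (b : Fin m → Fin n → ℚ) :
    Submodule ℤ (EuclideanSpace ℝ (Fin n)) :=
  Submodule.span ℤ (Set.range fun j => WithLp.toLp 2 fun c => ((b j c : ℚ) : ℝ))

/-- The encoding of a sequence of rational matrices `B 0, …, B k`, where `B i` consists of `m i`
vectors in `ℚⁿ`: first `n`, `k` and `m 0, …, m k`, then the entries of the matrices, vector by
vector, each as a numerator followed by a denominator. -/
def encodeBases (n k : ℕ) (m : Fin (k + 1) → ℕ) (B : ∀ i, Fin (m i) → Fin n → ℚ) : List ℤ :=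
  [(n : ℤ), (k : ℤ)] ++ (List.finRange (k + 1)).map (fun i => (m i : ℤ)) ++
    (List.finRange (k + 1)).flatMap fun i =>
      (List.finRange (m i)).flatMap fun j =>
        (List.finRange n).flatMap fun c => [(B i j c).num, ((B i j c).den : ℤ)]

/-! Gram determinants. -/

/-! Merging. Open a block at an index `a` and extend it as long as the normalized determinants
satisfy `r_j ≤ 2 r_a`. Determinants multiply along a primitive chain, so the normalized determinant
of a merged quotient is a weighted geometric mean of the `r_j` in the block and stays between the
first one and the last one, which differ by a factor of at most two. Every lattice satisfies `det M
≥ det (M ∩ V) * det (projection of M to Vᗮ)`. Applied to a sublattice of `C / A` with `V = span B`,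
this transfers lower bounds on determinants of sublattices from `B / A` and `C / B` to `C / A`
(`HasDetLowerBound.quot_of_chain`). With `V` the orthogonal complement of `span B` it does the same
for the duals (`HasDetLowerBound.dual_quot_of_chain`). So a merged quotient, rescaled by its own
normalized determinant, loses at most a factor of two in stability (`merged_block`). If `u_j`
denotes the first normalized determinant of block `j`, then the merged values satisfy `u_j ≤ r̃_j <
u_{j+1}` and `2 u_j < u_{j+1}`. This gives both monotonicity and separation at distance two
(`IsGreedyCut.isWellSeparatedFiltration`).

Existence of a `1`-stable filtration. Starting from a primitive `A`, choose a primitive `B` over `A`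
for which `nd (B / A)` is minimal and, among the minimizers, the rank is maximal. The minimum exists
because a lattice has only finitely many primitive sublattices of bounded determinant
(`IsLattice.finite_primitive`). Minimality bounds the sublattices of `B / A`. It also bounds those
of the dual: for `N` in `(B / A)*`, combine minimality for the part of `B` orthogonal to `N` with
the integrality of the pairing between `N` and the projection of `B`. Maximality of the rank makes
the next value strictly larger. Merging this filtration with `t = 1` gives the last claim.

Algorithm. The `r_i` are irrational in general, but after multiplication by a common denominator `D`
the squared determinants `g_i` of the members are integers with `g_{i+1} = g_i * (D r_i) ^ (2 d_i)`,
where `d_i` is the rank of the quotient. Raising `2 r_a < r_i` to the power `2 d_a d_i` turns the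
greedy test into an inequality of integers from which `D` drops out (`blockTest_iff_of_pow`). The
`g_i` are Gram determinants, computed by the Faddeev–LeVerrier recursion, whose divisions are exact
and whose numbers have polynomially many bits. If all loops and all bit lengths are bounded by `W`,
the cost of the program is a fixed polynomial in `W`, and `W` can be taken polynomial in the
encoding length. -/

theorem Matrix.PosSemidef.one_le_det_one_add {ι : Type*} [Fintype ι] [DecidableEq ι]
    {C : Matrix ι ι ℝ} (hC : C.PosSemidef) : 1 ≤ (1 + C).det := by
  have hH : (1 + C).IsHermitian := Matrix.isHermitian_one.add hC.1
  rw [hH.det_eq_prod_eigenvalues]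
  refine Finset.one_le_prod fun i _ => ?_
  have h0 := hC.dotProduct_mulVec_nonneg (hH.eigenvectorBasis i).ofLp
  have h1 := hH.eigenvalues_eq i
  have h2 : star (hH.eigenvectorBasis i).ofLp ⬝ᵥ (hH.eigenvectorBasis i).ofLp = 1 := by
    have := hH.eigenvectorBasis.orthonormal.1 i
    have h3 := EuclideanSpace.real_norm_sq_eq (hH.eigenvectorBasis i)
    rw [this] at h3
    simp only [dotProduct, star_trivial, Pi.star_apply]
    rw [one_pow] at h3
    exact (Finset.sum_congr rfl fun j _ => (sq _).symm).trans h3.symm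
  rw [Matrix.add_mulVec, Matrix.one_mulVec, dotProduct_add, h2] at h1
  simp only [RCLike.re_to_real] at h1
  simp only [RCLike.ofReal_real_eq_id, id]
  linarith

-- If `A` is singular, the claim is that `B.det` is nonnegative. Otherwise `A = Rᴴ R` with `R`
-- invertible, and `B = Rᴴ (1 + C) R` with `C` positive semidefinite.
open scoped Matrix MatrixOrder Matrix.Norms.L2Operator in
theorem Matrix.PosSemidef.det_le_det {ι : Type*} [Fintype ι] [DecidableEq ι]
    {A B : Matrix ι ι ℝ} (hA : A.PosSemidef) (hAB : (B - A).PosSemidef) : A.det ≤ B.det := by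
  have hB : B.PosSemidef := by simpa using hA.add hAB
  by_cases h0 : A.det = 0
  · rw [h0]; exact hB.det_nonneg
  obtain ⟨R, hR⟩ := CStarAlgebra.nonneg_iff_eq_star_mul_self.mp hA.nonneg
  rw [Matrix.star_eq_conjTranspose] at hR
  have hRdet : IsUnit R.det := by
    rw [isUnit_iff_ne_zero]
    intro h
    apply h0
    rw [hR, Matrix.det_mul, h, mul_zero]
  have hC := hAB.conjTranspose_mul_mul_same R⁻¹
  have hB' : B = Rᴴ * (1 + (R⁻¹)ᴴ * (B - A) * R⁻¹) * R := by
    have h1 : R⁻¹ * R = 1 := Matrix.nonsing_inv_mul R hRdet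
    have h2 : Rᴴ * (R⁻¹)ᴴ = 1 := by
      rw [← Matrix.conjTranspose_mul, h1, Matrix.conjTranspose_one]
    calc B = Rᴴ * R + (Rᴴ * (R⁻¹)ᴴ) * (B - A) * (R⁻¹ * R) := by
          rw [h1, h2, ← hR]; simp
      _ = _ := by
        simp only [Matrix.mul_add, Matrix.add_mul, Matrix.mul_one, Matrix.mul_assoc]
  have h1 := hC.one_le_det_one_add
  have h2 : B.det = A.det * (1 + (R⁻¹)ᴴ * (B - A) * R⁻¹).det := by
    have hA' : A.det = Rᴴ.det * R.det := by rw [hR, Matrix.det_mul]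
    rw [hA']
    conv_lhs => rw [hB']
    rw [Matrix.det_mul, Matrix.det_mul]
    ring
  rw [h2]
  exact le_mul_of_one_le_right hA.det_nonneg h1

section Gram

variable {E F ι κ : Type*} [NormedAddCommGroup E] [InnerProductSpace ℝ E]
  [NormedAddCommGroup F] [InnerProductSpace ℝ F] [Fintype ι] [DecidableEq ι] [Fintype κ]
  [DecidableEq κ]

omit [DecidableEq ι] [Fintype κ] [DecidableEq κ] in
theorem gram_linear_combination (v : ι → E) (U : Matrix κ ι ℝ) :
    Matrix.gram ℝ (fun j => ∑ i, U j i • v i) = U * Matrix.gram ℝ v * U.transpose := by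
  ext i j
  simp only [Matrix.gram_apply, Matrix.mul_apply, Matrix.transpose_apply]
  rw [inner_sum]
  refine Finset.sum_congr rfl fun l _ => ?_
  rw [sum_inner, Finset.sum_mul]
  refine Finset.sum_congr rfl fun l' _ => ?_
  rw [real_inner_smul_left, real_inner_smul_right]
  ring

theorem det_gram_nonneg (v : ι → E) : 0 ≤ (Matrix.gram ℝ v).det :=
  (Matrix.posSemidef_gram ℝ v).det_nonneg

theorem det_gram_pos {v : ι → E} (hv : LinearIndependent ℝ v) : 0 < (Matrix.gram ℝ v).det :=
  (Matrix.posDef_gram_of_linearIndependent hv).det_pos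

/-- The matrix `‖f‖² • gram v - gram (f ∘ v)` is positive semidefinite, and the determinant is
monotone. Contractions such as orthogonal projections therefore shrink determinants. -/
theorem det_gram_comp_le (v : ι → E) (f : E →L[ℝ] F) :
    (Matrix.gram ℝ (f ∘ v)).det ≤ (‖f‖ ^ 2) ^ Fintype.card ι * (Matrix.gram ℝ v).det := by
  have h := (Matrix.posSemidef_gram ℝ (f ∘ v)).det_le_det
    (Matrix.posSemidef_opNorm_smul_gram_sub_gram v f)
  rwa [Matrix.det_smul] at h

theorem det_gram_comp_le_of_norm_le_one (v : ι → E) (f : E →L[ℝ] F) (hf : ‖f‖ ≤ 1) :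
    (Matrix.gram ℝ (f ∘ v)).det ≤ (Matrix.gram ℝ v).det :=
  (det_gram_comp_le v f).trans <| mul_le_of_le_one_left (det_gram_nonneg v) <|
    pow_le_one₀ (by positivity) (pow_le_one₀ (by positivity) hf)

theorem det_gram_smul (v : ι → E) (c : ℝ) :
    (Matrix.gram ℝ (fun i => c • v i)).det = (c ^ 2) ^ Fintype.card ι * (Matrix.gram ℝ v).det := by
  have : Matrix.gram ℝ (fun i => c • v i) = c ^ 2 • Matrix.gram ℝ v := by
    ext i j
    simp [inner_smul_left, inner_smul_right]
    ring
  rw [this, Matrix.det_smul]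

/-- Removing from the second family its components in the span of the first one turns the Gram
determinant into a product. -/
theorem det_gram_sum_elim (v : ι → E) (w w' : κ → E)
    (hsub : ∀ j, w j - w' j ∈ Submodule.span ℝ (Set.range v))
    (horth : ∀ i j, inner ℝ (v i) (w' j) = 0) :
    (Matrix.gram ℝ (Sum.elim v w)).det = (Matrix.gram ℝ v).det * (Matrix.gram ℝ w').det := by
  have h : ∀ j, ∃ c : ι → ℝ, ∑ i, c i • v i = w j - w' j := fun j =>
    (Submodule.mem_span_range_iff_exists_fun ℝ).1 (hsub j)
  choose C hC using h
  -- The two families differ by a block triangular matrix of determinant one.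
  have hw : Sum.elim v w = fun j => ∑ i, (Matrix.fromBlocks (1 : Matrix ι ι ℝ) 0 (Matrix.of C) 1) j i
      • Sum.elim v w' i := by
    funext j
    rcases j with j | j
    · simp [Matrix.one_apply]
    · simp [Matrix.one_apply, hC]
  have hb : Matrix.gram ℝ (Sum.elim v w') =
      Matrix.fromBlocks (Matrix.gram ℝ v) 0 0 (Matrix.gram ℝ w') := by
    ext i j
    rcases i with i | i <;> rcases j with j | j <;> simp [horth]
    rw [real_inner_comm, horth]
  rw [hw, gram_linear_combination, Matrix.det_mul, Matrix.det_mul, Matrix.det_transpose,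
    Matrix.det_fromBlocks_zero₁₂, hb, Matrix.det_fromBlocks_zero₁₂]
  simp

/-- If two families span the same space and have integral inner products, then the product of their
Gram determinants is at least one. -/
theorem one_le_det_gram_mul_det_gram {v w : ι → E} (hv : LinearIndependent ℝ v)
    (hw : LinearIndependent ℝ w)
    (hsub : ∀ j, w j ∈ Submodule.span ℝ (Set.range v))
    (hint : ∀ i j, ∃ z : ℤ, inner ℝ (w i) (v j) = (z : ℝ)) :
    1 ≤ (Matrix.gram ℝ w).det * (Matrix.gram ℝ v).det := by
  have h : ∀ j, ∃ c : ι → ℝ, ∑ i, c i • v i = w j := fun j =>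
    (Submodule.mem_span_range_iff_exists_fun ℝ).1 (hsub j)
  choose C hC using h
  choose Z hZ using hint
  have hw' : w = fun j => ∑ i, Matrix.of C j i • v i := by
    funext j; simp [hC]
  have hZC : (Matrix.of Z).map (Int.cast : ℤ → ℝ) = Matrix.of C * Matrix.gram ℝ v := by
    ext i j
    simp only [Matrix.map_apply, Matrix.of_apply, Matrix.mul_apply, Matrix.gram_apply]
    rw [← hZ, ← hC i, sum_inner]
    exact Finset.sum_congr rfl fun l _ => by rw [real_inner_smul_left]
  have hd : (((Matrix.of Z).det : ℤ) : ℝ) = (Matrix.of C).det * (Matrix.gram ℝ v).det := by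
    rw [← Matrix.det_mul, ← hZC]
    exact (Int.castRingHom ℝ).map_det (Matrix.of Z)
  have hg : (Matrix.gram ℝ w).det = (Matrix.of C).det ^ 2 * (Matrix.gram ℝ v).det := by
    conv_lhs => rw [hw']
    rw [gram_linear_combination, Matrix.det_mul, Matrix.det_mul, Matrix.det_transpose]
    ring
  have hpos := det_gram_pos hw
  have hposv := det_gram_pos hv
  -- With `w = C v` the integer matrix of inner products is `Z = C * gram v`, so the product of the
  -- Gram determinants is `(det Z)²`: a positive integer.
  have hsq : (Matrix.gram ℝ w).det * (Matrix.gram ℝ v).det = (((Matrix.of Z).det ^ 2 : ℤ) : ℝ) := by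
    rw [Int.cast_pow]
    rw [hd, hg]; ring
  rw [hsq]
  have : (0 : ℝ) < (((Matrix.of Z).det ^ 2 : ℤ) : ℝ) := by rw [← hsq]; positivity
  have h1 : 0 < (Matrix.of Z).det ^ 2 := Int.cast_pos.1 this
  exact_mod_cast h1

end Gram

/-! Bases, ranks and determinants of lattices. -/

section Lattice

variable {n : ℕ}

theorem isLatticeBasis_of_equiv {ι : Type*} [Fintype ι] {v : ι → EuclideanSpace ℝ (Fin n)} {L : Submodule ℤ (EuclideanSpace ℝ (Fin n))}
    (hv : LinearIndependent ℝ v) (hs : Submodule.span ℤ (Set.range v) = L) :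
    IsLatticeBasis (v ∘ (Fintype.equivFin ι).symm) L :=
  ⟨hv.comp _ (Fintype.equivFin ι).symm.injective, by
    rw [← hs, Set.range_comp, (Fintype.equivFin ι).symm.range_eq_univ, Set.image_univ]⟩

theorem isLattice_of_span_eq {ι : Type*} [Fintype ι] {v : ι → EuclideanSpace ℝ (Fin n)} {L : Submodule ℤ (EuclideanSpace ℝ (Fin n))}
    (hv : LinearIndependent ℝ v) (hs : Submodule.span ℤ (Set.range v) = L) : IsLattice L :=
  ⟨_, _, isLatticeBasis_of_equiv hv hs⟩

theorem latticeDet_eq_of_span_eq {ι : Type*} [Fintype ι] [DecidableEq ι] {v : ι → EuclideanSpace ℝ (Fin n)}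
    {L : Submodule ℤ (EuclideanSpace ℝ (Fin n))} (hv : LinearIndependent ℝ v) (hs : Submodule.span ℤ (Set.range v) = L) :
    latticeDet L = √(Matrix.gram ℝ v).det := by
  rw [latticeDet_eq (isLatticeBasis_of_equiv hv hs)]
  congr 1
  exact Matrix.det_submatrix_equiv_self (Fintype.equivFin ι).symm (Matrix.gram ℝ v)

theorem latticeDet_sq_of_span_eq {ι : Type*} [Fintype ι] [DecidableEq ι] {v : ι → EuclideanSpace ℝ (Fin n)}
    {L : Submodule ℤ (EuclideanSpace ℝ (Fin n))} (hv : LinearIndependent ℝ v) (hs : Submodule.span ℤ (Set.range v) = L) :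
    latticeDet L ^ 2 = (Matrix.gram ℝ v).det := by
  rw [latticeDet_eq_of_span_eq hv hs, Real.sq_sqrt (det_gram_nonneg v)]

theorem linearIndependent_int {ι : Type*} {v : ι → EuclideanSpace ℝ (Fin n)} (hv : LinearIndependent ℝ v) :
    LinearIndependent ℤ v :=
  hv.restrict_scalars fun x y h => by
    simpa only [zsmul_eq_mul, mul_one, Int.cast_inj] using h

theorem latticeRank_eq_of_span_eq {ι : Type*} [Fintype ι] {v : ι → EuclideanSpace ℝ (Fin n)}
    {L : Submodule ℤ (EuclideanSpace ℝ (Fin n))} (hv : LinearIndependent ℝ v) (hs : Submodule.span ℤ (Set.range v) = L) :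
    latticeRank L = Fintype.card ι := by
  rw [latticeRank, ← hs, finrank_span_eq_card (linearIndependent_int hv)]

theorem span_real_eq_of_span_eq {ι : Type*} {v : ι → EuclideanSpace ℝ (Fin n)}
    {L : Submodule ℤ (EuclideanSpace ℝ (Fin n))} (hs : Submodule.span ℤ (Set.range v) = L) :
    Submodule.span ℝ (L : Set (EuclideanSpace ℝ (Fin n))) = Submodule.span ℝ (Set.range v) := by
  rw [← hs, Submodule.span_span_of_tower]

theorem IsLattice.finrank_span {L : Submodule ℤ (EuclideanSpace ℝ (Fin n))} (hL : IsLattice L) :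
    Module.finrank ℝ (Submodule.span ℝ (L : Set (EuclideanSpace ℝ (Fin n)))) = latticeRank L := by
  obtain ⟨m, b, hb⟩ := hL
  rw [span_real_eq_of_span_eq hb.2, finrank_span_eq_card hb.1, latticeRank_eq_of_span_eq hb.1 hb.2]

theorem IsLattice.det_pos {L : Submodule ℤ (EuclideanSpace ℝ (Fin n))} (hL : IsLattice L) : 0 < latticeDet L := by
  obtain ⟨m, b, hb⟩ := hL
  rw [latticeDet_eq hb]
  exact Real.sqrt_pos.2 (det_gram_pos hb.1)

theorem latticeDet_nonneg (L : Submodule ℤ (EuclideanSpace ℝ (Fin n))) : 0 ≤ latticeDet L := by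
  rw [latticeDet]
  split_ifs
  · exact Real.sqrt_nonneg _
  · exact le_rfl

theorem latticeRank_bot : latticeRank (⊥ : Submodule ℤ (EuclideanSpace ℝ (Fin n))) = 0 := by
  simp [latticeRank]

theorem latticeDet_bot : latticeDet (⊥ : Submodule ℤ (EuclideanSpace ℝ (Fin n))) = 1 := by
  rw [latticeDet_eq_of_span_eq (ι := Fin 0) (v := Fin.elim0) linearIndependent_empty_type (by simp)]
  simp

theorem IsLattice.rank_eq_zero {L : Submodule ℤ (EuclideanSpace ℝ (Fin n))} (hL : IsLattice L) :
    latticeRank L = 0 ↔ L = ⊥ := by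
  refine ⟨fun h => ?_, fun h => h ▸ latticeRank_bot⟩
  obtain ⟨m, b, hb⟩ := hL
  rw [latticeRank_eq_of_span_eq hb.1 hb.2, Fintype.card_fin] at h
  subst h
  rw [← hb.2]
  simp

theorem IsLattice.rank_pos {L : Submodule ℤ (EuclideanSpace ℝ (Fin n))} (hL : IsLattice L) (h : L ≠ ⊥) :
    0 < latticeRank L :=
  Nat.pos_of_ne_zero fun h0 => h (hL.rank_eq_zero.1 h0)

/-- Vectors of a lattice that are independent over the integers are independent over the reals. -/
theorem IsLattice.linearIndependent_real {L : Submodule ℤ (EuclideanSpace ℝ (Fin n))} (hL : IsLattice L) {ι : Type*}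
    {v : ι → EuclideanSpace ℝ (Fin n)} (hv : ∀ i, v i ∈ L) (hi : LinearIndependent ℤ v) : LinearIndependent ℝ v := by
  obtain ⟨m, b, hb⟩ := hL
  have h : ∀ i, ∃ c : Fin m → ℤ, ∑ j, c j • b j = v i := fun i =>
    (Submodule.mem_span_range_iff_exists_fun ℤ).1 (by rw [hb.2]; exact hv i)
  choose U hU using h
  have hUi : LinearIndependent ℤ U := by
    refine LinearIndependent.of_comp (Fintype.linearCombination ℤ b) ?_
    have : (Fintype.linearCombination ℤ b) ∘ U = v := by
      funext i
      simp [Fintype.linearCombination_apply, hU]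
    rwa [this]
  -- Integer coordinate vectors independent over `ℤ` stay independent over `ℝ`; the injective map
  -- from coordinates to vectors does the rest.
  have h1 : LinearIndependent ℝ (fun i => algebraMap ℤ ℝ ∘ U i) :=
    linearIndependent_algebraMap_comp_iff.2 hUi
  have h2 := h1.map' (Fintype.linearCombination ℝ b) (by
    rw [LinearMap.ker_eq_bot']
    intro x hx
    rw [Fintype.linearCombination_apply] at hx
    exact funext (Fintype.linearIndependent_iff.1 hb.1 x hx))
  have : (Fintype.linearCombination ℝ b) ∘ (fun i => algebraMap ℤ ℝ ∘ U i) = v := by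
    funext i
    simp [Fintype.linearCombination_apply, ← hU, Int.cast_smul_eq_zsmul]
  rwa [this] at h2

/-- Torsion-freeness makes finitely generated subgroups free, which `Module.finBasis` requires. -/
theorem isAddTorsionFree_euclideanSpace : IsAddTorsionFree (EuclideanSpace ℝ (Fin n)) := by
  have : Module ℚ (EuclideanSpace ℝ (Fin n)) := Module.compHom (EuclideanSpace ℝ (Fin n)) (algebraMap ℚ ℝ)
  exact .of_module_rat _

/-- A subgroup of a finitely generated free abelian group is finitely generated and free; its
integral basis is independent over `ℝ` because it lies in `L`. -/
theorem IsLattice.of_le {L M : Submodule ℤ (EuclideanSpace ℝ (Fin n))} (hL : IsLattice L) (h : M ≤ L) : IsLattice M := by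
  have hfg : L.FG := by
    obtain ⟨m, b, hb⟩ := hL
    rw [← hb.2]
    exact Submodule.fg_span (Set.finite_range b)
  have : Module.Finite ℤ L := Module.Finite.of_fg hfg
  have : IsNoetherian ℤ L := isNoetherian_of_isNoetherianRing_of_finite ℤ L
  have hM : Module.Finite ℤ M := Module.Finite.of_injective (Submodule.inclusion h)
    (Submodule.inclusion_injective h)
  have := isAddTorsionFree_euclideanSpace (n := n)
  let b := Module.finBasis ℤ M
  refine isLattice_of_span_eq (v := fun i => (b i : EuclideanSpace ℝ (Fin n)))
    (hL.linearIndependent_real (fun i => h (b i).2) ?_) ?_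
  · exact b.linearIndependent.map' M.subtype (Submodule.ker_subtype M)
  · have : (Set.range fun i => (b i : EuclideanSpace ℝ (Fin n))) = M.subtype '' Set.range b := by
      rw [← Set.range_comp]; rfl
    rw [this, ← Submodule.map_span, b.span_eq, Submodule.map_top, Submodule.range_subtype]

theorem latticeRank_mono {L M : Submodule ℤ (EuclideanSpace ℝ (Fin n))} (hL : IsLattice L) (h : M ≤ L) :
    latticeRank M ≤ latticeRank L := by
  rw [← hL.finrank_span, ← (hL.of_le h).finrank_span]
  exact Submodule.finrank_mono (Submodule.span_mono h)

/-- The orthogonal projection onto a subspace, as an additive map. -/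
noncomputable def projInt (V : Submodule ℝ (EuclideanSpace ℝ (Fin n))) : EuclideanSpace ℝ (Fin n) →ₗ[ℤ] (EuclideanSpace ℝ (Fin n)) :=
  V.starProjection.toLinearMap.restrictScalars ℤ

theorem projInt_apply (V : Submodule ℝ (EuclideanSpace ℝ (Fin n))) (x : EuclideanSpace ℝ (Fin n)) : projInt V x = V.starProjection x := rfl

theorem quotLattice_eq (L L' : Submodule ℤ (EuclideanSpace ℝ (Fin n))) :
    quotLattice L L' = L.map (projInt (Submodule.span ℝ (L' : Set (EuclideanSpace ℝ (Fin n))))ᗮ) := rfl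

theorem sub_projInt_orthogonal_mem (V : Submodule ℝ (EuclideanSpace ℝ (Fin n))) (x : EuclideanSpace ℝ (Fin n)) : x - projInt Vᗮ x ∈ V := by
  rw [projInt_apply, Submodule.starProjection_orthogonal_val, sub_sub_cancel]
  exact Submodule.starProjection_apply_mem V x

theorem projInt_orthogonal_eq_zero {V : Submodule ℝ (EuclideanSpace ℝ (Fin n))} {x : EuclideanSpace ℝ (Fin n)} : projInt Vᗮ x = 0 ↔ x ∈ V := by
  rw [projInt_apply, Submodule.starProjection_apply_eq_zero_iff, Submodule.orthogonal_orthogonal]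

theorem projInt_mem (V : Submodule ℝ (EuclideanSpace ℝ (Fin n))) (x : EuclideanSpace ℝ (Fin n)) : projInt V x ∈ V :=
  Submodule.starProjection_apply_mem V x

theorem span_map_projInt (V : Submodule ℝ (EuclideanSpace ℝ (Fin n))) (M : Submodule ℤ (EuclideanSpace ℝ (Fin n))) :
    Submodule.span ℝ ((M.map (projInt V) : Submodule ℤ (EuclideanSpace ℝ (Fin n))) : Set (EuclideanSpace ℝ (Fin n))) =
      (Submodule.span ℝ (M : Set (EuclideanSpace ℝ (Fin n)))).map V.starProjection.toLinearMap := by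
  rw [Submodule.map_span]
  rfl

section Extend

variable {M : Submodule ℤ (EuclideanSpace ℝ (Fin n))} {V : Submodule ℝ (EuclideanSpace ℝ (Fin n))} {ι κ : Type*} {b : ι → EuclideanSpace ℝ (Fin n)} {c : κ → EuclideanSpace ℝ (Fin n)}

/-- Generators of the kernel of the projection on `M`, together with lifts of generators of its
image, generate `M`: subtracting a lift from `x` leaves an element of `V`. -/
theorem span_sum_elim_eq (hb : Submodule.span ℤ (Set.range b) = M ⊓ V.restrictScalars ℤ)
    (hc : ∀ j, c j ∈ M)
    (hcs : Submodule.span ℤ (Set.range fun j => projInt Vᗮ (c j)) = M.map (projInt Vᗮ)) :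
    Submodule.span ℤ (Set.range (Sum.elim b c)) = M := by
  rw [Set.Sum.elim_range, Submodule.span_union]
  apply le_antisymm
  · refine sup_le (hb.le.trans inf_le_left) (Submodule.span_le.2 ?_)
    rintro _ ⟨j, rfl⟩
    exact hc j
  · intro x hx
    have h1 : projInt Vᗮ x ∈ (Submodule.span ℤ (Set.range c)).map (projInt Vᗮ) := by
      rw [Submodule.map_span, ← Set.range_comp]
      exact hcs.ge (Submodule.mem_map_of_mem hx)
    obtain ⟨y, hy, hxy⟩ := Submodule.mem_map.1 h1
    have hyM : y ∈ M := (Submodule.span_le.2 (by rintro _ ⟨j, rfl⟩; exact hc j)) hy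
    have h2 : x - y ∈ M ⊓ V.restrictScalars ℤ := by
      refine ⟨M.sub_mem hx hyM, ?_⟩
      rw [SetLike.mem_coe, Submodule.restrictScalars_mem, ← projInt_orthogonal_eq_zero, map_sub,
        hxy, sub_self]
    rw [← hb] at h2
    rw [← sub_add_cancel x y]
    exact Submodule.add_mem_sup h2 hy

/-- The scalars are left open because the statement is needed both over `ℝ` and over `ℤ`. -/
theorem linearIndependent_sum_elim (R : Type*) [Ring R] [Module R (EuclideanSpace ℝ (Fin n))]
    (φ : EuclideanSpace ℝ (Fin n) →ₗ[R] (EuclideanSpace ℝ (Fin n))) (hb : LinearIndependent R b) (hbV : ∀ i, φ (b i) = 0)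
    (hc : LinearIndependent R fun j => φ (c j)) :
    LinearIndependent R (Sum.elim b c) := by
  refine hb.sum_type (LinearIndependent.of_comp φ hc) ?_
  rw [Submodule.disjoint_def]
  intro x hx1 hx2
  have h0 : φ x = 0 := by
    have : Submodule.span R (Set.range b) ≤ LinearMap.ker φ := by
      rw [Submodule.span_le]
      rintro _ ⟨i, rfl⟩
      exact hbV i
    exact this hx1
  obtain ⟨l, rfl⟩ := (Finsupp.mem_span_range_iff_exists_finsupp).1 hx2
  simp only [Finsupp.sum, map_sum, map_smul] at h0
  have hl : l = 0 := linearIndependent_iff.1 hc l (by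
    rw [Finsupp.linearCombination_apply]; exact h0)
  simp [hl]

end Extend

/-- Rank and determinant of a lattice in terms of its intersection with a subspace and its
projection to the orthogonal complement. -/
theorem IsLattice.rank_add_rank_and_det_mul_det_le {M : Submodule ℤ (EuclideanSpace ℝ (Fin n))} (hM : IsLattice M)
    (V : Submodule ℝ (EuclideanSpace ℝ (Fin n))) (hQ : IsLattice (M.map (projInt Vᗮ))) :
    latticeRank M = latticeRank (M ⊓ V.restrictScalars ℤ) + latticeRank (M.map (projInt Vᗮ)) ∧
    latticeDet (M ⊓ V.restrictScalars ℤ) * latticeDet (M.map (projInt Vᗮ)) ≤ latticeDet M ∧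
    (Submodule.span ℝ ((M ⊓ V.restrictScalars ℤ : Submodule ℤ (EuclideanSpace ℝ (Fin n))) : Set (EuclideanSpace ℝ (Fin n))) = V →
      latticeDet M = latticeDet (M ⊓ V.restrictScalars ℤ) * latticeDet (M.map (projInt Vᗮ))) := by
  obtain ⟨r, b, hb⟩ := hM.of_le (M := M ⊓ V.restrictScalars ℤ) inf_le_left
  obtain ⟨s, c', hc'⟩ := hQ
  have hlift : ∀ j, ∃ c ∈ M, projInt Vᗮ c = c' j := fun j =>
    Submodule.mem_map.1 (hc'.2.le (Submodule.subset_span ⟨j, rfl⟩))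
  choose c hcM hc using hlift
  have hbV : ∀ i, b i ∈ V := fun i => by
    have := hb.2.le (Submodule.subset_span ⟨i, rfl⟩)
    exact this.2
  have hc2 : (fun j => projInt Vᗮ (c j)) = c' := funext hc
  have hspan : Submodule.span ℤ (Set.range (Sum.elim b c)) = M :=
    span_sum_elim_eq hb.2 hcM (by rw [hc2]; exact hc'.2)
  have hli : LinearIndependent ℝ (Sum.elim b c) :=
    linearIndependent_sum_elim ℝ Vᗮ.starProjection.toLinearMap hb.1
      (fun i => projInt_orthogonal_eq_zero.2 (hbV i)) (by
        have : (fun j => Vᗮ.starProjection.toLinearMap (c j)) = c' := hc2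
        rw [this]; exact hc'.1)
  -- The intersection may span a proper subspace `W` of `V`. Projecting along `W` gives an exact
  -- product of determinants; passing on to `Vᗮ` can only shrink the second factor, and does nothing
  -- when `W = V`.
  set W := Submodule.span ℝ (Set.range b) with hW
  have hWV : W ≤ V := Submodule.span_le.2 (Set.range_subset_iff.2 hbV)
  set w' : Fin s → EuclideanSpace ℝ (Fin n) := fun j => projInt Wᗮ (c j) with hw'
  have hdet : (Matrix.gram ℝ (Sum.elim b c)).det =
      (Matrix.gram ℝ b).det * (Matrix.gram ℝ w').det := by
    refine det_gram_sum_elim b c w' (fun j => sub_projInt_orthogonal_mem W (c j)) fun i j => ?_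
    have hi : b i ∈ W := Submodule.subset_span ⟨i, rfl⟩
    exact Submodule.inner_right_of_mem_orthogonal hi (projInt_mem Wᗮ (c j))
  have hcw : Vᗮ.starProjection ∘ w' = c' := by
    funext j
    have h1 : projInt Vᗮ (c j - w' j) = 0 :=
      projInt_orthogonal_eq_zero.2 (hWV (sub_projInt_orthogonal_mem W (c j)))
    rw [map_sub, sub_eq_zero, hc] at h1
    exact h1.symm
  have hM' := latticeDet_eq_of_span_eq hli hspan
  have hbdet := latticeDet_eq_of_span_eq hb.1 hb.2
  have hcdet := latticeDet_eq_of_span_eq hc'.1 hc'.2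
  refine ⟨?_, ?_, fun hV => ?_⟩
  · rw [latticeRank_eq_of_span_eq hli hspan, latticeRank_eq_of_span_eq hb.1 hb.2,
      latticeRank_eq_of_span_eq hc'.1 hc'.2]
    simp
  · rw [hM', hbdet, hcdet, hdet, ← Real.sqrt_mul (det_gram_nonneg b)]
    refine Real.sqrt_le_sqrt (mul_le_mul_of_nonneg_left ?_ (det_gram_nonneg b))
    rw [← hcw]
    exact det_gram_comp_le_of_norm_le_one w' _ (Submodule.starProjection_norm_le _)
  · rw [span_real_eq_of_span_eq hb.2] at hV
    have : w' = c' := by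
      rw [← hc2, hw', ← hV]
    rw [hM', hbdet, hcdet, hdet, ← Real.sqrt_mul (det_gram_nonneg b), this]

theorem IsPrimitive.le {L' L : Submodule ℤ (EuclideanSpace ℝ (Fin n))} (h : IsPrimitive L' L) : L' ≤ L := by
  obtain ⟨W, rfl⟩ := h
  exact inf_le_left

/-- The subspace in the definition may always be taken to be the smallest possible one. -/
theorem IsPrimitive.inf_span {L' L : Submodule ℤ (EuclideanSpace ℝ (Fin n))} (h : IsPrimitive L' L) :
    L ⊓ (Submodule.span ℝ (L' : Set (EuclideanSpace ℝ (Fin n)))).restrictScalars ℤ = L' := by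
  obtain ⟨W, rfl⟩ := h
  apply le_antisymm
  · refine le_inf inf_le_left (inf_le_right.trans ?_)
    change Submodule.span ℝ _ ≤ W
    exact Submodule.span_le.2 fun x hx => hx.2
  · exact le_inf inf_le_left fun x hx => Submodule.subset_span hx

/-- Projecting along a subspace spanned by lattice vectors preserves discreteness. Lifts of an
integral basis of the image, joined to a basis of `L'`, are independent in `L` over `ℤ`, hence over
`ℝ`; a real relation in the image would put a combination of the lifts into the span of `L'`. -/
theorem IsPrimitive.isLattice_quotLattice {L' L : Submodule ℤ (EuclideanSpace ℝ (Fin n))} (h : IsPrimitive L' L)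
    (hL : IsLattice L) : IsLattice (quotLattice L L') := by
  have hfg : L.FG := by
    obtain ⟨m, b, hb⟩ := hL
    rw [← hb.2]
    exact Submodule.fg_span (Set.finite_range b)
  rw [quotLattice_eq]
  set V := Submodule.span ℝ (L' : Set (EuclideanSpace ℝ (Fin n))) with hV
  obtain ⟨r, b, hb⟩ := hL.of_le h.le
  have hfin : Module.Finite ℤ (L.map (projInt Vᗮ)) := Module.Finite.of_fg (hfg.map _)
  have := isAddTorsionFree_euclideanSpace (n := n)
  let q := Module.finBasis ℤ (L.map (projInt Vᗮ))
  have hlift : ∀ j, ∃ c ∈ L, projInt Vᗮ c = q j := fun j => Submodule.mem_map.1 (q j).2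
  choose c hcM hc using hlift
  have hqi : LinearIndependent ℤ fun j => (q j : EuclideanSpace ℝ (Fin n)) :=
    q.linearIndependent.map' (L.map (projInt Vᗮ)).subtype (Submodule.ker_subtype _)
  have hqs : Submodule.span ℤ (Set.range fun j => (q j : EuclideanSpace ℝ (Fin n))) = L.map (projInt Vᗮ) := by
    have : (Set.range fun i => (q i : EuclideanSpace ℝ (Fin n))) = (L.map (projInt Vᗮ)).subtype '' Set.range q := by
      rw [← Set.range_comp]; rfl
    rw [this, ← Submodule.map_span, q.span_eq, Submodule.map_top, Submodule.range_subtype]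
  have hbL : ∀ i, b i ∈ L' := fun i => hb.2.le (Submodule.subset_span ⟨i, rfl⟩)
  have hbV : ∀ i, b i ∈ V := fun i => Submodule.subset_span (hbL i)
  have hVb : V = Submodule.span ℝ (Set.range b) := span_real_eq_of_span_eq hb.2
  have hli : LinearIndependent ℝ (Sum.elim b c) := by
    refine hL.linearIndependent_real (by rintro (i | j); exacts [h.le (hbL i), hcM j]) ?_
    refine linearIndependent_sum_elim ℤ (projInt Vᗮ)
      (linearIndependent_int hb.1)
      (fun i => projInt_orthogonal_eq_zero.2 (hbV i)) ?_
    simp only [hc]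
    exact hqi
  refine isLattice_of_span_eq (v := fun j => (q j : EuclideanSpace ℝ (Fin n))) ?_ hqs
  rw [Fintype.linearIndependent_iff]
  intro g hg j
  have h1 : ∑ j, g j • c j ∈ V := by
    rw [← projInt_orthogonal_eq_zero, projInt_apply, map_sum, ← hg]
    refine Finset.sum_congr rfl fun j _ => ?_
    rw [map_smul, ← hc j]
    rfl
  replace h1 := hVb.le h1
  have h2 := (linearIndependent_sum.1 hli).2.2
  have h3 : ∑ j, g j • c j = 0 := by
    refine Submodule.disjoint_def.1 h2 _ h1 (Submodule.sum_mem _ fun j _ => ?_)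
    exact Submodule.smul_mem _ _ (Submodule.subset_span ⟨j, rfl⟩)
  exact Fintype.linearIndependent_iff.1 (linearIndependent_sum.1 hli).2.1 g h3 j

end Lattice

/-! Scaling, duality and stability. -/

section Stability

variable {n : ℕ}

/-- This form avoids roots and includes the zero lattice, where both sides are one. -/
theorem IsLattice.normDet_pow_rank {L : Submodule ℤ (EuclideanSpace ℝ (Fin n))}
    (hL : IsLattice L) : normDet L ^ latticeRank L = latticeDet L := by
  rcases Nat.eq_zero_or_pos (latticeRank L) with h | h
  · rw [h, pow_zero, hL.rank_eq_zero.1 h, latticeDet_bot]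
  · rw [normDet, one_div, Real.rpow_inv_natCast_pow hL.det_pos.le h.ne']

theorem IsLattice.normDet_pos {L : Submodule ℤ (EuclideanSpace ℝ (Fin n))}
    (hL : IsLattice L) : 0 < normDet L :=
  Real.rpow_pos_of_pos hL.det_pos _

theorem IsLattice.le_normDet_iff {L : Submodule ℤ (EuclideanSpace ℝ (Fin n))}
    (hL : IsLattice L) (h0 : L ≠ ⊥) {s : ℝ} (hs : 0 ≤ s) :
    s ≤ normDet L ↔ s ^ latticeRank L ≤ latticeDet L := by
  rw [← hL.normDet_pow_rank, pow_le_pow_iff_left₀ hs hL.normDet_pos.le (hL.rank_pos h0).ne']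

theorem IsLattice.normDet_le_iff {L : Submodule ℤ (EuclideanSpace ℝ (Fin n))}
    (hL : IsLattice L) (h0 : L ≠ ⊥) {s : ℝ} (hs : 0 ≤ s) :
    normDet L ≤ s ↔ latticeDet L ≤ s ^ latticeRank L := by
  rw [← hL.normDet_pow_rank, pow_le_pow_iff_left₀ hL.normDet_pos.le hs (hL.rank_pos h0).ne']

theorem mem_smul_lattice {c : ℝ} (hc : c ≠ 0) {L : Submodule ℤ (EuclideanSpace ℝ (Fin n))}
    {x : EuclideanSpace ℝ (Fin n)} : x ∈ c • L ↔ c⁻¹ • x ∈ L := by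
  rw [← SetLike.mem_coe, Submodule.coe_pointwise_smul, Set.mem_smul_set_iff_inv_smul_mem₀ hc]
  rfl

theorem span_smul_lattice {c : ℝ} (hc : c ≠ 0) (L : Submodule ℤ (EuclideanSpace ℝ (Fin n))) :
    Submodule.span ℝ ((c • L : Submodule ℤ (EuclideanSpace ℝ (Fin n))) :
      Set (EuclideanSpace ℝ (Fin n))) = Submodule.span ℝ (L : Set (EuclideanSpace ℝ (Fin n))) := by
  rw [Submodule.coe_pointwise_smul, Submodule.span_smul_eq_of_isUnit _ _ (isUnit_iff_ne_zero.2 hc)]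

theorem IsLatticeBasis.smul {m : ℕ} {b : Fin m → EuclideanSpace ℝ (Fin n)}
    {L : Submodule ℤ (EuclideanSpace ℝ (Fin n))} (hb : IsLatticeBasis b L) {c : ℝ} (hc : c ≠ 0) :
    IsLatticeBasis (fun i => c • b i) (c • L) := by
  refine ⟨hb.1.units_smul fun _ => Units.mk0 c hc, ?_⟩
  rw [← hb.2]
  change _ = Submodule.map _ _
  rw [Submodule.map_span, ← Set.range_comp]
  rfl

theorem IsLattice.smul {L : Submodule ℤ (EuclideanSpace ℝ (Fin n))} (hL : IsLattice L) {c : ℝ}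
    (hc : c ≠ 0) : IsLattice (c • L) := by
  obtain ⟨m, b, hb⟩ := hL
  exact ⟨m, _, hb.smul hc⟩

theorem IsLattice.rank_smul {L : Submodule ℤ (EuclideanSpace ℝ (Fin n))} (hL : IsLattice L) {c : ℝ}
    (hc : c ≠ 0) : latticeRank (c • L) = latticeRank L := by
  rw [← hL.finrank_span, ← (hL.smul hc).finrank_span, span_smul_lattice hc]

theorem IsLattice.det_smul {L : Submodule ℤ (EuclideanSpace ℝ (Fin n))} (hL : IsLattice L) {c : ℝ}
    (hc : 0 < c) : latticeDet (c • L) = c ^ latticeRank L * latticeDet L := by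
  obtain ⟨m, b, hb⟩ := hL
  rw [latticeDet_eq hb, latticeDet_eq (hb.smul hc.ne'), latticeRank_eq_of_span_eq hb.1 hb.2,
    det_gram_smul, Real.sqrt_mul (by positivity), ← pow_mul, mul_comm 2, pow_mul,
    Real.sqrt_sq (by positivity)]

theorem dualLattice_smul {c : ℝ} (hc : c ≠ 0) (L : Submodule ℤ (EuclideanSpace ℝ (Fin n))) :
    dualLattice (c • L) = c⁻¹ • dualLattice L := by
  ext x
  rw [mem_smul_lattice (inv_ne_zero hc), inv_inv]
  change x ∈ Submodule.span ℝ _ ∧ _ ↔ c • x ∈ Submodule.span ℝ _ ∧ _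
  rw [span_smul_lattice hc]
  refine and_congr (Submodule.smul_mem_iff _ hc).symm ⟨fun h y hy => ?_, fun h y hy => ?_⟩
  · obtain ⟨z, hz⟩ := h (c • y) ((mem_smul_lattice hc).2 (by rwa [inv_smul_smul₀ hc]))
    exact ⟨z, by rw [← hz, real_inner_smul_left, real_inner_smul_right]⟩
  · obtain ⟨z, hz⟩ := h _ ((mem_smul_lattice hc).1 hy)
    refine ⟨z, ?_⟩
    rw [← hz, real_inner_smul_left, real_inner_smul_right, mul_inv_cancel_left₀ hc]

/-- All sublattices have normalized determinant at least `s`. -/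
def HasDetLowerBound (s : ℝ) (L : Submodule ℤ (EuclideanSpace ℝ (Fin n))) : Prop :=
  ∀ M ≤ L, IsLattice M → s ^ latticeRank M ≤ latticeDet M

theorem HasDetLowerBound.mono {s s' : ℝ} {L : Submodule ℤ (EuclideanSpace ℝ (Fin n))}
    (h : HasDetLowerBound s L) (hs' : 0 ≤ s') (hss : s' ≤ s) : HasDetLowerBound s' L :=
  fun M hM hl => (pow_le_pow_left₀ hs' hss _).trans (h M hM hl)

theorem hasDetLowerBound_bot (s : ℝ) :
    HasDetLowerBound s (⊥ : Submodule ℤ (EuclideanSpace ℝ (Fin n))) := by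
  intro M hM _
  rw [le_bot_iff.1 hM, latticeRank_bot, latticeDet_bot, pow_zero]

/-- A scaling of the lattice is traded for a scaling of the bound. The zero lattice, excluded on the
left, satisfies the power form on the right automatically. -/
theorem forall_le_normDet_smul_iff {a c : ℝ} (ha : 0 ≤ a) (hc : 0 < c)
    {L : Submodule ℤ (EuclideanSpace ℝ (Fin n))} :
    (∀ M ≤ c • L, IsLattice M → M ≠ ⊥ → a ≤ normDet M) ↔ HasDetLowerBound (c⁻¹ * a) L := by
  constructor
  · intro h M hM hl
    by_cases h0 : M = ⊥
    · rw [h0, latticeRank_bot, latticeDet_bot, pow_zero]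
    have h1 : c • M ≠ ⊥ := fun h1 => h0 <| by
      rw [← hl.rank_eq_zero, ← hl.rank_smul hc.ne', h1, latticeRank_bot]
    have h2 := h (c • M) (Submodule.map_mono hM) (hl.smul hc.ne') h1
    rw [(hl.smul hc.ne').le_normDet_iff h1 ha, hl.rank_smul hc.ne', hl.det_smul hc] at h2
    rw [mul_pow, inv_pow]
    rwa [inv_mul_le_iff₀ (by positivity)]
  · intro h M hM hl h0
    have h1 : c⁻¹ • M ≤ L := fun x hx => by
      have := hM ((mem_smul_lattice (inv_ne_zero hc.ne')).1 hx)
      rwa [inv_inv, mem_smul_lattice hc.ne', inv_smul_smul₀ hc.ne'] at this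
    have h2 := h _ h1 (hl.smul (inv_ne_zero hc.ne'))
    rw [hl.rank_smul (inv_ne_zero hc.ne'), hl.det_smul (inv_pos.2 hc), mul_pow] at h2
    exact (hl.le_normDet_iff h0 ha).2 (le_of_mul_le_mul_left h2 (by positivity))

theorem isTStable_inv_smul_iff {t c : ℝ} (ht : 0 < t) (hc : 0 < c)
    {L : Submodule ℤ (EuclideanSpace ℝ (Fin n))} :
    IsTStable t (c⁻¹ • L) ↔
      HasDetLowerBound (c * t⁻¹) L ∧ HasDetLowerBound (c⁻¹ * t⁻¹) (dualLattice L) := by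
  have h1 := forall_le_normDet_smul_iff (inv_pos.2 ht).le (inv_pos.2 hc) (L := L)
  have h2 := forall_le_normDet_smul_iff (inv_pos.2 ht).le hc (L := dualLattice L)
  rw [inv_inv] at h1
  rw [← h1, ← h2]
  have h3 : dualLattice (c⁻¹ • L) = c • dualLattice L := by
    rw [dualLattice_smul (inv_ne_zero hc.ne'), inv_inv]
  exact ⟨fun h => ⟨h.1, h3 ▸ h.2⟩, fun h => ⟨h.1, h3 ▸ h.2⟩⟩

/-- The dual basis `G⁻¹ b` generates a lattice over `ℤ`, and the dual lies inside it: an element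
minus the combination prescribed by its pairings with `b` is in the span of `b` and orthogonal to
it. -/
theorem IsLattice.dual {L : Submodule ℤ (EuclideanSpace ℝ (Fin n))} (hL : IsLattice L) :
    IsLattice (dualLattice L) := by
  obtain ⟨m, b, hb⟩ := hL
  set G := Matrix.gram ℝ b with hG
  have hdet : IsUnit G.det := isUnit_iff_ne_zero.2 (det_gram_pos hb.1).ne'
  set d : Fin m → EuclideanSpace ℝ (Fin n) := fun i => ∑ j, G⁻¹ i j • b j with hd
  have hdb : ∀ i j, inner ℝ (d i) (b j) = (1 : Matrix (Fin m) (Fin m) ℝ) i j := by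
    intro i j
    rw [← Matrix.nonsing_inv_mul G hdet, Matrix.mul_apply, hd, sum_inner]
    exact Finset.sum_congr rfl fun l _ => by rw [real_inner_smul_left]; rfl
  have hspan := span_real_eq_of_span_eq hb.2
  have hbL : ∀ i, b i ∈ L := fun i => hb.2.le (Submodule.subset_span ⟨i, rfl⟩)
  have hdi : LinearIndependent ℝ d := by
    rw [Fintype.linearIndependent_iff]
    intro g hg i
    have h1 : inner ℝ (∑ j, g j • d j) (b i) = 0 := by rw [hg, inner_zero_left]
    rw [sum_inner] at h1
    simpa [real_inner_smul_left, hdb, Matrix.one_apply] using h1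
  refine IsLattice.of_le (isLattice_of_span_eq hdi rfl) fun x hx => ?_
  obtain ⟨hx1, hx2⟩ := hx
  choose z hz using fun i => hx2 (b i) (hbL i)
  have hx' : x = ∑ i, z i • d i := by
    rw [← sub_eq_zero]
    set y := x - ∑ i, z i • d i with hy
    have hyV : y ∈ Submodule.span ℝ (Set.range b) := by
      refine Submodule.sub_mem _ (hspan ▸ hx1) (Submodule.sum_mem _ fun i _ => ?_)
      rw [← Int.cast_smul_eq_zsmul ℝ]
      refine Submodule.smul_mem _ _ (Submodule.sum_mem _ fun j _ => Submodule.smul_mem _ _ ?_)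
      exact Submodule.subset_span ⟨j, rfl⟩
    have hyb : ∀ i, inner ℝ y (b i) = 0 := by
      intro i
      rw [hy, inner_sub_left, sum_inner, hz]
      simp_rw [← Int.cast_smul_eq_zsmul ℝ, real_inner_smul_left, hdb]
      simp [Matrix.one_apply]
    have hyo : y ∈ (Submodule.span ℝ (Set.range b))ᗮ := by
      rw [Submodule.mem_orthogonal']
      intro u hu
      induction hu using Submodule.span_induction with
      | mem u hu => obtain ⟨i, rfl⟩ := hu; exact hyb i
      | zero => exact inner_zero_right _
      | add u v _ _ hu hv => rw [inner_add_right, hu, hv, add_zero]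
      | smul c u _ hu => rw [real_inner_smul_right, hu, mul_zero]
    exact Submodule.disjoint_def.1 (Submodule.orthogonal_disjoint _) y hyV hyo
  rw [hx']
  exact Submodule.sum_mem _ fun i _ => Submodule.smul_mem _ _ (Submodule.subset_span ⟨i, rfl⟩)

theorem inner_projInt_of_mem {V : Submodule ℝ (EuclideanSpace ℝ (Fin n))}
    {x : EuclideanSpace ℝ (Fin n)} (hx : x ∈ V) (y : EuclideanSpace ℝ (Fin n)) :
    inner ℝ x (projInt V y) = inner ℝ x y := by
  have h : V.starProjection x = x := Submodule.starProjection_eq_self_iff.2 hx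
  rw [projInt_apply, ← Submodule.inner_starProjection_left_eq_right, h]

/-- A vector orthogonal to `L'` pairs with `y` and with the projection of `y` in the same way, so
the dual of the quotient is the part of the dual of `L` orthogonal to `L'`. -/
theorem mem_dualLattice_quotLattice {L L' : Submodule ℤ (EuclideanSpace ℝ (Fin n))} (h : L' ≤ L)
    {x : EuclideanSpace ℝ (Fin n)} :
    x ∈ dualLattice (quotLattice L L') ↔ x ∈ Submodule.span ℝ (L : Set (EuclideanSpace ℝ (Fin n))) ∧
      x ∈ (Submodule.span ℝ (L' : Set (EuclideanSpace ℝ (Fin n))))ᗮ ∧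
      ∀ y ∈ L, ∃ z : ℤ, inner ℝ x y = (z : ℝ) := by
  set V := Submodule.span ℝ (L' : Set (EuclideanSpace ℝ (Fin n))) with hV
  have hVL : V ≤ Submodule.span ℝ (L : Set (EuclideanSpace ℝ (Fin n))) := Submodule.span_mono h
  have hspan : x ∈ Submodule.span ℝ ((quotLattice L L' : Submodule ℤ _) :
      Set (EuclideanSpace ℝ (Fin n))) ↔
      x ∈ Submodule.span ℝ (L : Set (EuclideanSpace ℝ (Fin n))) ∧ x ∈ Vᗮ := by
    rw [quotLattice_eq, span_map_projInt]
    constructor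
    · rintro ⟨y, hy, rfl⟩
      refine ⟨?_, projInt_mem _ y⟩
      have := Submodule.sub_mem _ hy (hVL (sub_projInt_orthogonal_mem V y))
      rwa [sub_sub_cancel] at this
    · rintro ⟨h1, h2⟩
      exact ⟨x, h1, Submodule.starProjection_eq_self_iff.2 h2⟩
  change x ∈ Submodule.span ℝ _ ∧ _ ↔ _
  rw [hspan, and_assoc]
  refine and_congr_right fun _ => and_congr_right fun hx => ?_
  rw [quotLattice_eq]
  constructor
  · intro h y hy
    obtain ⟨z, hz⟩ := h _ (Submodule.mem_map_of_mem hy)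
    exact ⟨z, by rw [← hz, inner_projInt_of_mem hx]⟩
  · rintro h _ ⟨y, hy, rfl⟩
    obtain ⟨z, hz⟩ := h y hy
    exact ⟨z, by rw [← hz, inner_projInt_of_mem hx]⟩

theorem IsPrimitive.trans {A B C : Submodule ℤ (EuclideanSpace ℝ (Fin n))} (hAB : IsPrimitive A B)
    (hBC : IsPrimitive B C) : IsPrimitive A C := by
  refine ⟨Submodule.span ℝ (A : Set (EuclideanSpace ℝ (Fin n))), le_antisymm ?_ ?_⟩
  · intro x hx
    have hxB : x ∈ B := by
      rw [← hBC.inf_span]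
      exact ⟨hx.1, Submodule.span_mono hAB.le hx.2⟩
    rw [← hAB.inf_span]
    exact ⟨hxB, hx.2⟩
  · exact le_inf (hAB.le.trans hBC.le) fun x hx => Submodule.subset_span hx

theorem isPrimitive_refl (A : Submodule ℤ (EuclideanSpace ℝ (Fin n))) : IsPrimitive A A :=
  ⟨⊤, by ext; simp⟩

theorem quotLattice_self (A : Submodule ℤ (EuclideanSpace ℝ (Fin n))) : quotLattice A A = ⊥ := by
  rw [quotLattice_eq, eq_bot_iff]
  rintro _ ⟨x, hx, rfl⟩
  exact projInt_orthogonal_eq_zero.2 (Submodule.subset_span hx)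

theorem IsPrimitive.rank_eq_and_det_eq {A B : Submodule ℤ (EuclideanSpace ℝ (Fin n))}
    (hAB : IsPrimitive A B) (hB : IsLattice B) :
    latticeRank B = latticeRank A + latticeRank (quotLattice B A) ∧
      latticeDet B = latticeDet A * latticeDet (quotLattice B A) := by
  have h := hB.rank_add_rank_and_det_mul_det_le
    (Submodule.span ℝ (A : Set (EuclideanSpace ℝ (Fin n)))) (hAB.isLattice_quotLattice hB)
  rw [hAB.inf_span] at h
  exact ⟨h.1, h.2.2 rfl⟩

variable {A B C : Submodule ℤ (EuclideanSpace ℝ (Fin n))} {s : ℝ}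

/-- Factor rank and determinant through `A ⊂ B`, `B ⊂ C` and `A ⊂ C`, and cancel the contribution of
`A`. No identification of iterated quotients is needed. -/
theorem rank_eq_and_det_eq_of_chain (hAB : IsPrimitive A B) (hBC : IsPrimitive B C)
    (hC : IsLattice C) :
    latticeRank (quotLattice C A) =
        latticeRank (quotLattice B A) + latticeRank (quotLattice C B) ∧
      latticeDet (quotLattice C A) = latticeDet (quotLattice B A) * latticeDet (quotLattice C B) := by
  have hB := hC.of_le hBC.le
  have h1 := hAB.rank_eq_and_det_eq hB
  have h2 := hBC.rank_eq_and_det_eq hC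
  have h3 := (hAB.trans hBC).rank_eq_and_det_eq hC
  refine ⟨by omega, mul_left_cancel₀ (hB.of_le hAB.le).det_pos.ne' ?_⟩
  rw [← h3.2, h2.2, h1.2, mul_assoc]

theorem projInt_orthogonal_projInt_orthogonal {V W : Submodule ℝ (EuclideanSpace ℝ (Fin n))}
    (h : V ≤ W) (x : EuclideanSpace ℝ (Fin n)) :
    projInt Wᗮ (projInt Vᗮ x) = projInt Wᗮ x := by
  have := projInt_orthogonal_eq_zero.2 (h (sub_projInt_orthogonal_mem V x))
  rw [map_sub, sub_eq_zero] at this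
  exact this.symm

/-- The common core of the two merging lemmas: rank is additive and determinant supermultiplicative
when `M` is cut by `V`. -/
theorem HasDetLowerBound.of_inf_of_map {M N N' : Submodule ℤ (EuclideanSpace ℝ (Fin n))}
    (V : Submodule ℝ (EuclideanSpace ℝ (Fin n))) (hs : 0 ≤ s) (hM : IsLattice M)
    (hN : HasDetLowerBound s N) (hN' : HasDetLowerBound s N') (hNl : IsLattice N')
    (h1 : M ⊓ V.restrictScalars ℤ ≤ N) (h2 : M.map (projInt Vᗮ) ≤ N') :
    s ^ latticeRank M ≤ latticeDet M := by
  have hQ := hNl.of_le h2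
  obtain ⟨hr, hd, -⟩ := hM.rank_add_rank_and_det_mul_det_le V hQ
  rw [hr, pow_add]
  exact (mul_le_mul (hN _ h1 (hM.of_le inf_le_left)) (hN' _ h2 hQ) (by positivity)
    (latticeDet_nonneg _)).trans hd

/-- Cut `M` by `span B`: the intersection consists of projected vectors of `B`, so it lies in `B /
A`, and the projection lies in `C / B`. -/
theorem HasDetLowerBound.quot_of_chain (hs : 0 ≤ s) (hAB : IsPrimitive A B) (hBC : IsPrimitive B C)
    (hC : IsLattice C) (h1 : HasDetLowerBound s (quotLattice B A))
    (h2 : HasDetLowerBound s (quotLattice C B)) : HasDetLowerBound s (quotLattice C A) := by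
  intro M hM hl
  have hAB' := Submodule.span_mono (R := ℝ) (s := (A : Set (EuclideanSpace ℝ (Fin n)))) hAB.le
  refine HasDetLowerBound.of_inf_of_map
    (Submodule.span ℝ (B : Set (EuclideanSpace ℝ (Fin n)))) hs hl h1 h2
    (hBC.isLattice_quotLattice hC) ?_ ?_
  · rintro x ⟨hxM, hxV⟩
    obtain ⟨y, hy, rfl⟩ := hM hxM
    refine ⟨y, ?_, rfl⟩
    rw [SetLike.mem_coe, ← hBC.inf_span]
    refine ⟨hy, ?_⟩
    have h3 := Submodule.add_mem _ (hAB' (sub_projInt_orthogonal_mem _ y)) hxV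
    have h4 := sub_add_cancel y
      (projInt (Submodule.span ℝ (A : Set (EuclideanSpace ℝ (Fin n))))ᗮ y)
    exact h4 ▸ h3
  · rintro _ ⟨x, hxM, rfl⟩
    obtain ⟨y, hy, rfl⟩ := hM hxM
    refine ⟨y, hy, ?_⟩
    exact (projInt_orthogonal_projInt_orthogonal hAB' y).symm

/-- Duality reverses the roles: the part of `M` orthogonal to `B` lies in `(C / B)*`, and the
projection of `M` to `span B` lies in `(B / A)*`, since it pairs with vectors of `B` as `M` does. -/
theorem HasDetLowerBound.dual_quot_of_chain (hs : 0 ≤ s) (hAB : IsPrimitive A B)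
    (hBC : IsPrimitive B C) (hC : IsLattice C)
    (h1 : HasDetLowerBound s (dualLattice (quotLattice B A)))
    (h2 : HasDetLowerBound s (dualLattice (quotLattice C B))) :
    HasDetLowerBound s (dualLattice (quotLattice C A)) := by
  intro M hM hl
  have hAB' := Submodule.span_mono (R := ℝ) (s := (A : Set (EuclideanSpace ℝ (Fin n)))) hAB.le
  refine HasDetLowerBound.of_inf_of_map
    (Submodule.span ℝ (B : Set (EuclideanSpace ℝ (Fin n))))ᗮ hs hl h2 h1
    (hAB.isLattice_quotLattice (hC.of_le hBC.le)).dual ?_ ?_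
  · rintro x ⟨hxM, hxV⟩
    have h3 := (mem_dualLattice_quotLattice (hAB.le.trans hBC.le)).1 (hM hxM)
    exact (mem_dualLattice_quotLattice hBC.le).2 ⟨h3.1, hxV, h3.2.2⟩
  · rintro _ ⟨x, hxM, rfl⟩
    have h3 := (mem_dualLattice_quotLattice (hAB.le.trans hBC.le)).1 (hM hxM)
    rw [Submodule.orthogonal_orthogonal]
    have hsym : ∀ y ∈ Submodule.span ℝ (B : Set (EuclideanSpace ℝ (Fin n))),
        inner ℝ (projInt (Submodule.span ℝ (B : Set (EuclideanSpace ℝ (Fin n)))) x) y =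
          inner ℝ x y := fun y hy => by
      rw [real_inner_comm, inner_projInt_of_mem hy, real_inner_comm]
    refine (mem_dualLattice_quotLattice hAB.le).2 ⟨projInt_mem _ x, ?_, fun y hy => ?_⟩
    · rw [Submodule.mem_orthogonal']
      intro u hu
      rw [hsym u (hAB' hu)]
      exact Submodule.inner_left_of_mem_orthogonal hu h3.2.1
    · obtain ⟨z, hz⟩ := h3.2.2 y (hBC.le hy)
      exact ⟨z, by rw [hsym y (Submodule.subset_span hy), hz]⟩

end Stability

/-! Merging consecutive members of a filtration. -/

section Merge

variable {n k : ℕ} {G : ℕ → Submodule ℤ (EuclideanSpace ℝ (Fin n))}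

theorem isPrimitive_of_forall_succ (hG : ∀ i < k, IsPrimitive (G i) (G (i + 1))) {a b : ℕ}
    (hab : a ≤ b) (hb : b ≤ k) : IsPrimitive (G a) (G b) := by
  induction b, hab using Nat.le_induction with
  | base => exact isPrimitive_refl _
  | succ b hab ih => exact (ih (by omega)).trans (hG b (by omega))

theorem isLattice_of_forall_succ (hG : ∀ i < k, IsPrimitive (G i) (G (i + 1)))
    (hk : IsLattice (G k)) {a : ℕ} (ha : a ≤ k) : IsLattice (G a) :=
  hk.of_le (isPrimitive_of_forall_succ hG ha le_rfl).le

theorem hasDetLowerBound_quot_of_forall {s : ℝ} (hs : 0 ≤ s)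
    (hG : ∀ i < k, IsPrimitive (G i) (G (i + 1))) (hk : IsLattice (G k)) {a b : ℕ}
    (hab : a ≤ b) (hb : b ≤ k)
    (h : ∀ i, a ≤ i → i < b → HasDetLowerBound s (quotLattice (G (i + 1)) (G i))) :
    HasDetLowerBound s (quotLattice (G b) (G a)) := by
  induction b, hab using Nat.le_induction with
  | base => rw [quotLattice_self]; exact hasDetLowerBound_bot s
  | succ b hab ih =>
    exact HasDetLowerBound.quot_of_chain hs (isPrimitive_of_forall_succ hG hab (by omega))
      (hG b (by omega)) (isLattice_of_forall_succ hG hk hb)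
      (ih (by omega) fun i h1 h2 => h i h1 (by omega)) (h b hab (by omega))

/-- The induction starts from a block of one step, so the dual of the zero lattice never has to be
considered. -/
theorem hasDetLowerBound_dual_quot_of_forall {s : ℝ} (hs : 0 ≤ s)
    (hG : ∀ i < k, IsPrimitive (G i) (G (i + 1))) (hk : IsLattice (G k)) {a b : ℕ}
    (hab : a < b) (hb : b ≤ k)
    (h : ∀ i, a ≤ i → i < b → HasDetLowerBound s (dualLattice (quotLattice (G (i + 1)) (G i)))) :
    HasDetLowerBound s (dualLattice (quotLattice (G b) (G a))) := by
  induction b, hab using Nat.le_induction with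
  | base => exact h a le_rfl (by omega)
  | succ b hab ih =>
    have hab' : a ≤ b := by omega
    exact HasDetLowerBound.dual_quot_of_chain hs (isPrimitive_of_forall_succ hG hab' (by omega))
      (hG b (by omega)) (isLattice_of_forall_succ hG hk hb)
      (ih (by omega) fun i h1 h2 => h i h1 (by omega)) (h b hab' (by omega))

/-- The normalized determinant of a block is a geometric mean of those of its steps, weighted by
rank; this is the lower half of that fact, in power form, and `det_quot_le_pow_of_forall` is the
upper half. -/
theorem pow_le_det_quot_of_forall {s : ℝ} (hs : 0 ≤ s)
    (hG : ∀ i < k, IsPrimitive (G i) (G (i + 1))) (hk : IsLattice (G k)) {a b : ℕ}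
    (hab : a ≤ b) (hb : b ≤ k)
    (h : ∀ i, a ≤ i → i < b → s ≤ normDet (quotLattice (G (i + 1)) (G i))) :
    s ^ latticeRank (quotLattice (G b) (G a)) ≤ latticeDet (quotLattice (G b) (G a)) := by
  induction b, hab using Nat.le_induction with
  | base => rw [quotLattice_self, latticeRank_bot, latticeDet_bot, pow_zero]
  | succ b hab ih =>
    have h1 := rank_eq_and_det_eq_of_chain (isPrimitive_of_forall_succ hG hab (by omega))
      (hG b (by omega)) (isLattice_of_forall_succ hG hk hb)
    rw [h1.1, h1.2, pow_add]
    refine mul_le_mul (ih (by omega) fun i h1 h2 => h i h1 (by omega)) ?_ (by positivity)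
      (latticeDet_nonneg _)
    have hq := (hG b (by omega)).isLattice_quotLattice (isLattice_of_forall_succ hG hk hb)
    rw [← hq.normDet_pow_rank]
    exact pow_le_pow_left₀ hs (h b hab (by omega)) _

theorem det_quot_le_pow_of_forall {s : ℝ} (hs : 0 ≤ s)
    (hG : ∀ i < k, IsPrimitive (G i) (G (i + 1))) (hk : IsLattice (G k)) {a b : ℕ}
    (hab : a ≤ b) (hb : b ≤ k)
    (h : ∀ i, a ≤ i → i < b → normDet (quotLattice (G (i + 1)) (G i)) ≤ s) :
    latticeDet (quotLattice (G b) (G a)) ≤ s ^ latticeRank (quotLattice (G b) (G a)) := by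
  induction b, hab using Nat.le_induction with
  | base => rw [quotLattice_self, latticeRank_bot, latticeDet_bot, pow_zero]
  | succ b hab ih =>
    have h1 := rank_eq_and_det_eq_of_chain (isPrimitive_of_forall_succ hG hab (by omega))
      (hG b (by omega)) (isLattice_of_forall_succ hG hk hb)
    rw [h1.1, h1.2, pow_add]
    refine mul_le_mul (ih (by omega) fun i h1 h2 => h i h1 (by omega)) ?_ (latticeDet_nonneg _)
      (by positivity)
    have hq := (hG b (by omega)).isLattice_quotLattice (isLattice_of_forall_succ hG hk hb)
    rw [← hq.normDet_pow_rank]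
    exact pow_le_pow_left₀ hq.normDet_pos.le (h b hab (by omega)) _

theorem quotLattice_ne_bot {A B : Submodule ℤ (EuclideanSpace ℝ (Fin n))} (h : IsPrimitive A B)
    (hne : A ≠ B) : quotLattice B A ≠ ⊥ := by
  intro h0
  apply hne
  rw [← h.inf_span]
  refine inf_eq_left.2 fun x hx => ?_
  have h1 : projInt (Submodule.span ℝ (A : Set (EuclideanSpace ℝ (Fin n))))ᗮ x ∈
      quotLattice B A := Submodule.mem_map_of_mem hx
  rw [h0, Submodule.mem_bot] at h1
  exact projInt_orthogonal_eq_zero.1 h1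

/-- Merging a block whose normalized determinants lie within a factor of two. -/
theorem merged_block {t : ℝ} (ht : 1 ≤ t) (hG : ∀ i < k, IsPrimitive (G i) (G (i + 1)))
    (hk : IsLattice (G k)) (hne : ∀ i < k, G i ≠ G (i + 1))
    (hst : ∀ i < k, IsTStable t ((normDet (quotLattice (G (i + 1)) (G i)))⁻¹ •
      quotLattice (G (i + 1)) (G i))) {a b : ℕ} (hab : a < b) (hb : b ≤ k) {u v : ℝ} (hu : 0 < u)
    (h1 : ∀ i, a ≤ i → i < b → u ≤ normDet (quotLattice (G (i + 1)) (G i)))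
    (h2 : ∀ i, a ≤ i → i < b → normDet (quotLattice (G (i + 1)) (G i)) ≤ v) (huv : v ≤ 2 * u) :
    u ≤ normDet (quotLattice (G b) (G a)) ∧ normDet (quotLattice (G b) (G a)) ≤ v ∧
      IsTStable (2 * t) ((normDet (quotLattice (G b) (G a)))⁻¹ • quotLattice (G b) (G a)) := by
  have ht0 : 0 < t := by linarith
  have hv : 0 < v := hu.trans_le ((h1 a le_rfl hab).trans (h2 a le_rfl hab))
  have hlat : ∀ i < k, IsLattice (quotLattice (G (i + 1)) (G i)) := fun i hi =>
    (hG i hi).isLattice_quotLattice (isLattice_of_forall_succ hG hk hi)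
  have hst' := fun i (hi : i < k) => (isTStable_inv_smul_iff ht0 (hlat i hi).normDet_pos).1 (hst i hi)
  have hp := isPrimitive_of_forall_succ hG hab.le hb
  have hQ := hp.isLattice_quotLattice (isLattice_of_forall_succ hG hk hb)
  have hQ0 : quotLattice (G b) (G a) ≠ ⊥ := by
    refine quotLattice_ne_bot hp fun h => hne a (by omega) ?_
    refine le_antisymm (hG a (by omega)).le ?_
    rw [h]
    exact (isPrimitive_of_forall_succ hG hab hb).le
  have hlow : u ≤ normDet (quotLattice (G b) (G a)) := (hQ.le_normDet_iff hQ0 hu.le).2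
    (pow_le_det_quot_of_forall hu.le hG hk hab.le hb h1)
  have hupp : normDet (quotLattice (G b) (G a)) ≤ v := (hQ.normDet_le_iff hQ0 hv.le).2
    (det_quot_le_pow_of_forall hv.le hG hk hab.le hb h2)
  refine ⟨hlow, hupp, (isTStable_inv_smul_iff (by linarith) hQ.normDet_pos).2 ⟨?_, ?_⟩⟩
  -- Every step has the bound `u / t`, and the block's normalized determinant is at most `v ≤ 2 *
  -- u`; this is where the `2` in `2 * t` is spent.
  · have h3 : HasDetLowerBound (u * t⁻¹) (quotLattice (G b) (G a)) :=
      hasDetLowerBound_quot_of_forall (by positivity) hG hk hab.le hb fun i hi1 hi2 =>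
        (hst' i (by omega)).1.mono (by positivity)
          (mul_le_mul_of_nonneg_right (h1 i hi1 hi2) (by positivity))
    have := hQ.normDet_pos
    refine h3.mono (by positivity) ?_
    rw [mul_inv, ← mul_assoc]
    refine mul_le_mul_of_nonneg_right ?_ (by positivity)
    linarith
  -- For the dual the largest step is the critical one: `v` is at most twice the block's normalized
  -- determinant because the latter is at least `u`.
  · have h3 : HasDetLowerBound (v⁻¹ * t⁻¹) (dualLattice (quotLattice (G b) (G a))) :=
      hasDetLowerBound_dual_quot_of_forall (by positivity) hG hk hab hb fun i hi1 hi2 =>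
        (hst' i (by omega)).2.mono (by positivity)
          (mul_le_mul_of_nonneg_right
            (inv_anti₀ (hlat i (by omega)).normDet_pos (h2 i hi1 hi2)) (by positivity))
    have := hQ.normDet_pos
    refine h3.mono (by positivity) ?_
    rw [mul_inv, ← mul_assoc, ← mul_inv]
    refine mul_le_mul_of_nonneg_right (inv_anti₀ hv ?_) (by positivity)
    linarith

/-- The indices of a subsequence cut a filtration greedily into blocks of normalized determinants
within a factor of two. -/
structure IsGreedyCut {k k' : ℕ} (r : Fin k → ℝ) (l : Fin (k' + 1) → Fin (k + 1)) : Prop where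
  zero : l 0 = 0
  last : l (Fin.last k') = Fin.last k
  strictMono : StrictMono l
  le_two_mul : ∀ (j : Fin k') (i i' : Fin k), i.castSucc = l j.castSucc →
    l j.castSucc ≤ i'.castSucc → i'.castSucc < l j.succ → r i' ≤ 2 * r i
  -- Vacuous for the final block, whose end `Fin.last k` is not of the form `castSucc`.
  two_mul_lt : ∀ (j : Fin k') (i i' : Fin k), i.castSucc = l j.castSucc →
    i'.castSucc = l j.succ → 2 * r i < r i'

/-- A merged value `r̃_j` is at most the last step of its block, hence below the first step
`u_{j+1}` of the next block. So `r̃_i < u_{i+1} < u_{i+2} / 2 ≤ r̃_{i+2} / 2`. Neighbouring merged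
values need not be separated: the greedy rule controls only the first steps. -/
theorem IsGreedyCut.isWellSeparatedFiltration {n k k' : ℕ} {t : ℝ} (ht : 1 ≤ t)
    {L : Submodule ℤ (EuclideanSpace ℝ (Fin n))} (hL : IsLattice L)
    {F : Fin (k + 1) → Submodule ℤ (EuclideanSpace ℝ (Fin n))} (hF : IsStableFiltration t L F)
    {l : Fin (k' + 1) → Fin (k + 1)} (hl : IsGreedyCut (quotNormDet F) l) :
    IsWellSeparatedFiltration (2 * t) L (F ∘ l) := by
  -- `Fin.ofNat` wraps around beyond `k`; only the values up to `k` are used.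
  set G : ℕ → Submodule ℤ (EuclideanSpace ℝ (Fin n)) := fun i => F (Fin.ofNat (k + 1) i) with hGdef
  have hGF : ∀ i : Fin (k + 1), G i = F i := fun i => by
    simp only [hGdef]
    congr 1
    exact Fin.ofNat_val_eq_self i
  have hGr : ∀ i : Fin k, normDet (quotLattice (G ((i : ℕ) + 1)) (G i)) = quotNormDet F i := by
    intro i
    have h1 := hGF i.succ
    have h2 := hGF i.castSucc
    rw [Fin.val_succ] at h1
    rw [Fin.val_castSucc] at h2
    rw [h1, h2]; rfl
  have hGq : ∀ i : Fin k, quotLattice (G ((i : ℕ) + 1)) (G i) =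
      quotLattice (F i.succ) (F i.castSucc) := by
    intro i
    have h1 := hGF i.succ
    have h2 := hGF i.castSucc
    rw [Fin.val_succ] at h1
    rw [Fin.val_castSucc] at h2
    rw [h1, h2]
  have hG : ∀ i < k, IsPrimitive (G i) (G (i + 1)) := by
    intro i hi
    have := hF.primitive ⟨i, hi⟩
    rwa [← hGF, ← hGF] at this
  have hne : ∀ i < k, G i ≠ G (i + 1) := by
    intro i hi h
    have h3 := hF.strictMono (Fin.castSucc_lt_succ (i := ⟨i, hi⟩))
    rw [← hGF, ← hGF] at h3
    exact h3.ne h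
  have hGk : G k = L := by
    rw [← hF.top, ← hGF]; rfl
  have hk : IsLattice (G k) := hGk ▸ hL
  have hst : ∀ i < k, IsTStable t ((normDet (quotLattice (G (i + 1)) (G i)))⁻¹ •
      quotLattice (G (i + 1)) (G i)) := by
    intro i hi
    have := hF.stable ⟨i, hi⟩
    rwa [← hGr, ← hGq] at this
  have hpos : ∀ i : Fin k, 0 < quotNormDet F i := fun i => by
    rw [← hGr]
    exact ((hG i i.2).isLattice_quotLattice (isLattice_of_forall_succ hG hk i.2)).normDet_pos
  have hlt : ∀ j : Fin k', (l j.castSucc : ℕ) < l j.succ := fun j =>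
    hl.strictMono Fin.castSucc_lt_succ
  have hfst : ∀ j : Fin k', (l j.castSucc : ℕ) < k := fun j =>
    (hlt j).trans_le (Nat.lt_succ_iff.1 (l j.succ).2)
  have hrl : ∀ j : Fin k', quotNormDet (F ∘ l) j =
      normDet (quotLattice (G (l j.succ)) (G (l j.castSucc))) := fun j => by
    rw [hGF, hGF]; rfl
  -- the first normalized determinant of each block
  set u : Fin k' → ℝ := fun j => quotNormDet F ⟨l j.castSucc, hfst j⟩ with hu
  -- The upper bound `v` is the last step of the block, with index `l j.succ - 1`; the greedy rule
  -- gives `v ≤ 2 * u j`.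
  have hblock := fun j : Fin k' => merged_block ht hG hk hne hst (hlt j)
    (Nat.lt_succ_iff.1 (l j.succ).2) (hpos ⟨l j.castSucc, hfst j⟩)
    (v := quotNormDet F ⟨(l j.succ : ℕ) - 1, by have := hlt j; omega⟩)
    (fun i hi1 hi2 => by
      have hik : i < k := by omega
      rw [hGr ⟨i, hik⟩]
      exact hF.quotNormDet_strictMono.monotone (Fin.mk_le_mk.2 hi1))
    (fun i hi1 hi2 => by
      have hik : i < k := by omega
      rw [hGr ⟨i, hik⟩]
      exact hF.quotNormDet_strictMono.monotone (Fin.mk_le_mk.2 (by omega)))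
    (hl.le_two_mul j _ _ rfl
      (by rw [Fin.le_def, Fin.val_castSucc]; change _ ≤ (l j.succ : ℕ) - 1; have := hlt j; omega)
      (by rw [Fin.lt_def, Fin.val_castSucc]; change (l j.succ : ℕ) - 1 < _; have := hlt j; omega))
  have hu1 : ∀ j, u j ≤ quotNormDet (F ∘ l) j := fun j => by
    rw [hrl]; exact (hblock j).1
  have hlast : ∀ j : Fin k', ∀ j' : Fin k', (j' : ℕ) = j + 1 → quotNormDet (F ∘ l) j < u j' ∧
      2 * u j < u j' := by
    intro j j' hjj
    have hj' : j'.castSucc = j.succ := Fin.ext (by simp [hjj])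
    refine ⟨?_, hl.two_mul_lt j _ _ rfl (Fin.ext (by rw [← hj']; rfl))⟩
    rw [hrl]
    refine (hblock j).2.1.trans_lt (hF.quotNormDet_strictMono ?_)
    rw [Fin.mk_lt_mk, hj']
    have := hlt j
    omega
  refine ⟨⟨?_, ?_, hF.strictMono.comp hl.strictMono, ?_, ?_, ?_⟩, ?_⟩
  · rw [Function.comp_apply, hl.zero, hF.bot]
  · rw [Function.comp_apply, hl.last, hF.top]
  · intro j
    have := isPrimitive_of_forall_succ hG (hlt j).le (Nat.lt_succ_iff.1 (l j.succ).2)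
    rwa [hGF, hGF] at this
  · cases k' with
    | zero => exact fun i => i.elim0
    | succ k' =>
      refine Fin.strictMono_iff_lt_succ.2 fun j => ?_
      exact (hlast j.castSucc j.succ (by simp)).1.trans_le (hu1 _)
  · intro j
    have := (hblock j).2.2
    rw [hrl]
    rwa [hGF, hGF] at this ⊢
  · intro i j hij
    have hi1 : (i : ℕ) + 1 < k' := by omega
    have h1 := hlast i ⟨i + 1, hi1⟩ rfl
    have h2 := hlast ⟨i + 1, hi1⟩ j (by simp [hij])
    have h3 := hu1 j
    linarith

end Merge

/-! Every lattice has a `1`-stable filtration. -/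

section Canonical

variable {n : ℕ}

/-- Coordinates with respect to `b`, extended to the whole space. The operator norm of `f` compares
the integral Gram determinants of coordinate vectors with the metric ones. -/
theorem exists_continuousLinearMap_eq_single {m : ℕ} {b : Fin m → EuclideanSpace ℝ (Fin n)}
    (hb : LinearIndependent ℝ b) :
    ∃ f : EuclideanSpace ℝ (Fin n) →L[ℝ] EuclideanSpace ℝ (Fin m),
      ∀ x : Fin m → ℝ, f (∑ i, x i • b i) = WithLp.toLp 2 x := by
  have hinj : LinearMap.ker (Fintype.linearCombination ℝ b) = ⊥ := by
    rw [LinearMap.ker_eq_bot']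
    intro x hx
    rw [Fintype.linearCombination_apply] at hx
    exact funext (Fintype.linearIndependent_iff.1 hb x hx)
  obtain ⟨g, hg⟩ := LinearMap.exists_leftInverse_of_injective _ hinj
  refine ⟨LinearMap.toContinuousLinearMap
    ((WithLp.linearEquiv 2 ℝ (Fin m → ℝ)).symm.toLinearMap ∘ₗ g), fun x => ?_⟩
  have h := LinearMap.congr_fun hg x
  rw [LinearMap.comp_apply, Fintype.linearCombination_apply] at h
  change (WithLp.linearEquiv 2 ℝ (Fin m → ℝ)).symm (g _) = _
  rw [h]
  rfl

open Matrix in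
/-- The integral matrix `Uᵀ adj(U Uᵀ) U` and the determinant of `U Uᵀ` determine the row space
of `U`. -/
theorem exists_scaled_projection {r m : ℕ} (U : Matrix (Fin r) (Fin m) ℤ) (hd : 0 < (U * Uᵀ).det) :
    ∃ (Q : Matrix (Fin m) (Fin m) ℤ) (Y : Matrix (Fin m) (Fin r) ℤ), U * Q = (U * Uᵀ).det • U ∧
      Q = Y * U ∧ ∀ i j, |Q i j| ≤ (U * Uᵀ).det := by
  set S := U * Uᵀ with hS
  set Q := Uᵀ * S.adjugate * U with hQ
  have hST : Sᵀ = S := by rw [hS, transpose_mul, transpose_transpose]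
  have hQT : Qᵀ = Q := by
    rw [hQ, transpose_mul, transpose_mul, transpose_transpose, adjugate_transpose, hST,
      Matrix.mul_assoc]
  have hUQ : U * Q = S.det • U := by
    rw [hQ, ← Matrix.mul_assoc, ← Matrix.mul_assoc, ← hS, mul_adjugate, smul_mul, Matrix.one_mul]
  -- `Q` is `det S` times the orthogonal projection to the row space. Symmetry and this identity
  -- give that row `i` has squared norm `det S * Q i i`, which bounds first the diagonal and then
  -- all entries by `det S`.
  have hQQ : Q * Q = S.det • Q := by
    conv_lhs => rw [hQ, Matrix.mul_assoc, ← hQ, hUQ]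
    rw [Matrix.mul_smul, ← hQ]
  refine ⟨Q, Uᵀ * S.adjugate, hUQ, rfl, fun i j => ?_⟩
  have hrow : ∑ l, Q i l ^ 2 = S.det * Q i i := by
    have h := congrFun (congrFun hQQ i) i
    rw [mul_apply, Matrix.smul_apply, smul_eq_mul] at h
    rw [← h]
    refine Finset.sum_congr rfl fun l _ => ?_
    have : Q l i = Q i l := congrFun (congrFun hQT i) l
    rw [this, sq]
  have hle : ∀ l, Q i l ^ 2 ≤ S.det * Q i i := fun l => by
    rw [← hrow]
    exact Finset.single_le_sum (f := fun l => Q i l ^ 2) (fun _ _ => sq_nonneg _)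
      (Finset.mem_univ l)
  have hii : Q i i ≤ S.det := by nlinarith [hle i]
  refine abs_le_of_sq_le_sq ?_ hd.le
  nlinarith [hle j]

/-- A lattice has finitely many primitive sublattices of bounded determinant. -/
theorem IsLattice.finite_primitive {L : Submodule ℤ (EuclideanSpace ℝ (Fin n))} (hL : IsLattice L)
    (C : ℝ) : {M | IsPrimitive M L ∧ latticeDet M ≤ C}.Finite := by
  have hL' := hL
  obtain ⟨m, b, hb⟩ := hL
  obtain ⟨f, hf⟩ := exists_continuousLinearMap_eq_single hb.1
  -- `K` bounds the Gram determinant of the coordinate vectors of a basis of `M`. The maximum with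
  -- `1` allows the exponent `rank M` to be replaced by `m`.
  obtain ⟨K, hK⟩ := exists_nat_ge (max 1 (‖f‖ ^ 2) ^ m * C ^ 2)
  -- A primitive `M` is recovered from a pair `(Δ, Q)` as the set of coordinate vectors fixed by the
  -- projection `Q / Δ`, and only finitely many integral pairs respect the bound `K`.
  set Ψ : ℤ × (Fin m → Fin m → ℤ) → Set (EuclideanSpace ℝ (Fin n)) := fun q =>
    {x | ∃ z : Fin m → ℤ, ∑ i, z i • b i = x ∧ Matrix.vecMul z (Matrix.of q.2) = q.1 • z} with hΨ
  have hfin : (Ψ '' (Set.Icc 0 (K : ℤ) ×ˢ Set.Icc (fun _ _ => -(K : ℤ)) fun _ _ => (K : ℤ))).Finite :=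
    ((Set.finite_Icc _ _).prod (Set.finite_Icc _ _)).image _
  refine Set.Finite.of_finite_image (hfin.subset ?_) (f := fun M => (M : Set _))
    (SetLike.coe_injective.injOn)
  rintro _ ⟨M, ⟨hM, hMC⟩, rfl⟩
  obtain ⟨r, b', hb'⟩ := hL'.of_le hM.le
  have hb'M : ∀ j, b' j ∈ M := fun j => hb'.2.le (Submodule.subset_span ⟨j, rfl⟩)
  have hU : ∀ j, ∃ c : Fin m → ℤ, ∑ i, c i • b i = b' j := fun j =>
    (Submodule.mem_span_range_iff_exists_fun ℤ).1 (by rw [hb.2]; exact hM.le (hb'M j))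
  choose U hU using hU
  have hUr : ∀ j, ∑ i, (U j i : ℝ) • b i = b' j := fun j => by
    rw [← hU j]
    exact Finset.sum_congr rfl fun i _ => Int.cast_smul_eq_zsmul ℝ _ _
  have hfb : ∀ j, f (b' j) = WithLp.toLp 2 fun i => (U j i : ℝ) := fun j => by
    rw [← hUr, hf]
  have hgram : Matrix.gram ℝ (f ∘ b') =
      (Matrix.of U * (Matrix.of U).transpose).map (Int.cast : ℤ → ℝ) := by
    ext i j
    rw [Matrix.gram_apply, Function.comp_apply, Function.comp_apply, hfb, hfb]
    simp [Matrix.mul_apply, PiLp.inner_apply, mul_comm]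
  have hdetc : (Matrix.gram ℝ (f ∘ b')).det =
      (((Matrix.of U * (Matrix.of U).transpose).det : ℤ) : ℝ) := by
    rw [hgram]
    exact ((Int.castRingHom ℝ).map_det _).symm
  have hli : LinearIndependent ℝ (f ∘ b') := by
    refine LinearIndependent.of_comp (Fintype.linearCombination ℝ b ∘ₗ
      (WithLp.linearEquiv 2 ℝ (Fin m → ℝ)).toLinearMap) ?_
    convert hb'.1 using 1
    funext j
    rw [Function.comp_apply, Function.comp_apply, hfb, ← hUr]
    rfl
  have hpos : 0 < (Matrix.of U * (Matrix.of U).transpose).det := by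
    have := det_gram_pos hli
    rw [hdetc] at this
    exact_mod_cast this
  have hrm : r ≤ m := by
    have := latticeRank_mono hL' hM.le
    rwa [latticeRank_eq_of_span_eq hb.1 hb.2, latticeRank_eq_of_span_eq hb'.1 hb'.2,
      Fintype.card_fin, Fintype.card_fin] at this
  have hle : (Matrix.of U * (Matrix.of U).transpose).det ≤ (K : ℤ) := by
    have h1 : (Matrix.gram ℝ (f ∘ b')).det ≤ K := by
      refine le_trans ?_ hK
      refine (det_gram_comp_le b' f).trans ?_
      rw [← latticeDet_sq_of_span_eq hb'.1 hb'.2, Fintype.card_fin]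
      refine mul_le_mul ?_ (pow_le_pow_left₀ (latticeDet_nonneg _) hMC 2) (by positivity)
        (by positivity)
      exact (pow_le_pow_left₀ (by positivity) (le_max_right 1 _) r).trans
        (pow_le_pow_right₀ (le_max_left _ _) hrm)
    rw [hdetc] at h1
    exact_mod_cast h1
  obtain ⟨Q, Y, hUQ, hQY, hQ⟩ := exists_scaled_projection (Matrix.of U) hpos
  set Δ := (Matrix.of U * (Matrix.of U).transpose).det with hΔ
  refine ⟨(Δ, fun i j => Q i j), ⟨⟨hpos.le, hle⟩, ⟨fun i j => ?_, fun i j => ?_⟩⟩, ?_⟩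
  · exact (abs_le.1 ((hQ i j).trans hle)).1
  · exact (abs_le.1 ((hQ i j).trans hle)).2
  · ext x
    constructor
    · rintro ⟨z, rfl, hz⟩
      change Matrix.vecMul z Q = Δ • z at hz
      rw [SetLike.mem_coe, ← hM.inf_span]
      refine ⟨?_, ?_⟩
      · rw [← hb.2]
        exact Submodule.sum_mem _ fun i _ => Submodule.smul_mem _ _ (Submodule.subset_span ⟨i, rfl⟩)
      -- Since `Q = Y * U`, the multiple `Δ z` is an integral combination of the basis of `M`;
      -- primitivity then puts `z` itself into `M`.
      · have h1 : Δ • ∑ i, z i • b i = ∑ j, (Matrix.vecMul z Y) j • b' j := by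
          rw [hQY, ← Matrix.vecMul_vecMul] at hz
          simp_rw [← hU, Finset.smul_sum, smul_smul]
          rw [Finset.sum_comm]
          refine Finset.sum_congr rfl fun i _ => ?_
          rw [← Finset.sum_smul]
          congr 1
          have := congrFun hz i
          rw [Pi.smul_apply, smul_eq_mul] at this
          rw [← this]
          rfl
        have h2 : Δ • ∑ i, z i • b i ∈
            Submodule.span ℝ (M : Set (EuclideanSpace ℝ (Fin n))) := by
          rw [h1]
          exact Submodule.subset_span (M.sum_mem fun j _ => M.smul_mem _ (hb'M j))
        rw [← Int.cast_smul_eq_zsmul ℝ] at h2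
        have h3 : (Δ : ℝ) ≠ 0 := Int.cast_ne_zero.2 hpos.ne'
        change _ ∈ Submodule.span ℝ (M : Set (EuclideanSpace ℝ (Fin n)))
        exact (Submodule.smul_mem_iff _ h3).1 h2
    · intro hx
      rw [SetLike.mem_coe, ← hb'.2] at hx
      obtain ⟨y, rfl⟩ := (Submodule.mem_span_range_iff_exists_fun ℤ).1 hx
      refine ⟨Matrix.vecMul y (Matrix.of U), ?_, ?_⟩
      · simp_rw [← hU, Finset.smul_sum, smul_smul]
        rw [Finset.sum_comm]
        refine Finset.sum_congr rfl fun i _ => ?_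
        rw [← Finset.sum_smul]
        rfl
      · change Matrix.vecMul (Matrix.vecMul y (Matrix.of U)) Q = Δ • _
        rw [Matrix.vecMul_vecMul, hUQ, Matrix.vecMul_smul]

/-- At equal rank the bases differ by a nonsingular integer matrix, whose determinant has absolute
value at least one. -/
theorem latticeDet_le_of_le {M N : Submodule ℤ (EuclideanSpace ℝ (Fin n))} (hN : IsLattice N)
    (hMN : M ≤ N) (hr : latticeRank M = latticeRank N) : latticeDet N ≤ latticeDet M := by
  obtain ⟨m, b, hb⟩ := hN.of_le hMN
  obtain ⟨m', c, hc⟩ := hN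
  rw [latticeRank_eq_of_span_eq hb.1 hb.2, latticeRank_eq_of_span_eq hc.1 hc.2, Fintype.card_fin,
    Fintype.card_fin] at hr
  subst hr
  have hU : ∀ j, ∃ z : Fin m → ℤ, ∑ i, z i • c i = b j := fun j =>
    (Submodule.mem_span_range_iff_exists_fun ℤ).1 (by
      rw [hc.2]; exact hMN (hb.2.le (Submodule.subset_span ⟨j, rfl⟩)))
  choose U hU using hU
  have hUr : b = fun j => ∑ i, ((Matrix.of U).map (Int.cast : ℤ → ℝ)) j i • c i := by
    funext j
    rw [← hU j]
    exact Finset.sum_congr rfl fun i _ => (Int.cast_smul_eq_zsmul ℝ _ _).symm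
  have hd : ((Matrix.of U).map (Int.cast : ℤ → ℝ)).det = (((Matrix.of U).det : ℤ) : ℝ) :=
    ((Int.castRingHom ℝ).map_det _).symm
  have hg : (Matrix.gram ℝ b).det = (((Matrix.of U).det ^ 2 : ℤ) : ℝ) * (Matrix.gram ℝ c).det := by
    conv_lhs => rw [hUr]
    rw [gram_linear_combination, Matrix.det_mul, Matrix.det_mul, Matrix.det_transpose, hd,
      Int.cast_pow]
    ring
  rw [latticeDet_eq hb, latticeDet_eq hc]
  refine Real.sqrt_le_sqrt ?_
  have h1 := det_gram_pos hb.1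
  have h2 := det_gram_pos hc.1
  rw [hg] at h1 ⊢
  have h3 : (0 : ℝ) < (((Matrix.of U).det ^ 2 : ℤ) : ℝ) := pos_of_mul_pos_left h1 h2.le
  have h4 : 0 < (Matrix.of U).det ^ 2 := Int.cast_pos.1 h3
  refine le_mul_of_one_le_left h2.le ?_
  exact_mod_cast h4

theorem rank_lt_rank_of_isPrimitive {A B : Submodule ℤ (EuclideanSpace ℝ (Fin n))}
    (h : IsPrimitive A B) (hB : IsLattice B) (hne : A ≠ B) : latticeRank A < latticeRank B := by
  rw [(h.rank_eq_and_det_eq hB).1]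
  have := (h.isLattice_quotLattice hB).rank_pos (quotLattice_ne_bot h hne)
  omega

theorem IsPrimitive.of_le_of_le {A B L : Submodule ℤ (EuclideanSpace ℝ (Fin n))}
    (h : IsPrimitive A L) (hAB : A ≤ B) (hBL : B ≤ L) : IsPrimitive A B := by
  obtain ⟨W, rfl⟩ := h
  exact ⟨W, le_antisymm (inf_le_inf_right _ hBL) (le_inf hAB inf_le_right)⟩

/-- `B` is a largest primitive sublattice over `A` of smallest normalized determinant. -/
structure IsDestabilizing (L A B : Submodule ℤ (EuclideanSpace ℝ (Fin n))) : Prop where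
  primitive : IsPrimitive B L
  le : A ≤ B
  ne : A ≠ B
  normDet_le : ∀ M, IsPrimitive M L → A ≤ M → A ≠ M →
    normDet (quotLattice B A) ≤ normDet (quotLattice M A)
  rank_le : ∀ M, IsPrimitive M L → A ≤ M → A ≠ M →
    normDet (quotLattice M A) = normDet (quotLattice B A) → latticeRank M ≤ latticeRank B

/-- Only sublattices with `nd (M / A) ≤ nd (L / A)` compete. Their determinant `det A * nd (M / A) ^
rank (M / A)` is bounded, so they are finitely many; minimize, then maximize the rank among the
minimizers. -/
theorem exists_isDestabilizing {L A : Submodule ℤ (EuclideanSpace ℝ (Fin n))} (hL : IsLattice L)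
    (hA : IsPrimitive A L) (hne : A ≠ L) : ∃ B, IsDestabilizing L A B := by
  set s := normDet (quotLattice L A) with hs
  have hs0 : 0 < s := (hA.isLattice_quotLattice hL).normDet_pos
  set S : Set (Submodule ℤ (EuclideanSpace ℝ (Fin n))) :=
    {M | IsPrimitive M L ∧ A ≤ M ∧ A ≠ M ∧ normDet (quotLattice M A) ≤ s} with hS
  have hfin : S.Finite := by
    refine (hL.finite_primitive (latticeDet A * max 1 s ^ latticeRank L)).subset ?_
    rintro M ⟨hM, hAM, hAne, hMs⟩
    refine ⟨hM, ?_⟩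
    have hMl := hL.of_le hM.le
    have hAM' := hA.of_le_of_le hAM hM.le
    have hq := hAM'.isLattice_quotLattice hMl
    have h1 := hAM'.rank_eq_and_det_eq hMl
    rw [h1.2, ← hq.normDet_pow_rank]
    refine mul_le_mul_of_nonneg_left ?_ (latticeDet_nonneg _)
    refine (pow_le_pow_left₀ hq.normDet_pos.le (hMs.trans (le_max_right 1 s)) _).trans
      (pow_le_pow_right₀ (le_max_left _ _) ?_)
    have := latticeRank_mono hL hM.le
    omega
  have hLS : L ∈ S := ⟨isPrimitive_refl L, hA.le, hne, le_rfl⟩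
  obtain ⟨M₀, hM₀, hmin⟩ := Set.exists_min_image S (fun M => normDet (quotLattice M A)) hfin ⟨L, hLS⟩
  obtain ⟨B, ⟨hB, hBeq⟩, hmax⟩ := Set.exists_max_image
    {M ∈ S | normDet (quotLattice M A) = normDet (quotLattice M₀ A)} latticeRank
    (hfin.subset (Set.sep_subset _ _)) ⟨M₀, hM₀, rfl⟩
  refine ⟨B, hB.1, hB.2.1, hB.2.2.1, fun M hM hAM hAne => ?_, fun M hM hAM hAne h => ?_⟩
  · rw [hBeq]
    by_cases hMs : normDet (quotLattice M A) ≤ s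
    · exact hmin M ⟨hM, hAM, hAne, hMs⟩
    · exact (hmin L hLS).trans (not_le.1 hMs).le
  · exact hmax M ⟨⟨hM, hAM, hAne, h.trans_le hB.2.2.2⟩, h.trans hBeq⟩

namespace IsDestabilizing

variable {L A B : Submodule ℤ (EuclideanSpace ℝ (Fin n))}

/-- Minimality, written as `det M / det A ≥ r ^ (rank M - rank A)` without quotients. It is extended
from primitive `M ≠ A` to every intermediate `M`: saturating `M` in `L` keeps the rank and does not
increase the determinant. -/
theorem det_mul_pow_le (h : IsDestabilizing L A B) (hL : IsLattice L) (hA : IsPrimitive A L)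
    {M : Submodule ℤ (EuclideanSpace ℝ (Fin n))} (hAM : A ≤ M) (hML : M ≤ L) :
    latticeDet A * normDet (quotLattice B A) ^ latticeRank M ≤
      latticeDet M * normDet (quotLattice B A) ^ latticeRank A := by
  set r := normDet (quotLattice B A) with hr
  have hr0 : 0 < r := ((hA.of_le_of_le h.le h.primitive.le).isLattice_quotLattice
    (hL.of_le h.primitive.le)).normDet_pos
  set M' := L ⊓ (Submodule.span ℝ (M : Set (EuclideanSpace ℝ (Fin n)))).restrictScalars ℤ with hM'
  have hM'p : IsPrimitive M' L := ⟨_, rfl⟩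
  have hMM' : M ≤ M' := le_inf hML fun x hx => Submodule.subset_span hx
  have hM'l : IsLattice M' := hL.of_le inf_le_left
  have hrank : latticeRank M = latticeRank M' := by
    refine le_antisymm (latticeRank_mono hM'l hMM') ?_
    rw [← hM'l.finrank_span, ← (hL.of_le hML).finrank_span]
    exact Submodule.finrank_mono (Submodule.span_le.2 fun x hx => hx.2)
  refine le_trans ?_ (mul_le_mul_of_nonneg_right (latticeDet_le_of_le hM'l hMM' hrank)
    (by positivity))
  rw [hrank]
  by_cases hAM' : A = M'
  · rw [← hAM']
  have hAp := hA.of_le_of_le (hAM.trans hMM') hM'p.le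
  have hq := hAp.isLattice_quotLattice hM'l
  have h1 := hAp.rank_eq_and_det_eq hM'l
  rw [h1.1, h1.2, pow_add, mul_assoc, mul_comm (r ^ _)]
  refine mul_le_mul_of_nonneg_left (mul_le_mul_of_nonneg_right ?_ (by positivity))
    (latticeDet_nonneg _)
  rw [← hq.normDet_pow_rank]
  exact pow_le_pow_left₀ hr0.le (h.normDet_le M' hM'p (hAM.trans hMM') hAM') _

/-- A sublattice of `B / A` is `N' / A` for its preimage `N'` in `B`, and minimality applies to
`N'`. -/
theorem hasDetLowerBound (h : IsDestabilizing L A B) (hL : IsLattice L) (hA : IsPrimitive A L) :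
    HasDetLowerBound (normDet (quotLattice B A)) (quotLattice B A) := by
  intro N hN hNl
  set r := normDet (quotLattice B A) with hr
  have hr0 : 0 < r := ((hA.of_le_of_le h.le h.primitive.le).isLattice_quotLattice
    (hL.of_le h.primitive.le)).normDet_pos
  set π := projInt (Submodule.span ℝ (A : Set (EuclideanSpace ℝ (Fin n))))ᗮ with hπ
  set N' := B ⊓ N.comap π with hN'
  have hAN' : A ≤ N' := le_inf h.le fun x hx => by
    have : π x = 0 := projInt_orthogonal_eq_zero.2 (Submodule.subset_span hx)
    rw [Submodule.mem_comap, this]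
    exact N.zero_mem
  have hN'L : N' ≤ L := inf_le_left.trans h.primitive.le
  have hquot : quotLattice N' A = N := by
    rw [quotLattice_eq, ← hπ]
    apply le_antisymm
    · rintro _ ⟨x, hx, rfl⟩
      exact hx.2
    · intro x hx
      obtain ⟨y, hy, rfl⟩ := hN hx
      exact ⟨y, ⟨hy, hx⟩, rfl⟩
  have h1 := (hA.of_le_of_le hAN' hN'L).rank_eq_and_det_eq (hL.of_le hN'L)
  have h2 := h.det_mul_pow_le hL hA hAN' hN'L
  have hApos := (hL.of_le hA.le).det_pos
  rw [hquot] at h1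
  rw [h1.1, h1.2, ← hr, pow_add, mul_assoc] at h2
  have h3 := le_of_mul_le_mul_left h2 hApos
  rw [mul_comm] at h3
  exact le_of_mul_le_mul_right h3 (by positivity)

/-- Let `M` be the part of `B` orthogonal to `N`; it contains `A`, so minimality bounds `det M` from
below. Cutting `B` gives `det B ≥ det M * det (π_N B)`, and the integral pairing of `N` with `π_N B`
gives `det N * det (π_N B) ≥ 1`. Together these bound `det N` from below. -/
theorem hasDetLowerBound_dual (h : IsDestabilizing L A B) (hL : IsLattice L)
    (hA : IsPrimitive A L) :
    HasDetLowerBound (normDet (quotLattice B A))⁻¹ (dualLattice (quotLattice B A)) := by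
  intro N hN hNl
  set r := normDet (quotLattice B A) with hr
  have hB : IsLattice B := hL.of_le h.primitive.le
  have hAB := hA.of_le_of_le h.le h.primitive.le
  have hq := hAB.isLattice_quotLattice hB
  have hr0 : 0 < r := hq.normDet_pos
  have hNB := fun x (hx : x ∈ N) => (mem_dualLattice_quotLattice h.le).1 (hN hx)
  set V := Submodule.span ℝ (N : Set (EuclideanSpace ℝ (Fin n))) with hV
  have hint : ∀ y ∈ B.map (projInt V), ∀ x ∈ N, ∃ z : ℤ, inner ℝ x y = (z : ℝ) := by
    rintro _ ⟨y, hy, rfl⟩ x hx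
    rw [inner_projInt_of_mem (Submodule.subset_span hx)]
    exact (hNB x hx).2.2 y hy
  -- The projection of `B` is a lattice because it is contained in the dual of `N`.
  have hY : IsLattice (B.map (projInt V)) := by
    refine hNl.dual.of_le fun y hy => ⟨?_, fun x hx => ?_⟩
    · obtain ⟨x, -, rfl⟩ := hy
      exact projInt_mem V x
    · obtain ⟨z, hz⟩ := hint y hy x hx
      exact ⟨z, by rw [real_inner_comm, hz]⟩
  have hYspan : Submodule.span ℝ ((B.map (projInt V) : Submodule ℤ _) :
      Set (EuclideanSpace ℝ (Fin n))) = V := by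
    rw [span_map_projInt]
    apply le_antisymm
    · rintro _ ⟨x, -, rfl⟩
      exact projInt_mem V x
    · intro x hx
      have hxB : x ∈ Submodule.span ℝ (B : Set (EuclideanSpace ℝ (Fin n))) :=
        (Submodule.span_le.2 fun y hy => (hNB y hy).1) hx
      exact ⟨x, hxB, Submodule.starProjection_eq_self_iff.2 hx⟩
  have hdet := hB.rank_add_rank_and_det_mul_det_le Vᗮ (by rwa [Submodule.orthogonal_orthogonal])
  rw [Submodule.orthogonal_orthogonal] at hdet
  have hrank : latticeRank (B.map (projInt V)) = latticeRank N := by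
    rw [← hY.finrank_span, hYspan, ← hNl.finrank_span]
  have hAM : A ≤ B ⊓ Vᗮ.restrictScalars ℤ := by
    refine le_inf h.le fun x hx => ?_
    change x ∈ Vᗮ
    rw [Submodule.mem_orthogonal]
    intro u hu
    induction hu using Submodule.span_induction with
    | mem u hu =>
      exact Submodule.inner_left_of_mem_orthogonal (Submodule.subset_span hx) (hNB u hu).2.1
    | zero => exact inner_zero_left _
    | add u v _ _ hu hv => rw [inner_add_left, hu, hv, add_zero]
    | smul c u _ hu => rw [real_inner_smul_left, hu, mul_zero]
  have h1 := h.det_mul_pow_le hL hA hAM (inf_le_left.trans h.primitive.le)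
  have h2 := hAB.rank_eq_and_det_eq hB
  have hone : 1 ≤ latticeDet N * latticeDet (B.map (projInt V)) := by
    obtain ⟨p, c, hc⟩ := hNl
    obtain ⟨p', d, hd⟩ := hY
    rw [latticeRank_eq_of_span_eq hc.1 hc.2, latticeRank_eq_of_span_eq hd.1 hd.2,
      Fintype.card_fin, Fintype.card_fin] at hrank
    subst hrank
    rw [latticeDet_eq hc, latticeDet_eq hd, ← Real.sqrt_mul (det_gram_nonneg _), Real.one_le_sqrt]
    refine one_le_det_gram_mul_det_gram hd.1 hc.1 (fun j => ?_) fun i j => ?_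
    · rw [← span_real_eq_of_span_eq hd.2, hYspan]
      exact Submodule.subset_span (hc.2.le (Submodule.subset_span ⟨j, rfl⟩))
    · exact hint _ (hd.2.le (Submodule.subset_span ⟨j, rfl⟩)) _
        (hc.2.le (Submodule.subset_span ⟨i, rfl⟩))
  have hApos := (hL.of_le hA.le).det_pos
  have hYpos := hY.det_pos
  have hNpos := hNl.det_pos
  set M := B ⊓ Vᗮ.restrictScalars ℤ with hM
  have h4 : latticeDet A * r ^ latticeRank M ≤ latticeDet A * (r ^ latticeRank M *
      (r ^ latticeRank N * latticeDet N)) := by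
    calc latticeDet A * r ^ latticeRank M ≤ latticeDet M * r ^ latticeRank A := h1
      _ ≤ latticeDet M * r ^ latticeRank A *
          (latticeDet N * latticeDet (B.map (projInt V))) :=
        le_mul_of_one_le_right (mul_nonneg (latticeDet_nonneg _) (by positivity)) hone
      _ = (latticeDet M * latticeDet (B.map (projInt V))) * (r ^ latticeRank A * latticeDet N) := by
        ring
      _ ≤ latticeDet B * (r ^ latticeRank A * latticeDet N) :=
        mul_le_mul_of_nonneg_right hdet.2.1 (by positivity)
      _ = latticeDet A * (r ^ (latticeRank A + latticeRank (quotLattice B A)) * latticeDet N) := by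
        rw [h2.2, ← hq.normDet_pow_rank, ← hr]
        ring
      _ = _ := by
        rw [← h2.1, hdet.1, hrank, pow_add]
        ring
  have h5 := le_of_mul_le_mul_left h4 hApos
  have h6 : 1 ≤ r ^ latticeRank N * latticeDet N :=
    (le_mul_iff_one_le_right (by positivity)).1 h5
  rw [inv_pow]
  exact (inv_le_iff_one_le_mul₀' (by positivity)).2 h6

theorem isTStable (h : IsDestabilizing L A B) (hL : IsLattice L) (hA : IsPrimitive A L) :
    IsTStable 1 ((normDet (quotLattice B A))⁻¹ • quotLattice B A) := by
  have hq := (hA.of_le_of_le h.le h.primitive.le).isLattice_quotLattice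
    (hL.of_le h.primitive.le)
  rw [isTStable_inv_smul_iff one_pos hq.normDet_pos, inv_one, mul_one, mul_one]
  exact ⟨h.hasDetLowerBound hL hA, h.hasDetLowerBound_dual hL hA⟩

/-- Otherwise `nd (C / A)`, a mean of `nd (B / A)` and `nd (C / B)`, would not exceed `nd (B / A)`;
then `C` is also a minimizer, of larger rank than `B`. -/
theorem normDet_lt {C : Submodule ℤ (EuclideanSpace ℝ (Fin n))} (h : IsDestabilizing L A B)
    (h' : IsDestabilizing L B C) (hL : IsLattice L) (hA : IsPrimitive A L) :
    normDet (quotLattice B A) < normDet (quotLattice C B) := by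
  by_contra! hle
  have hC : IsLattice C := hL.of_le h'.primitive.le
  have hAB := hA.of_le_of_le h.le h.primitive.le
  have hBC := h.primitive.of_le_of_le h'.le h'.primitive.le
  have hAC := hAB.trans hBC
  have hne : A ≠ C := fun e => h'.ne (le_antisymm h'.le (e ▸ h.le))
  have hqB := hAB.isLattice_quotLattice (hL.of_le h.primitive.le)
  have hqC := hAC.isLattice_quotLattice hC
  have hqCB := hBC.isLattice_quotLattice hC
  have h1 : normDet (quotLattice C A) ≤ normDet (quotLattice B A) := by
    rw [hqC.normDet_le_iff (quotLattice_ne_bot hAC hne) hqB.normDet_pos.le]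
    have h2 := rank_eq_and_det_eq_of_chain hAB hBC hC
    rw [h2.1, h2.2, pow_add, hqB.normDet_pow_rank, ← hqCB.normDet_pow_rank]
    exact mul_le_mul_of_nonneg_left (pow_le_pow_left₀ hqCB.normDet_pos.le hle _)
      (latticeDet_nonneg _)
  have h3 := h.rank_le C h'.primitive (h.le.trans h'.le) hne
    (le_antisymm h1 (h.normDet_le C h'.primitive (h.le.trans h'.le) hne))
  exact (rank_lt_rank_of_isPrimitive hBC hC h'.ne).not_ge h3

end IsDestabilizing

/-- Iterate the choice of a destabilizing sublattice from `⊥`. The rank grows at each step before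
`L` is reached, so `L` is reached. -/
theorem IsLattice.exists_stable_filtration {L : Submodule ℤ (EuclideanSpace ℝ (Fin n))}
    (hL : IsLattice L) : ∃ (k : ℕ) (F : Fin (k + 1) → Submodule ℤ (EuclideanSpace ℝ (Fin n))),
      IsStableFiltration 1 L F := by
  classical
  -- This makes the choice a total function that can be iterated; its value at `L` and at
  -- non-primitive `A` is arbitrary.
  have hnext : ∀ A, ∃ B, IsPrimitive A L → A ≠ L → IsDestabilizing L A B := fun A => by
    by_cases h : IsPrimitive A L ∧ A ≠ L
    · obtain ⟨B, hB⟩ := exists_isDestabilizing hL h.1 h.2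
      exact ⟨B, fun _ _ => hB⟩
    · exact ⟨A, fun h1 h2 => absurd ⟨h1, h2⟩ h⟩
  choose next hnext using hnext
  set G : ℕ → Submodule ℤ (EuclideanSpace ℝ (Fin n)) := fun i => next^[i] ⊥ with hG
  have hGs : ∀ i, G (i + 1) = next (G i) := fun i => Function.iterate_succ_apply' next i ⊥
  have hprim : ∀ i, (∀ j < i, G j ≠ L) → IsPrimitive (G i) L := by
    intro i
    induction i with
    | zero => exact fun _ => ⟨⊥, by ext x; simp +contextual [hG]⟩
    | succ i ih =>
      intro h
      rw [hGs]
      exact (hnext _ (ih fun j hj => h j (by omega)) (h i (by omega))).primitive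
  have hdest : ∀ i, (∀ j ≤ i, G j ≠ L) → IsDestabilizing L (G i) (G (i + 1)) := by
    intro i h
    rw [hGs]
    exact hnext _ (hprim i fun j hj => h j hj.le) (h i le_rfl)
  have hrank : ∀ i, (∀ j < i, G j ≠ L) → i ≤ latticeRank (G i) := by
    intro i
    induction i with
    | zero => exact fun _ => Nat.zero_le _
    | succ i ih =>
      intro h
      have h1 := ih fun j hj => h j (by omega)
      have hd := hdest i fun j hj => h j (by omega)
      have h2 := rank_lt_rank_of_isPrimitive
        ((hprim i fun j hj => h j (by omega)).of_le_of_le hd.le hd.primitive.le)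
        (hL.of_le hd.primitive.le) hd.ne
      omega
  have hex : ∃ k, G k = L := by
    by_contra! hcon
    have h1 := hrank (latticeRank L + 1) fun j _ => hcon j
    have h2 := latticeRank_mono hL (hprim (latticeRank L + 1) fun j _ => hcon j).le
    omega
  have hmin : ∀ j < Nat.find hex, G j ≠ L := fun j hj => Nat.find_min hex hj
  have hdest' : ∀ i < Nat.find hex, IsDestabilizing L (G i) (G (i + 1)) := fun i hi =>
    hdest i fun j hj => hmin j (by omega)
  have hprim' : ∀ i ≤ Nat.find hex, IsPrimitive (G i) L := fun i hi =>
    hprim i fun j hj => hmin j (by omega)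
  refine ⟨Nat.find hex, fun i => G i, rfl, Nat.find_spec hex, ?_, fun i => ?_, ?_, fun i => ?_⟩
  · rw [Fin.strictMono_iff_lt_succ]
    exact fun i => (hdest' i i.2).le.lt_of_ne (hdest' i i.2).ne
  · exact (hprim' i i.2.le).of_le_of_le (hdest' i i.2).le (hdest' i i.2).primitive.le
  · generalize hk : Nat.find hex = k at *
    cases k with
    | zero => exact fun i => i.elim0
    | succ k =>
      refine Fin.strictMono_iff_lt_succ.2 fun i => ?_
      exact (hdest' i (by omega)).normDet_lt (hdest' (i + 1) (by omega)) hL (hprim' i (by omega))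
  · exact (hdest' i i.2).isTStable hL (hprim' i i.2.le)

end Canonical

/-! Greedy choice of the cut points. -/

section Greedy

/-- The cut points among `0, …, i - 1`: a new block starts at `j` if `T a j` for the start `a` of the
current block. -/
def greedyList (T : ℕ → ℕ → Prop) [DecidableRel T] : ℕ → List ℕ
  | 0 => [0]
  -- The default of `getLastD` is never taken, because the list starts with `0`.
  | i + 1 => if T ((greedyList T i).getLastD 0) i then greedyList T i ++ [i] else greedyList T i

/-- All cut points, including the last one. -/
def greedyOut (T : ℕ → ℕ → Prop) [DecidableRel T] (k : ℕ) : List ℕ :=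
  -- For `k = 0`, appending `k` would repeat the cut point `0`.
  if k = 0 then [0] else greedyList T k ++ [k]

variable {T : ℕ → ℕ → Prop} [DecidableRel T]

/-- Irreflexivity covers the start of a newly opened block. It also prevents `0` from being entered
twice, since the index `0` is tested against itself. -/
theorem getLast_greedyList (hT : ∀ i, ¬ T i i) (i : ℕ) :
    (greedyList T i).getLastD 0 ≤ i - 1 ∧
      ∀ j, (greedyList T i).getLastD 0 ≤ j → j < i → ¬ T ((greedyList T i).getLastD 0) j := by
  induction i with
  | zero => simp [greedyList]
  | succ i ih =>
    rw [greedyList]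
    split_ifs with h
    · simp only [List.getLastD_concat]
      refine ⟨le_rfl, fun j h1 h2 => ?_⟩
      obtain rfl : j = i := by omega
      exact hT j
    · refine ⟨by omega, fun j h1 h2 => ?_⟩
      rcases Nat.lt_succ_iff_lt_or_eq.1 h2 with h3 | rfl
      · exact ih.2 j h1 h3
      · exact h

theorem head_greedyList (i : ℕ) : (greedyList T i).head? = some 0 := by
  induction i with
  | zero => simp [greedyList]
  | succ i ih =>
    rw [greedyList]
    split_ifs
    · rw [List.head?_append, ih]; rfl
    · exact ih

theorem isChain_greedyList (hT : ∀ i, ¬ T i i) (i : ℕ) :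
    (greedyList T i).IsChain
      fun x y => x < y ∧ T x y ∧ y < i ∧ ∀ j, x ≤ j → j < y → ¬ T x j := by
  induction i with
  | zero => simp [greedyList]
  | succ i ih =>
    have ih' := ih.imp (S := fun x y => x < y ∧ T x y ∧ y < i + 1 ∧ ∀ j, x ≤ j → j < y → ¬ T x j)
      fun x y h => ⟨h.1, h.2.1, by omega, h.2.2.2⟩
    rw [greedyList]
    split_ifs with h
    · refine List.isChain_append.2 ⟨ih', List.isChain_singleton _, ?_⟩
      intro x hx y hy
      have hy' : y = i := by simpa using hy.symm
      have hx' : (greedyList T i).getLastD 0 = x := by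
        rw [List.getLastD_eq_getLast?, Option.mem_def.1 hx]; rfl
      have h1 := getLast_greedyList hT i
      rw [hx'] at h h1
      rw [hy']
      refine ⟨?_, h, by omega, h1.2⟩
      rcases Nat.eq_zero_or_pos i with rfl | hi
      · obtain rfl : x = 0 := by omega
        exact absurd h (hT 0)
      · omega
    · exact ih'

/-- The cut at `k` is forced by the end of the filtration, so `T` is asserted only for cuts before
`k`. -/
theorem greedyOut_spec (hT : ∀ i, ¬ T i i) (k : ℕ) :
    (greedyOut T k).head? = some 0 ∧ (greedyOut T k).getLast? = some k ∧
      (greedyOut T k).IsChain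
        fun x y => x < y ∧ (y < k → T x y) ∧ y ≤ k ∧ ∀ j, x ≤ j → j < y → ¬ T x j := by
  rw [greedyOut]
  split_ifs with hk
  · subst hk
    simp
  · refine ⟨?_, by simp, ?_⟩
    · rw [List.head?_append, head_greedyList]; rfl
    · have h := (isChain_greedyList hT k).imp
        (S := fun x y => x < y ∧ (y < k → T x y) ∧ y ≤ k ∧ ∀ j, x ≤ j → j < y → ¬ T x j)
        fun x y h => ⟨h.1, fun _ => h.2.1, h.2.2.1.le, h.2.2.2⟩
      refine List.isChain_append.2 ⟨h, List.isChain_singleton _, ?_⟩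
      intro x hx y hy
      have hy' : y = k := by simpa using hy.symm
      have hx' : (greedyList T k).getLastD 0 = x := by
        rw [List.getLastD_eq_getLast?, Option.mem_def.1 hx]; rfl
      have h1 := getLast_greedyList hT k
      rw [hx'] at h1
      rw [hy']
      exact ⟨by omega, fun h => absurd h (lt_irrefl _), le_rfl, h1.2⟩

/-- Any decidable relation agreeing with the real comparison is admitted, so that the lemma serves
both the pure existence statement and the integer test of the program. -/
theorem exists_isGreedyCut {k : ℕ} {r : Fin k → ℝ} (hT : ∀ i, ¬ T i i)
    (hr : ∀ i j : Fin k, T i j ↔ 2 * r i < r j) :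
    ∃ (k' : ℕ) (l : Fin (k' + 1) → Fin (k + 1)), IsGreedyCut r l ∧
      List.ofFn (fun j => (l j : ℕ)) = greedyOut T k := by
  obtain ⟨h0, hlast, hchain⟩ := greedyOut_spec hT k
  set out := greedyOut T k with hout
  obtain ⟨k', hk'⟩ : ∃ k', out.length = k' + 1 := by
    refine Nat.exists_eq_succ_of_ne_zero fun h => ?_
    rw [List.length_eq_zero_iff.1 h] at h0
    simp at h0
  have hc := List.isChain_iff_getElem.1 hchain
  have h0' : out[0]'(by omega) = 0 := by
    rw [List.head?_eq_getElem?, List.getElem?_eq_getElem (by omega)] at h0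
    exact Option.some_inj.1 h0
  have hl' : out[k']'(by omega) = k := by
    rw [List.getLast?_eq_getElem?, List.getElem?_eq_getElem (by omega)] at hlast
    have := Option.some_inj.1 hlast
    simpa [hk'] using this
  have hle : ∀ (i : ℕ) (hi : i < out.length), out[i] < k + 1 := by
    intro i hi
    rcases i with _ | i
    · rw [h0']; omega
    · exact Nat.lt_succ_of_le (hc i hi).2.2.1
  refine ⟨k', fun j => ⟨out[(j : ℕ)]'(by omega), hle _ _⟩, ⟨?_, ?_, ?_, ?_, ?_⟩, ?_⟩
  · exact Fin.ext h0'
  · exact Fin.ext hl'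
  · refine Fin.strictMono_iff_lt_succ.2 fun j => ?_
    exact Fin.lt_def.2 (hc j (by omega)).1
  · intro j i i' hi h1 h2
    have hj := hc j (by omega)
    have hi' : (i : ℕ) = out[(j : ℕ)]'(by omega) := congrArg Fin.val hi
    have := hj.2.2.2 i' (Fin.le_def.1 h1) (Fin.lt_def.1 h2)
    rw [← hi', hr] at this
    exact not_lt.1 this
  · intro j i i' hi h1
    have hj := hc j (by omega)
    have hi' : (i : ℕ) = out[(j : ℕ)]'(by omega) := congrArg Fin.val hi
    have hi'' : (i' : ℕ) = out[(j : ℕ) + 1]'(by omega) := congrArg Fin.val h1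
    rw [← hr, hi', hi'']
    exact hj.2.1 (by rw [← hi'']; exact i'.2)
  · refine List.ext_getElem (by simp [hk']) fun i h1 h2 => ?_
    rw [List.getElem_ofFn]

end Greedy

theorem IsStableFiltration.quotNormDet_pos {n k : ℕ} {t : ℝ}
    {L : Submodule ℤ (EuclideanSpace ℝ (Fin n))} (hL : IsLattice L)
    {F : Fin (k + 1) → Submodule ℤ (EuclideanSpace ℝ (Fin n))} (hF : IsStableFiltration t L F)
    (i : Fin k) : 0 < quotNormDet F i := by
  have h : F i.succ ≤ L := hF.top ▸ hF.strictMono.monotone (Fin.le_last _)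
  exact ((hF.primitive i).isLattice_quotLattice (hL.of_le h)).normDet_pos

theorem exists_wellSeparated {n k : ℕ} {t : ℝ} (ht : 1 ≤ t)
    {L : Submodule ℤ (EuclideanSpace ℝ (Fin n))} (hL : IsLattice L)
    {F : Fin (k + 1) → Submodule ℤ (EuclideanSpace ℝ (Fin n))} (hF : IsStableFiltration t L F) :
    ∃ (k' : ℕ) (l : Fin (k' + 1) → Fin (k + 1)),
      l 0 = 0 ∧ l (Fin.last k') = Fin.last k ∧ StrictMono l ∧
      IsWellSeparatedFiltration (2 * t) L (F ∘ l) := by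
  classical
  obtain ⟨k', l, hl, -⟩ := exists_isGreedyCut (r := quotNormDet F)
    (T := fun i j => ∃ (hi : i < k) (hj : j < k),
      2 * quotNormDet F ⟨i, hi⟩ < quotNormDet F ⟨j, hj⟩)
    (by
      rintro i ⟨hi, _, h⟩
      have := hF.quotNormDet_pos hL ⟨i, hi⟩
      linarith)
    (fun i j => ⟨fun ⟨_, _, h⟩ => h, fun h => ⟨i.2, j.2, h⟩⟩)
  exact ⟨k', l, hl.zero, hl.last, hl.strictMono, hl.isWellSeparatedFiltration ht hL hF⟩

theorem IsLattice.exists_wellSeparated_two {n : ℕ} {L : Submodule ℤ (EuclideanSpace ℝ (Fin n))}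
    (hL : IsLattice L) : ∃ (k : ℕ) (F : Fin (k + 1) → Submodule ℤ (EuclideanSpace ℝ (Fin n))),
      IsWellSeparatedFiltration 2 L F := by
  obtain ⟨k, F, hF⟩ := hL.exists_stable_filtration
  obtain ⟨k', l, -, -, -, h⟩ := exists_wellSeparated le_rfl hL hF
  exact ⟨k', F ∘ l, by simpa using h⟩

/-! The Faddeev–LeVerrier algorithm for symmetric integer matrices. -/

section FaddeevLeVerrier

/-- The state after `s` steps: the auxiliary matrix and the `s`-th elementary symmetric function of
the eigenvalues of the `d × d` matrix `a`. -/
def leVerrier (a : ℕ → ℕ → ℤ) (d : ℕ) : ℕ → (ℕ → ℕ → ℤ) × ℤ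
  | 0 => (fun _ _ => 0, 1)
  | s + 1 =>
    let f : ℕ → ℕ → ℤ := fun i j => (if i = j then (leVerrier a d s).2 else 0) -
      ∑ l ∈ Finset.range d, a i l * (leVerrier a d s).1 l j
    -- For symmetric `a` this sum is the trace of `a * f`, in the flat order in which the program
    -- runs through a matrix. The division by `s + 1` proves to be exact for `s < d`.
    (f, (∑ p ∈ Finset.range (d * d), a (p / d) (p % d) * f (p / d) (p % d)) / (s + 1))

theorem leVerrier_succ_fst (a : ℕ → ℕ → ℤ) (d s i j : ℕ) :
    (leVerrier a d (s + 1)).1 i j = (if i = j then (leVerrier a d s).2 else 0) -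
      ∑ l ∈ Finset.range d, a i l * (leVerrier a d s).1 l j := rfl

theorem leVerrier_succ_snd (a : ℕ → ℕ → ℤ) (d s : ℕ) :
    (leVerrier a d (s + 1)).2 = (∑ p ∈ Finset.range (d * d),
      a (p / d) (p % d) * (leVerrier a d (s + 1)).1 (p / d) (p % d)) / (s + 1) := rfl

theorem sum_range_mul_self {M : Type*} [AddCommMonoid M] (d : ℕ) (g : ℕ → ℕ → M) :
    ∑ p ∈ Finset.range (d * d), g (p / d) (p % d) = ∑ i : Fin d, ∑ j : Fin d, g i j := by
  rw [Finset.sum_range, ← Fintype.sum_prod_type', ← finProdFinEquiv.symm.sum_comp]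
  rfl

open Matrix in
theorem Matrix.IsHermitian.trace_pow_eq {ι : Type*} [Fintype ι] [DecidableEq ι] {A : Matrix ι ι ℝ}
    (hA : A.IsHermitian) (j : ℕ) : (A ^ j).trace = ∑ i, hA.eigenvalues i ^ j := by
  have h : A ^ j = Unitary.conjStarAlgAut ℝ _ hA.eigenvectorUnitary
      (diagonal (RCLike.ofReal ∘ hA.eigenvalues) ^ j) := by
    rw [map_pow, ← hA.spectral_theorem]
  rw [h, Unitary.conjStarAlgAut_apply, Matrix.trace_mul_comm, ← Matrix.mul_assoc,
    Unitary.coe_star_mul_self, Matrix.one_mul, diagonal_pow, trace_diagonal]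
  rfl

/-- The elementary symmetric functions of the eigenvalues. -/
noncomputable def eigenEsymm {ι : Type*} [Fintype ι] [DecidableEq ι] {A : Matrix ι ι ℝ}
    (hA : A.IsHermitian) (s : ℕ) : ℝ :=
  MvPolynomial.aeval hA.eigenvalues (MvPolynomial.esymm ι ℝ s)

section

variable {ι : Type*} [Fintype ι] [DecidableEq ι] {A : Matrix ι ι ℝ} (hA : A.IsHermitian)

theorem eigenEsymm_zero : eigenEsymm hA 0 = 1 := by
  simp [eigenEsymm]

theorem eigenEsymm_card : eigenEsymm hA (Fintype.card ι) = A.det := by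
  rw [eigenEsymm, MvPolynomial.esymm, map_sum, ← Finset.card_univ, Finset.powersetCard_self,
    Finset.sum_singleton, map_prod, hA.det_eq_prod_eigenvalues]
  simp

/-- Newton's identities at the eigenvalues, whose power sums are the traces of the powers of `A`. -/
theorem succ_mul_eigenEsymm (s : ℕ) : ((s + 1 : ℕ) : ℝ) * eigenEsymm hA (s + 1) =
    ∑ i ∈ Finset.range (s + 1), (-1) ^ (s - i) * eigenEsymm hA i * (A ^ (s + 1 - i)).trace := by
  have h := congrArg (MvPolynomial.aeval hA.eigenvalues)
    (MvPolynomial.mul_esymm_eq_sum ι ℝ (s + 1))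
  simp only [map_mul, map_natCast, map_pow, map_neg, map_one, map_sum, MvPolynomial.psum,
    MvPolynomial.aeval_X] at h
  rw [eigenEsymm, h, Finset.sum_filter, Finset.Nat.sum_antidiagonal_eq_sum_range_succ_mk,
    Finset.sum_range_succ]
  simp only [lt_irrefl, if_false, add_zero]
  rw [Finset.mul_sum]
  refine Finset.sum_congr rfl fun i hi => ?_
  have hi' := Finset.mem_range.1 hi
  rw [if_pos hi', hA.trace_pow_eq, ← mul_assoc, ← mul_assoc, ← pow_add]
  congr 2
  have : s + 1 + 1 + i = s - i + 2 * (i + 1) := by omega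
  rw [this, pow_add, pow_mul]
  simp

/-- Up to sign these are coefficients of the characteristic polynomial of an integer matrix. Their
integrality is what makes the divisions in `leVerrier` exact. -/
theorem exists_int_eigenEsymm {N : Matrix ι ι ℤ} (hN : A = N.map (Int.cast : ℤ → ℝ)) {s : ℕ}
    (hs : s ≤ Fintype.card ι) : ∃ z : ℤ, eigenEsymm hA s = z := by
  have h1 : A.charpoly = N.charpoly.map (Int.castRingHom ℝ) := by
    rw [← Matrix.charpoly_map, hN]; rfl
  have h2 : A.charpoly = ((Finset.univ.val.map hA.eigenvalues).map
      fun t => Polynomial.X - Polynomial.C t).prod := by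
    rw [hA.charpoly_eq, Multiset.map_map]; rfl
  have h3 := Multiset.prod_X_sub_C_coeff (Finset.univ.val.map hA.eigenvalues)
    (k := Fintype.card ι - s) (by simp)
  rw [← h2, h1, Polynomial.coeff_map] at h3
  simp only [Multiset.card_map, Finset.card_val, Finset.card_univ, Nat.sub_sub_self hs] at h3
  rw [eigenEsymm, MvPolynomial.aeval_esymm_eq_multiset_esymm]
  rcases neg_one_pow_eq_or ℝ s with h | h
  · rw [h, one_mul] at h3
    exact ⟨_, h3.symm⟩
  · rw [h] at h3
    refine ⟨-N.charpoly.coeff (Fintype.card ι - s), ?_⟩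
    rw [Int.cast_neg, eq_neg_iff_add_eq_zero]
    change _ + (Int.castRingHom ℝ) _ = 0
    rw [h3]
    ring

end

/-- The auxiliary matrix is an alternating polynomial in `A` with coefficients `e_i`. Multiplied by
`A`, its trace is the right-hand side of Newton's identity. -/
theorem leVerrier_eq {a : ℕ → ℕ → ℤ} {d : ℕ} {A : Matrix (Fin d) (Fin d) ℝ} (hA : A.IsHermitian)
    (ha : ∀ i j : Fin d, A i j = a i j) {s : ℕ} (hs : s ≤ d) :
    ((leVerrier a d s).2 : ℝ) = eigenEsymm hA s ∧
      (Matrix.of fun i j : Fin d => ((leVerrier a d s).1 i j : ℝ)) =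
        ∑ i ∈ Finset.range s, ((-1) ^ (s - 1 - i) * eigenEsymm hA i) • A ^ (s - 1 - i) := by
  induction s with
  | zero =>
    refine ⟨by simp [leVerrier, eigenEsymm_zero], ?_⟩
    ext i j
    simp [leVerrier]
  | succ s ih =>
    obtain ⟨ih1, ih2⟩ := ih (by omega)
    have hM : (Matrix.of fun i j : Fin d => ((leVerrier a d (s + 1)).1 i j : ℝ)) =
        ∑ i ∈ Finset.range (s + 1), ((-1) ^ (s - i) * eigenEsymm hA i) • A ^ (s - i) := by
      have h1 : (Matrix.of fun i j : Fin d => ((leVerrier a d (s + 1)).1 i j : ℝ)) =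
          eigenEsymm hA s • 1 -
            A * Matrix.of fun i j : Fin d => ((leVerrier a d s).1 i j : ℝ) := by
        ext i j
        simp only [Matrix.of_apply, leVerrier_succ_fst, Matrix.sub_apply, Matrix.smul_apply,
          Matrix.mul_apply, ha, Matrix.one_apply, ← ih1, Finset.sum_range]
        push_cast
        simp [Fin.ext_iff]
      rw [h1, ih2, Finset.sum_range_succ, Finset.mul_sum, sub_eq_add_neg, add_comm,
        ← Finset.sum_neg_distrib]
      congr 1
      · refine Finset.sum_congr rfl fun i hi => ?_
        have hi' := Finset.mem_range.1 hi
        have h2 : s - i = s - 1 - i + 1 := by omega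
        rw [Matrix.mul_smul, h2, pow_succ, pow_succ', ← neg_smul]
        congr 1
        ring
      · simp
    refine ⟨?_, hM⟩
    obtain ⟨z, hz⟩ := exists_int_eigenEsymm hA (N := Matrix.of fun i j : Fin d => a i j)
      (by ext i j; simp [ha]) (s := s + 1) (by simpa using hs)
    have htr : ((∑ p ∈ Finset.range (d * d),
        a (p / d) (p % d) * (leVerrier a d (s + 1)).1 (p / d) (p % d) : ℤ) : ℝ) =
        ((s + 1 : ℕ) : ℝ) * eigenEsymm hA (s + 1) := by
      rw [sum_range_mul_self d fun i j => a i j * (leVerrier a d (s + 1)).1 i j,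
        succ_mul_eigenEsymm]
      have h2 : ∑ i ∈ Finset.range (s + 1), (-1) ^ (s - i) * eigenEsymm hA i *
          (A ^ (s + 1 - i)).trace = (A * Matrix.of fun i j : Fin d =>
            ((leVerrier a d (s + 1)).1 i j : ℝ)).trace := by
        rw [hM, Finset.mul_sum, Matrix.trace_sum]
        refine Finset.sum_congr rfl fun i hi => ?_
        have hi' := Finset.mem_range.1 hi
        have h2 : s + 1 - i = s - i + 1 := by omega
        rw [Matrix.mul_smul, Matrix.trace_smul, h2, pow_succ' A, smul_eq_mul]
      rw [h2, Matrix.trace, Finset.sum_comm]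
      push_cast
      refine Finset.sum_congr rfl fun i _ => ?_
      rw [Matrix.diag_apply, Matrix.mul_apply]
      refine Finset.sum_congr rfl fun j _ => ?_
      rw [Matrix.of_apply, ha]
      have hsym : A i j = A j i := by
        have := hA.apply i j
        simpa using this.symm
      rw [ha, ha] at hsym
      rw [hsym]
    rw [hz] at htr ⊢
    rw [leVerrier_succ_snd]
    have h3 : ∑ p ∈ Finset.range (d * d),
        a (p / d) (p % d) * (leVerrier a d (s + 1)).1 (p / d) (p % d) = ((s + 1 : ℕ) : ℤ) * z := by
      exact_mod_cast htr
    rw [h3]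
    have h4 : (((s + 1 : ℕ) : ℤ)) ≠ 0 := by positivity
    push_cast at h4 ⊢
    rw [Int.mul_ediv_cancel_left _ h4]

theorem leVerrier_det {a : ℕ → ℕ → ℤ} {d : ℕ} (ha : ∀ i j, a i j = a j i) :
    (leVerrier a d d).2 = (Matrix.of fun i j : Fin d => a i j).det := by
  have hA : (Matrix.of fun i j : Fin d => (a i j : ℝ)).IsHermitian := by
    ext i j
    simp [ha i j]
  have h := (leVerrier_eq hA (a := a) (fun i j => rfl) le_rfl).1
  have h2 := eigenEsymm_card hA
  rw [Fintype.card_fin] at h2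
  rw [h2] at h
  have h3 : (Matrix.of fun i j : Fin d => (a i j : ℝ)).det =
      (((Matrix.of fun i j : Fin d => a i j).det : ℤ) : ℝ) :=
    ((Int.castRingHom ℝ).map_det _).symm
  rw [h3] at h
  exact_mod_cast h

end FaddeevLeVerrier

/-! Verification of programs for the random access machine. -/

section BitLength

theorem bitLength_le_iff {z : ℤ} {W : ℕ} : bitLength z ≤ W ↔ z.natAbs < 2 ^ W := Nat.size_le

theorem bitLength_le_iff_abs {z : ℤ} {W : ℕ} : bitLength z ≤ W ↔ |z| < 2 ^ W := by
  rw [bitLength_le_iff, Int.abs_eq_natAbs]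
  exact_mod_cast Iff.rfl

theorem bitLength_natCast_le (n : ℕ) : bitLength n ≤ n := by
  rw [bitLength_le_iff, Int.natAbs_natCast]
  exact Nat.lt_two_pow_self

theorem bitLength_natCast_le_of_le {n W : ℕ} (h : n ≤ W) : bitLength n ≤ W :=
  (bitLength_natCast_le n).trans h

theorem bitLength_add_le (x y : ℤ) : bitLength (x + y) ≤ bitLength x + bitLength y + 1 := by
  rw [bitLength_le_iff]
  have hx := bitLength_le_iff.1 (le_refl (bitLength x))
  have hy := bitLength_le_iff.1 (le_refl (bitLength y))
  have h1 : 2 ^ bitLength x ≤ 2 ^ (bitLength x + bitLength y) :=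
    Nat.pow_le_pow_right two_pos (by omega)
  have h2 : 2 ^ bitLength y ≤ 2 ^ (bitLength x + bitLength y) :=
    Nat.pow_le_pow_right two_pos (by omega)
  rw [pow_succ]
  have := Int.natAbs_add_le x y
  omega

theorem bitLength_neg (x : ℤ) : bitLength (-x) = bitLength x := by
  simp [bitLength]

theorem bitLength_sub_le (x y : ℤ) : bitLength (x - y) ≤ bitLength x + bitLength y + 1 := by
  rw [sub_eq_add_neg, ← bitLength_neg y]
  exact bitLength_add_le _ _

theorem bitLength_mul_le (x y : ℤ) : bitLength (x * y) ≤ bitLength x + bitLength y := by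
  rw [bitLength_le_iff, Int.natAbs_mul, pow_add]
  exact Nat.mul_lt_mul'' (bitLength_le_iff.1 le_rfl) (bitLength_le_iff.1 le_rfl)

theorem bitLength_div_le (x y : ℤ) : bitLength (x / y) ≤ bitLength x :=
  Nat.size_le_size (Int.natAbs_ediv_le_natAbs x y)

end BitLength

section Logic

/-- All memory cells hold numbers of at most `W` bits. -/
def RamBounded (W : ℕ) (σ : RamMem) : Prop := ∀ a i, bitLength (σ a i) ≤ W

/-- The cost of an expression is at most `weight * (W + 1)` in a memory of `W`-bit numbers. -/
def RamExpr.weight : RamExpr → ℕ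
  | const z => 1 + bitLength z
  | read _ e => 2 * e.weight + 1
  | add e₁ e₂ => 2 * e₁.weight + 2 * e₂.weight + 1
  | sub e₁ e₂ => 2 * e₁.weight + 2 * e₂.weight + 1
  | mul e₁ e₂ => 2 * e₁.weight + 2 * e₂.weight + 1
  | div e₁ e₂ => 2 * e₁.weight + 2 * e₂.weight + 1

/-- Costs depend on the bit lengths of subexpressions, so cost and bit length are bounded together.
-/
theorem RamExpr.cost_le {W : ℕ} {σ : RamMem} (hσ : RamBounded W σ) (e : RamExpr) :
    e.cost σ ≤ e.weight * (W + 1) ∧ bitLength (e.val σ) ≤ e.weight * (W + 1) := by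
  induction e with
  | const z =>
    simp only [cost, weight, val]
    constructor <;> nlinarith
  | read a e ih =>
    simp only [cost, weight, val]
    have := hσ a (e.val σ)
    constructor <;> nlinarith
  | add e₁ e₂ ih₁ ih₂ =>
    simp only [cost, weight, val]
    have := bitLength_add_le (e₁.val σ) (e₂.val σ)
    constructor <;> nlinarith
  | sub e₁ e₂ ih₁ ih₂ =>
    simp only [cost, weight, val]
    have := bitLength_sub_le (e₁.val σ) (e₂.val σ)
    constructor <;> nlinarith
  | mul e₁ e₂ ih₁ ih₂ =>
    simp only [cost, weight, val]
    have := bitLength_mul_le (e₁.val σ) (e₂.val σ)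
    constructor <;> nlinarith
  | div e₁ e₂ ih₁ ih₂ =>
    simp only [cost, weight, val]
    have := bitLength_div_le (e₁.val σ) (e₂.val σ)
    constructor <;> nlinarith

/-- A bound for the cost of a program whose loops make at most `W` iterations and whose numbers
have at most `W` bits. -/
def RamProg.costBound (W : ℕ) : RamProg → ℕ
  | skip => 1
  | write _ e₁ e₂ => (2 * e₁.weight + 2 * e₂.weight + 1) * (W + 1)
  | seq P Q => P.costBound W + Q.costBound W
  | ifPos e P Q => (2 * e.weight + 1) * (W + 1) + P.costBound W + Q.costBound W
  -- The guard is evaluated once more than the body, hence `W + 1`.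
  | whilePos e P => (W + 1) * ((2 * e.weight + 1) * (W + 1) + P.costBound W)

theorem RamProg.exists_polynomial_costBound (P : RamProg) :
    ∃ p : Polynomial ℕ, ∀ W, P.costBound W = p.eval W := by
  induction P with
  | skip => exact ⟨1, fun W => by simp [costBound]⟩
  | write a e₁ e₂ =>
    exact ⟨((2 * e₁.weight + 2 * e₂.weight + 1 : ℕ) : Polynomial ℕ) * (Polynomial.X + 1),
      fun W => by simp [costBound]⟩
  | seq P Q hP hQ =>
    obtain ⟨p, hp⟩ := hP
    obtain ⟨q, hq⟩ := hQ
    exact ⟨p + q, fun W => by simp [costBound, hp, hq]⟩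
  | ifPos e P Q hP hQ =>
    obtain ⟨p, hp⟩ := hP
    obtain ⟨q, hq⟩ := hQ
    exact ⟨((2 * e.weight + 1 : ℕ) : Polynomial ℕ) * (Polynomial.X + 1) + p + q,
      fun W => by simp [costBound, hp, hq]⟩
  | whilePos e P hP =>
    obtain ⟨p, hp⟩ := hP
    exact ⟨(Polynomial.X + 1) *
      (((2 * e.weight + 1 : ℕ) : Polynomial ℕ) * (Polynomial.X + 1) + p),
      fun W => by simp [costBound, hp]⟩

/-- Started in `σ`, the program halts within its cost bound in a bounded memory that satisfies
`Q`. -/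
def RamWp (W : ℕ) (P : RamProg) (σ : RamMem) (Q : RamMem → Prop) : Prop :=
  ∃ τ c, RamExec P σ c τ ∧ c ≤ P.costBound W ∧ RamBounded W τ ∧ Q τ

variable {W : ℕ} {σ : RamMem} {P R : RamProg} {Q Q' : RamMem → Prop}

theorem RamWp.mono (h : RamWp W P σ Q) (hQ : ∀ τ, RamBounded W τ → Q τ → Q' τ) :
    RamWp W P σ Q' := by
  obtain ⟨τ, c, h1, h2, h3, h4⟩ := h
  exact ⟨τ, c, h1, h2, h3, hQ τ h3 h4⟩

theorem ramWp_skip (hσ : RamBounded W σ) (hQ : Q σ) : RamWp W .skip σ Q :=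
  ⟨σ, 1, .skip σ, le_rfl, hσ, hQ⟩

theorem ramWp_seq (hP : RamWp W P σ fun τ => RamBounded W τ → RamWp W R τ Q) :
    RamWp W (.seq P R) σ Q := by
  obtain ⟨τ, c, h1, h2, h3, h4⟩ := hP
  obtain ⟨υ, d, h5, h6, h7, h8⟩ := h4 h3
  exact ⟨υ, c + d, .seq h1 h5, Nat.add_le_add h2 h6, h7, h8⟩

/-- Store `z` in cell `i` of array `a`. -/
def RamMem.set (σ : RamMem) (a : ℕ) (i z : ℤ) : RamMem :=
  Function.update σ a (Function.update (σ a) i z)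

theorem RamMem.set_of_ne {σ : RamMem} {a b : ℕ} (h : b ≠ a) (i z : ℤ) : σ.set a i z b = σ b :=
  Function.update_of_ne h _ _

theorem RamMem.set_self (σ : RamMem) (a : ℕ) (i z : ℤ) : σ.set a i z a i = z := by
  simp [RamMem.set]

theorem RamMem.set_self_of_ne {σ : RamMem} {a : ℕ} {i j : ℤ} (h : j ≠ i) (z : ℤ) :
    σ.set a i z a j = σ a j := by
  simp [RamMem.set, Function.update_of_ne h]

theorem RamBounded.set (hσ : RamBounded W σ) {a : ℕ} {i z : ℤ} (hz : bitLength z ≤ W) :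
    RamBounded W (σ.set a i z) := by
  intro b j
  by_cases hb : b = a
  · subst hb
    by_cases hj : j = i
    · subst hj
      rwa [RamMem.set_self]
    · rw [RamMem.set_self_of_ne hj]
      exact hσ b j
  · rw [RamMem.set_of_ne hb]
    exact hσ b j

theorem ramWp_write {a : ℕ} {e₁ e₂ : RamExpr} (hσ : RamBounded W σ)
    (hz : bitLength (e₂.val σ) ≤ W) (hQ : Q (σ.set a (e₁.val σ) (e₂.val σ))) :
    RamWp W (.write a e₁ e₂) σ Q := by
  refine ⟨_, _, .write a e₁ e₂ σ, ?_, hσ.set hz, hQ⟩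
  have h1 := e₁.cost_le hσ
  have h2 := e₂.cost_le hσ
  simp only [RamProg.costBound]
  nlinarith

theorem ramWp_ifPos {e : RamExpr} (hσ : RamBounded W σ)
    (hP : 0 < e.val σ → RamWp W P σ Q) (hR : e.val σ ≤ 0 → RamWp W R σ Q) :
    RamWp W (.ifPos e P R) σ Q := by
  have h1 := e.cost_le hσ
  rcases lt_or_ge 0 (e.val σ) with h | h
  · obtain ⟨τ, c, h2, h3, h4, h5⟩ := hP h
    refine ⟨τ, _, .ifPos_true h h2, ?_, h4, h5⟩
    simp only [RamProg.costBound]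
    nlinarith
  · obtain ⟨τ, c, h2, h3, h4, h5⟩ := hR h
    refine ⟨τ, _, .ifPos_false h h2, ?_, h4, h5⟩
    simp only [RamProg.costBound]
    nlinarith

/-- The number `N` of iterations is known in advance, so the invariant is indexed by the iteration
and the induction is on the number of remaining iterations. -/
theorem ramWp_whilePos {e : RamExpr} {I : ℕ → RamMem → Prop} {N : ℕ} (hN : N ≤ W)
    (hσ : RamBounded W σ) (h0 : I 0 σ)
    (hstep : ∀ i < N, ∀ τ, RamBounded W τ → I i τ → 0 < e.val τ ∧ RamWp W P τ (I (i + 1)))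
    (hend : ∀ τ, RamBounded W τ → I N τ → e.val τ ≤ 0 ∧ Q τ) :
    RamWp W (.whilePos e P) σ Q := by
  have key : ∀ j ≤ N, ∀ τ, RamBounded W τ → I (N - j) τ → ∃ υ c, RamExec (.whilePos e P) τ c υ ∧
      c ≤ (j + 1) * ((2 * e.weight + 1) * (W + 1) + P.costBound W) ∧ RamBounded W υ ∧ Q υ := by
    intro j
    induction j with
    | zero =>
      intro _ τ hτ hI
      obtain ⟨h1, h2⟩ := hend τ hτ hI
      have h3 := e.cost_le hτ
      exact ⟨τ, _, .whilePos_false h1, by nlinarith, hτ, h2⟩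
    | succ j ih =>
      intro hj τ hτ hI
      obtain ⟨h1, υ, c, h2, h3, h4, h5⟩ := hstep (N - (j + 1)) (by omega) τ hτ hI
      have h6 : N - (j + 1) + 1 = N - j := by omega
      rw [h6] at h5
      obtain ⟨ω, d, h7, h8, h9, h10⟩ := ih (by omega) υ h4 h5
      have h11 := e.cost_le hτ
      refine ⟨ω, _, .whilePos_true h1 h2 h7, ?_, h9, h10⟩
      nlinarith
  obtain ⟨υ, c, h1, h2, h3, h4⟩ := key N le_rfl σ hσ (by rwa [Nat.sub_self])
  exact ⟨υ, c, h1, h2.trans (Nat.mul_le_mul_right _ (by omega)), h3, h4⟩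

/-- The scalar variable in cell `0` of array `v`. -/
abbrev ramVar (v : ℕ) : RamExpr := .read v (.const 0)

/-- Run `P` for `v = 0, …, e - 1`. -/
def ramFor (v : ℕ) (e : RamExpr) (P : RamProg) : RamProg :=
  .seq (.write v (.const 0) (.const 0))
    (.whilePos (.sub e (ramVar v))
      (.seq P (.write v (.const 0) (.add (ramVar v) (.const 1)))))

/-- The invariant is required after the counter has been updated, which spares a separate condition
that it is insensitive to the counter. -/
theorem ramWp_for {v : ℕ} {e : RamExpr} {I : ℕ → RamMem → Prop} {N : ℕ} (hN : N ≤ W)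
    (hσ : RamBounded W σ) (h0 : I 0 (σ.set v 0 0)) (he : ∀ i τ, i ≤ N → I i τ → e.val τ = N)
    (hstep : ∀ i < N, ∀ τ, RamBounded W τ → I i τ → τ v 0 = i →
      RamWp W P τ fun υ => υ v 0 = i ∧ I (i + 1) (υ.set v 0 (i + 1 : ℕ)))
    (hend : ∀ τ, RamBounded W τ → I N τ → Q τ) : RamWp W (ramFor v e P) σ Q := by
  refine ramWp_seq (ramWp_write hσ (by simp [RamExpr.val, bitLength]) fun hb => ?_)
  refine ramWp_whilePos (I := fun i τ => I i τ ∧ τ v 0 = i) hN hb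
    ⟨h0, by simp [RamExpr.val, RamMem.set_self]⟩ ?_ ?_
  · rintro i hi τ hτ ⟨hI, hv⟩
    refine ⟨?_, ramWp_seq ((hstep i hi τ hτ hI hv).mono ?_)⟩
    · simp only [RamExpr.val, he i τ hi.le hI, hv]
      omega
    · rintro υ - ⟨hv', hI'⟩ hυ
      have h1 : (RamExpr.add (ramVar v) (.const 1)).val υ = (i + 1 : ℕ) := by
        simp [RamExpr.val, hv']
      refine ramWp_write hυ ?_ ?_
      · rw [h1]
        exact bitLength_natCast_le_of_le (by omega)
      · rw [h1]
        exact ⟨hI', by simp [RamExpr.val, RamMem.set_self]⟩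
  · rintro τ hτ ⟨hI, hv⟩
    refine ⟨?_, hend τ hτ hI⟩
    simp only [RamExpr.val, he N τ le_rfl hI, hv]
    omega

/-- The memories agree on all arrays outside of `S`. -/
def RamAgree (S : List ℕ) (σ τ : RamMem) : Prop := ∀ a, a ∉ S → τ a = σ a

theorem RamAgree.refl (S : List ℕ) (σ : RamMem) : RamAgree S σ σ := fun _ _ => rfl

theorem RamAgree.trans {S : List ℕ} {σ τ υ : RamMem} (h : RamAgree S σ τ) (h' : RamAgree S τ υ) :
    RamAgree S σ υ := fun a ha => (h' a ha).trans (h a ha)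

theorem RamAgree.mono {S S' : List ℕ} {σ τ : RamMem} (h : RamAgree S σ τ) (hS : S ⊆ S') :
    RamAgree S' σ τ := fun a ha => h a fun h' => ha (hS h')

theorem RamAgree.set {S : List ℕ} {σ τ : RamMem} (h : RamAgree S σ τ) {a : ℕ} (ha : a ∈ S)
    (i z : ℤ) : RamAgree S σ (τ.set a i z) := fun b hb => by
  rw [RamMem.set_of_ne fun hba => hb (by rwa [hba])]
  exact h b hb

/-- Initialize `x` by `e₀` and update it by `e` for `v = 0, …, N - 1`. -/
def ramFold (v x : ℕ) (cnt e₀ e : RamExpr) : RamProg :=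
  .seq (.write x (.const 0) e₀) (ramFor v cnt (.write x (.const 0) e))

/-- The bit bound is imposed on every intermediate value `f i`, since each of them is stored on the
way to `f N`. -/
theorem ramWp_fold {v x : ℕ} (hvx : v ≠ x) {cnt e₀ e : RamExpr} {N : ℕ} (hN : N ≤ W)
    (hσ : RamBounded W σ) (f : ℕ → ℤ) (hf : ∀ i ≤ N, bitLength (f i) ≤ W) (h0 : e₀.val σ = f 0)
    (hcnt : ∀ τ, RamAgree [v, x] σ τ → cnt.val τ = N)
    (he : ∀ i τ, i < N → RamAgree [v, x] σ τ → τ v 0 = i → τ x 0 = f i → e.val τ = f (i + 1)) :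
    RamWp W (ramFold v x cnt e₀ e) σ fun τ => RamAgree [v, x] σ τ ∧ τ x 0 = f N := by
  refine ramWp_seq (ramWp_write hσ (by rw [h0]; exact hf 0 (Nat.zero_le _)) fun hb => ?_)
  refine ramWp_for (I := fun i τ => RamAgree [v, x] σ τ ∧ τ x 0 = f i) hN hb ?_ ?_ ?_ ?_
  · refine ⟨((RamAgree.refl _ _).set (by simp) _ _).set (by simp) _ _, ?_⟩
    rw [RamMem.set_of_ne hvx.symm]
    simp [RamExpr.val, RamMem.set_self, h0]
  · exact fun i τ _ h => hcnt τ h.1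
  · rintro i hi τ hτ ⟨h1, h2⟩ h3
    have h4 := he i τ hi h1 h3 h2
    refine ramWp_write hτ (by rw [h4]; exact hf _ hi) ⟨?_, ?_, ?_⟩
    · rw [RamMem.set_of_ne hvx, h3]
    · exact (h1.set (by simp) _ _).set (by simp) _ _
    · rw [RamMem.set_of_ne hvx.symm]
      simp [RamExpr.val, RamMem.set_self, h4]
  · exact fun τ _ h => h

/-- Fill the first cells of array `x`: for `v = 0, …, N - 1`, run `P` and store `e` in cell `v`. -/
def ramFill (v x : ℕ) (cnt : RamExpr) (P : RamProg) (e : RamExpr) : RamProg :=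
  ramFor v cnt (.seq P (.write x (ramVar v) e))

/-- `S` contains the scratch arrays of `P`. Keeping `v` and `x` outside of it protects the counter
and the cells already filled. -/
theorem ramWp_fill {v x : ℕ} (hvx : v ≠ x) {S : List ℕ} (hvS : v ∉ S) (hxS : x ∉ S)
    {cnt e : RamExpr} {N : ℕ} (hN : N ≤ W) (hσ : RamBounded W σ) (f : ℕ → ℤ)
    (hf : ∀ i < N, bitLength (f i) ≤ W)
    (hcnt : ∀ τ, RamAgree (v :: x :: S) σ τ → cnt.val τ = N)
    (he : ∀ i τ, i < N → RamBounded W τ → RamAgree (v :: x :: S) σ τ → τ v 0 = i →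
      RamWp W P τ fun υ => RamAgree S τ υ ∧ e.val υ = f i) :
    RamWp W (ramFill v x cnt P e) σ fun τ =>
      RamAgree (v :: x :: S) σ τ ∧ ∀ i < N, τ x (i : ℕ) = f i := by
  refine ramWp_for (I := fun i τ => RamAgree (v :: x :: S) σ τ ∧ ∀ j < i, τ x (j : ℕ) = f j)
    hN hσ ?_ ?_ ?_ ?_
  · exact ⟨(RamAgree.refl _ _).set (by simp) _ _, fun j hj => absurd hj (Nat.not_lt_zero _)⟩
  · exact fun i τ _ h => hcnt τ h.1
  · rintro i hi τ hτ ⟨h1, h2⟩ h3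
    refine ramWp_seq ((he i τ hi hτ h1 h3).mono ?_)
    rintro υ - ⟨h4, h5⟩ hυ
    have hv : υ v 0 = i := by rw [h4 v hvS, h3]
    refine ramWp_write hυ (by rw [h5]; exact hf i hi) ⟨?_, ?_, ?_⟩
    · rw [RamMem.set_of_ne hvx, hv]
    · refine (RamAgree.set ?_ (by simp) _ _).set (by simp) _ _
      exact h1.trans (h4.mono fun a ha => by simp [ha])
    · intro j hj
      rw [RamMem.set_of_ne hvx.symm, h5]
      simp only [RamExpr.val, hv]
      rcases Nat.lt_succ_iff_lt_or_eq.1 hj with h6 | rfl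
      · rw [RamMem.set_self_of_ne (by exact_mod_cast h6.ne), h4 x hxS, h2 j h6]
      · rw [RamMem.set_self]
  · exact fun τ _ h => h

end Logic

/-! The program for Gram determinants. -/

section GramDet

/-- Matrices are stored row by row: entry `(i, l)` of a `d × d` matrix is in cell `i * d + l`. -/
theorem index_lt {d i l : ℕ} (hi : i < d) (hl : l < d) : i * d + l < d * d := by
  have : (i + 1) * d ≤ d * d := Nat.mul_le_mul_right d hi
  linarith [add_one_mul i d]

theorem index_div {d i l : ℕ} (hl : l < d) : (i * d + l) / d = i := by
  rw [Nat.add_comm, Nat.add_mul_div_right _ _ (by omega), Nat.div_eq_of_lt hl, zero_add]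

theorem index_mod {d i l : ℕ} (hl : l < d) : (i * d + l) % d = l := by
  rw [Nat.add_comm, Nat.add_mul_mod_self_right, Nat.mod_eq_of_lt hl]

theorem div_lt_of_lt_mul_self {d p : ℕ} (hp : p < d * d) : p / d < d :=
  Nat.div_lt_of_lt_mul hp

theorem mod_lt_of_lt_mul_self {d p : ℕ} (hp : p < d * d) : p % d < d :=
  Nat.mod_lt _ (by rcases Nat.eq_zero_or_pos d with rfl | h <;> omega)

/-- The remainder of a division. -/
def ramMod (e₁ e₂ : RamExpr) : RamExpr := .sub e₁ (.mul (.div e₁ e₂) e₂)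

theorem ramMod_val {σ : RamMem} {e₁ e₂ : RamExpr} {p d : ℕ} (h₁ : e₁.val σ = p)
    (h₂ : e₂.val σ = d) : (ramMod e₁ e₂).val σ = (p % d : ℕ) := by
  simp only [ramMod, RamExpr.val, h₁, h₂]
  push_cast
  rw [Int.emod_def]
  ring

theorem ramDiv_val {σ : RamMem} {e₁ e₂ : RamExpr} {p d : ℕ} (h₁ : e₁.val σ = p)
    (h₂ : e₂.val σ = d) : (RamExpr.div e₁ e₂).val σ = (p / d : ℕ) := by
  simp only [RamExpr.val, h₁, h₂]
  push_cast
  rfl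

/-- The `l`-th coordinate of the `j`-th vector, multiplied by the common denominator `D`. Numerators
and denominators of the vectors start in cell `o`. -/
def scaledEntry (w : ℤ → ℤ) (D : ℤ) (o n j l : ℕ) : ℤ :=
  -- In the application `D` is a multiple of this denominator, so the division is exact.
  w (o + 2 * (j * n + l) : ℕ) * (D / w (o + 2 * (j * n + l) + 1 : ℕ))

/-- The inner products of the scaled vectors. -/
def scaledGram (w : ℤ → ℤ) (D : ℤ) (o n i j : ℕ) : ℤ :=
  ∑ l ∈ Finset.range n, scaledEntry w D o n i l * scaledEntry w D o n j l

theorem scaledGram_comm (w : ℤ → ℤ) (D : ℤ) (o n i j : ℕ) :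
    scaledGram w D o n i j = scaledGram w D o n j i :=
  Finset.sum_congr rfl fun _ _ => mul_comm _ _

/-- The position of a coordinate in the input. -/
def entryPos (j : RamExpr) : RamExpr :=
  .add (ramVar 5) (.mul (.const 2) (.add (.mul j (ramVar 2)) (ramVar 9)))

/-- A scaled coordinate. -/
def entryExpr (j : RamExpr) : RamExpr :=
  .mul (.read 1 (entryPos j)) (.div (ramVar 4) (.read 1 (.add (entryPos j) (.const 1))))

theorem entryExpr_val {τ : RamMem} {w : ℤ → ℤ} {D : ℤ} {o n l i : ℕ} {j : RamExpr}
    (h1 : τ 1 = w) (h2 : τ 2 0 = n) (h4 : τ 4 0 = D) (h5 : τ 5 0 = o) (h9 : τ 9 0 = l)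
    (hj : j.val τ = i) : (entryExpr j).val τ = scaledEntry w D o n i l := by
  simp only [entryExpr, entryPos, RamExpr.val, h1, h2, h4, h5, h9, hj, scaledEntry]
  push_cast
  rfl

/-- Compute the Gram matrix of the scaled vectors. -/
def gramProg : RamProg :=
  -- Array `2` holds `n`, `4` the common denominator, `5` the offset of the basis and `6` its rank;
  -- `8` is the flat matrix index, `9` the coordinate, `10` the accumulator.
  ramFill 8 13 (.mul (ramVar 6) (ramVar 6))
    (ramFold 9 10 (ramVar 2) (.const 0) (.add (ramVar 10)
      (.mul (entryExpr (.div (ramVar 8) (ramVar 6))) (entryExpr (ramMod (ramVar 8) (ramVar 6))))))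
    (ramVar 10)

theorem ramVar_val (σ : RamMem) (v : ℕ) : (ramVar v).val σ = σ v 0 := rfl

/-- The bound on `n` is asked only for `0 < d`: the dimension is encoded in binary, and without any
basis vector it can be exponential in the input length. -/
theorem ramWp_gramProg {W : ℕ} {σ : RamMem} (hσ : RamBounded W σ) {w : ℤ → ℤ} {D : ℤ}
    {o n d : ℕ} (h1 : σ 1 = w) (h2 : σ 2 0 = n) (h4 : σ 4 0 = D) (h5 : σ 5 0 = o)
    (h6 : σ 6 0 = d) (hn : 0 < d → n ≤ W) (hd : d * d ≤ W)
    (hb : ∀ i < d, ∀ j < d, ∀ q ≤ n, bitLength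
      (∑ l ∈ Finset.range q, scaledEntry w D o n i l * scaledEntry w D o n j l) ≤ W) :
    RamWp W gramProg σ fun τ => RamAgree [8, 13, 9, 10] σ τ ∧
      ∀ p < d * d, τ 13 (p : ℕ) = scaledGram w D o n (p / d) (p % d) := by
  refine ramWp_fill (by decide) (by decide) (by decide) hd hσ
    (fun p => scaledGram w D o n (p / d) (p % d)) ?_ ?_ ?_
  · intro p hp
    exact hb _ (div_lt_of_lt_mul_self hp) _ (mod_lt_of_lt_mul_self hp) n le_rfl
  · intro τ hτ
    simp only [RamExpr.val, hτ 6 (by decide), h6]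
    push_cast
    rfl
  · intro p τ hp hτb hτ hp8
    have hd0 : 0 < d := by rcases Nat.eq_zero_or_pos d with rfl | h <;> omega
    refine ramWp_fold (by decide) (hn hd0) hτb (fun q => ∑ l ∈ Finset.range q,
      scaledEntry w D o n (p / d) l * scaledEntry w D o n (p % d) l) ?_ ?_ ?_ ?_
    · exact fun q hq =>
        hb _ (div_lt_of_lt_mul_self hp) _ (mod_lt_of_lt_mul_self hp) q hq
    · simp [RamExpr.val]
    · intro υ hυ
      rw [ramVar_val, hυ 2 (by decide), hτ 2 (by decide), h2]
    · intro l υ hl hυ h9 h10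
      have e1 : υ 1 = w := by rw [hυ 1 (by decide), hτ 1 (by decide), h1]
      have e2 : υ 2 0 = n := by rw [hυ 2 (by decide), hτ 2 (by decide), h2]
      have e4 : υ 4 0 = D := by rw [hυ 4 (by decide), hτ 4 (by decide), h4]
      have e5 : υ 5 0 = o := by rw [hυ 5 (by decide), hτ 5 (by decide), h5]
      have e6 : (ramVar 6).val υ = d := by
        rw [ramVar_val, hυ 6 (by decide), hτ 6 (by decide), h6]
      have e8 : (ramVar 8).val υ = p := by rw [ramVar_val, hυ 8 (by decide), hp8]
      simp only [RamExpr.val, h10, entryExpr_val e1 e2 e4 e5 h9 (ramDiv_val e8 e6),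
        entryExpr_val e1 e2 e4 e5 h9 (ramMod_val e8 e6), Finset.sum_range_succ]

/-- `1` if the expressions are equal and `0` otherwise. -/
def ramEq (e₁ e₂ : RamExpr) : RamExpr :=
  .div (.const 1) (.add (.const 1) (.mul (.sub e₁ e₂) (.sub e₁ e₂)))

theorem ramEq_val {σ : RamMem} {e₁ e₂ : RamExpr} {i j : ℕ} (h₁ : e₁.val σ = i)
    (h₂ : e₂.val σ = j) : (ramEq e₁ e₂).val σ = if i = j then 1 else 0 := by
  simp only [ramEq, RamExpr.val, h₁, h₂]
  split_ifs with h
  · simp [h]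
  · refine Int.ediv_eq_zero_of_lt zero_le_one ?_
    have : ((i : ℤ) - j) ≠ 0 := sub_ne_zero.2 (by exact_mod_cast h)
    have := mul_self_pos.2 this
    omega

/-- One step of the Faddeev–LeVerrier algorithm. -/
def leVerrierStep : RamProg :=
  -- Array `11` holds the step, `12` the coefficient, `13` the given matrix and `14` the auxiliary
  -- one. The new auxiliary matrix is built in `15`, because `14` is still being read.
  .seq (ramFill 8 15 (.mul (ramVar 6) (ramVar 6))
    (ramFold 9 10 (ramVar 6) (.const 0) (.add (ramVar 10)
      (.mul (.read 13 (.add (.mul (.div (ramVar 8) (ramVar 6)) (ramVar 6)) (ramVar 9)))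
        (.read 14 (.add (.mul (ramVar 9) (ramVar 6)) (ramMod (ramVar 8) (ramVar 6)))))))
    (.sub (.mul (ramVar 12) (ramEq (.div (ramVar 8) (ramVar 6)) (ramMod (ramVar 8) (ramVar 6))))
      (ramVar 10)))
  (.seq (ramFill 8 14 (.mul (ramVar 6) (ramVar 6)) .skip (.read 15 (ramVar 8)))
  (.seq (ramFold 8 10 (.mul (ramVar 6) (ramVar 6)) (.const 0) (.add (ramVar 10)
      (.mul (.read 13 (ramVar 8)) (.read 14 (ramVar 8)))))
    (.write 12 (.const 0) (.div (ramVar 10) (.add (ramVar 11) (.const 1))))))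

/-- All numbers that occur in the Faddeev–LeVerrier algorithm have at most `W` bits. -/
structure LeVerrierBounded (W : ℕ) (a : ℕ → ℕ → ℤ) (d : ℕ) : Prop where
  matrix : ∀ s ≤ d, ∀ i < d, ∀ j < d, bitLength ((leVerrier a d s).1 i j) ≤ W
  coeff : ∀ s ≤ d, bitLength (leVerrier a d s).2 ≤ W
  product : ∀ s < d, ∀ i < d, ∀ j < d, ∀ q ≤ d,
    bitLength (∑ l ∈ Finset.range q, a i l * (leVerrier a d s).1 l j) ≤ W
  trace : ∀ s ≤ d, ∀ q ≤ d * d, bitLength (∑ p ∈ Finset.range q,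
    a (p / d) (p % d) * (leVerrier a d s).1 (p / d) (p % d)) ≤ W

theorem ramWp_leVerrierStep {W : ℕ} {σ : RamMem} (hσ : RamBounded W σ) {a : ℕ → ℕ → ℤ} {d s : ℕ}
    (hs : s < d) (hd : d * d ≤ W) (hb : LeVerrierBounded W a d) (h6 : σ 6 0 = d) (h11 : σ 11 0 = s)
    (h13 : ∀ p < d * d, σ 13 (p : ℕ) = a (p / d) (p % d))
    (h14 : ∀ p < d * d, σ 14 (p : ℕ) = (leVerrier a d s).1 (p / d) (p % d))
    (h12 : σ 12 0 = (leVerrier a d s).2) :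
    RamWp W leVerrierStep σ fun τ => RamAgree [8, 9, 10, 12, 14, 15] σ τ ∧
      (∀ p < d * d, τ 14 (p : ℕ) = (leVerrier a d (s + 1)).1 (p / d) (p % d)) ∧
      τ 12 0 = (leVerrier a d (s + 1)).2 := by
  have hdW : d ≤ W := (Nat.le_mul_self d).trans hd
  have hdd : ∀ {S : List ℕ} {τ : RamMem}, 6 ∉ S → RamAgree S σ τ →
      (RamExpr.mul (ramVar 6) (ramVar 6)).val τ = (d * d : ℕ) := by
    intro S τ hS hτ
    simp only [RamExpr.val, hτ 6 hS, h6]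
    push_cast
    rfl
  refine ramWp_seq ((ramWp_fill (S := [9, 10]) (by decide) (by decide) (by decide) hd hσ
    (fun p => (leVerrier a d (s + 1)).1 (p / d) (p % d)) ?_ (fun τ hτ => hdd (by decide) hτ)
    ?_).mono ?_)
  · exact fun p hp =>
      hb.matrix (s + 1) hs _ (div_lt_of_lt_mul_self hp) _ (mod_lt_of_lt_mul_self hp)
  · intro p τ hp hτb hτ hp8
    have hi := div_lt_of_lt_mul_self hp
    have hj := mod_lt_of_lt_mul_self hp
    refine (ramWp_fold (by decide) hdW hτb (fun q => ∑ l ∈ Finset.range q,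
      a (p / d) l * (leVerrier a d s).1 l (p % d)) ?_ ?_ ?_ ?_).mono ?_
    · exact fun q hq => hb.product s hs _ hi _ hj q hq
    · simp [RamExpr.val]
    · intro υ hυ
      rw [ramVar_val, hυ 6 (by decide), hτ 6 (by decide), h6]
    · intro l υ hl hυ h9 h10
      have e6 : (ramVar 6).val υ = d := by
        rw [ramVar_val, hυ 6 (by decide), hτ 6 (by decide), h6]
      have e8 : (ramVar 8).val υ = p := by rw [ramVar_val, hυ 8 (by decide), hp8]
      have i1 : (RamExpr.add (.mul (.div (ramVar 8) (ramVar 6)) (ramVar 6)) (ramVar 9)).val υ =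
          (p / d * d + l : ℕ) := by
        have := ramDiv_val e8 e6
        simp only [RamExpr.val] at this e6 ⊢
        rw [this, e6, h9]
        push_cast
        rfl
      have i2 : (RamExpr.add (.mul (ramVar 9) (ramVar 6))
          (ramMod (ramVar 8) (ramVar 6))).val υ = (l * d + p % d : ℕ) := by
        have := ramMod_val e8 e6
        simp only [RamExpr.val] at this e6 ⊢
        rw [this, e6, h9]
        push_cast
        rfl
      change υ 10 0 + υ 13 (RamExpr.val υ _) * υ 14 (RamExpr.val υ _) = _
      rw [i1, i2, h10, hυ 13 (by decide), hτ 13 (by decide), hυ 14 (by decide), hτ 14 (by decide),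
        h13 _ (index_lt hi hl), h14 _ (index_lt hl hj), index_div hl, index_mod hl,
        index_div hj, index_mod hj, Finset.sum_range_succ]
    · rintro υ - ⟨hυ, h10⟩
      refine ⟨hυ, ?_⟩
      have e6 : (ramVar 6).val υ = d := by
        rw [ramVar_val, hυ 6 (by decide), hτ 6 (by decide), h6]
      have e8 : (ramVar 8).val υ = p := by rw [ramVar_val, hυ 8 (by decide), hp8]
      change υ 12 0 * (ramEq _ _).val υ - υ 10 0 = _
      rw [ramEq_val (ramDiv_val e8 e6) (ramMod_val e8 e6), h10, hυ 12 (by decide), hτ 12 (by decide), h12, leVerrier_succ_fst]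
      simp
  rintro τ - ⟨hτ, h15⟩ hτb
  refine ramWp_seq ((ramWp_fill (S := []) (by decide) (by decide) (by decide) hd hτb
    (fun p => (leVerrier a d (s + 1)).1 (p / d) (p % d)) ?_ ?_ ?_).mono ?_)
  · exact fun p hp =>
      hb.matrix (s + 1) hs _ (div_lt_of_lt_mul_self hp) _ (mod_lt_of_lt_mul_self hp)
  · intro υ hυ
    simp only [RamExpr.val, hυ 6 (by decide), hτ 6 (by decide), h6]
    push_cast
    rfl
  · intro p υ hp hυb hυ hp8
    refine ramWp_skip hυb ⟨RamAgree.refl _ _, ?_⟩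
    simp only [RamExpr.val, hp8, hυ 15 (by decide), h15 p hp]
  rintro υ - ⟨hυ, h14'⟩ hυb
  refine ramWp_seq ((ramWp_fold (by decide) hd hυb (fun q => ∑ p ∈ Finset.range q,
    a (p / d) (p % d) * (leVerrier a d (s + 1)).1 (p / d) (p % d)) ?_ ?_ ?_ ?_).mono ?_)
  · exact fun q hq => hb.trace (s + 1) hs q hq
  · simp [RamExpr.val]
  · intro ω hω
    simp only [RamExpr.val, hω 6 (by decide), hυ 6 (by decide), hτ 6 (by decide), h6]
    push_cast
    rfl
  · intro p ω hp hω hp8 h10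
    simp only [RamExpr.val, hp8, h10, hω 13 (by decide), hυ 13 (by decide), hτ 13 (by decide),
      hω 14 (by decide), h13 p hp, h14' p hp, Finset.sum_range_succ]
  rintro ω - ⟨hω, h10⟩ hωb
  have hc : (RamExpr.div (ramVar 10) (.add (ramVar 11) (.const 1))).val ω =
      (leVerrier a d (s + 1)).2 := by
    simp only [RamExpr.val, h10, hω 11 (by decide), hυ 11 (by decide), hτ 11 (by decide), h11,
      leVerrier_succ_snd]
  refine ramWp_write hωb (by rw [hc]; exact hb.coeff _ hs) ⟨?_, fun p hp => ?_, ?_⟩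
  · refine RamAgree.set ?_ (by decide) _ _
    exact ((hτ.mono (by decide)).trans (hυ.mono (by decide))).trans (hω.mono (by decide))
  · rw [RamMem.set_of_ne (by decide), hω 14 (by decide), h14' p hp]
  · rw [hc]
    exact RamMem.set_self _ _ _ _

/-- The Faddeev–LeVerrier algorithm. -/
def leVerrierProg : RamProg :=
  .seq (ramFill 8 14 (.mul (ramVar 6) (ramVar 6)) .skip (.const 0))
  (.seq (.write 12 (.const 0) (.const 1)) (ramFor 11 (ramVar 6) leVerrierStep))

theorem ramWp_leVerrierProg {W : ℕ} {σ : RamMem} (hσ : RamBounded W σ) {a : ℕ → ℕ → ℤ} {d : ℕ}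
    (hW : 0 < W) (hd : d * d ≤ W) (hb : LeVerrierBounded W a d) (h6 : σ 6 0 = d)
    (h13 : ∀ p < d * d, σ 13 (p : ℕ) = a (p / d) (p % d)) :
    RamWp W leVerrierProg σ fun τ => RamAgree [8, 9, 10, 11, 12, 14, 15] σ τ ∧
      τ 12 0 = (leVerrier a d d).2 := by
  refine ramWp_seq ((ramWp_fill (S := []) (by decide) (by decide) (by decide) hd hσ
    (fun p => (leVerrier a d 0).1 (p / d) (p % d)) ?_ ?_ ?_).mono ?_)
  · exact fun p hp => by simp [leVerrier, bitLength]
  · intro υ hυ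
    simp only [RamExpr.val, hυ 6 (by decide), h6]
    push_cast
    rfl
  · intro p υ hp hυb hυ hp8
    exact ramWp_skip hυb ⟨RamAgree.refl _ _, rfl⟩
  rintro τ - ⟨hτ, h14⟩ hτb
  refine ramWp_seq (ramWp_write hτb (by simp [RamExpr.val, bitLength]; omega) fun hb' => ?_)
  refine ramWp_for (I := fun s τ => RamAgree [8, 9, 10, 11, 12, 14, 15] σ τ ∧
    (∀ p < d * d, τ 14 (p : ℕ) = (leVerrier a d s).1 (p / d) (p % d)) ∧
    τ 12 0 = (leVerrier a d s).2) ((Nat.le_mul_self d).trans hd) hb' ?_ ?_ ?_ ?_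
  · refine ⟨((hτ.mono (by decide)).set (by decide) _ _).set (by decide) _ _, fun p hp => ?_, ?_⟩
    · rw [RamMem.set_of_ne (by decide), RamMem.set_of_ne (by decide), h14 p hp]
    · rw [RamMem.set_of_ne (by decide)]
      exact RamMem.set_self _ _ _ _
  · rintro s υ - ⟨hυ, -⟩
    rw [ramVar_val, hυ 6 (by decide), h6]
  · rintro s hs υ hυb ⟨hυ, h14, h12⟩ h11
    refine (ramWp_leVerrierStep hυb hs hd hb (by rw [hυ 6 (by decide), h6]) h11
      (fun p hp => by rw [hυ 13 (by decide), h13 p hp]) h14 h12).mono ?_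
    rintro ω - ⟨hω, h14', h12'⟩
    refine ⟨by rw [hω 11 (by decide), h11], ?_, fun p hp => ?_, ?_⟩
    · exact (hυ.trans (hω.mono (by decide))).set (by decide) _ _
    · rw [RamMem.set_of_ne (by decide), h14' p hp]
    · rw [RamMem.set_of_ne (by decide), h12']
  · rintro υ - ⟨hυ, -, h12⟩
    exact ⟨hυ, h12⟩

end GramDet

/-! ### Sizes of the numbers in the Faddeev–LeVerrier recursion. -/

section LeVerrierBound

theorem abs_sum_range_le {f : ℕ → ℤ} {q N : ℕ} {B : ℤ} (hB : 0 ≤ B) (hq : q ≤ N)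
    (hf : ∀ l < N, |f l| ≤ B) : |∑ l ∈ Finset.range q, f l| ≤ N * B := by
  refine (Finset.abs_sum_le_sum_abs _ _).trans ?_
  refine (Finset.sum_le_card_nsmul _ _ B fun l hl =>
    hf l ((Finset.mem_range.1 hl).trans_le hq)).trans ?_
  rw [Finset.card_range, nsmul_eq_mul]
  exact mul_le_mul_of_nonneg_right (by exact_mod_cast hq) hB

variable {a : ℕ → ℕ → ℤ} {d : ℕ} {X : ℤ}

/-- One step multiplies the bound by at most `1 + d * X` for the matrix, then by at most `d² * X`
for the trace: two factors `Z`. -/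
theorem abs_leVerrier_le (hX : 1 ≤ X) (ha : ∀ i < d, ∀ j < d, |a i j| ≤ X) {Z : ℤ}
    (hZ1 : 1 + d * X ≤ Z) (hZ2 : ((d * d : ℕ) : ℤ) * X ≤ Z) (s : ℕ) :
    (∀ i < d, ∀ j < d, |(leVerrier a d s).1 i j| ≤ Z ^ (2 * s)) ∧
      |(leVerrier a d s).2| ≤ Z ^ (2 * s) := by
  have hdX : 0 ≤ (d : ℤ) * X := by positivity
  have hZ : 1 ≤ Z := by linarith
  induction s with
  | zero => simp [leVerrier]
  | succ s ih =>
    have hp : 1 ≤ Z ^ (2 * s) := one_le_pow₀ hZ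
    have hM : ∀ i < d, ∀ j < d, |(leVerrier a d (s + 1)).1 i j| ≤ Z ^ (2 * s + 1) := by
      intro i hi j hj
      rw [leVerrier_succ_fst]
      refine (abs_sub _ _).trans ?_
      have h1 : |if i = j then (leVerrier a d s).2 else 0| ≤ Z ^ (2 * s) := by
        split_ifs
        · exact ih.2
        · rw [abs_zero]; positivity
      have h2 := abs_sum_range_le (f := fun l => a i l * (leVerrier a d s).1 l j)
        (q := d) (N := d) (B := X * Z ^ (2 * s)) (by positivity) le_rfl fun l hl => by
          rw [abs_mul]
          exact mul_le_mul (ha i hi l hl) (ih.1 l hl j hj) (abs_nonneg _) (by linarith)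
      have h3 : (1 + d * X) * Z ^ (2 * s) ≤ Z * Z ^ (2 * s) :=
        mul_le_mul_of_nonneg_right hZ1 (by positivity)
      rw [pow_succ]
      linarith
    refine ⟨fun i hi j hj => (hM i hi j hj).trans (pow_le_pow_right₀ hZ (by omega)), ?_⟩
    rw [leVerrier_succ_snd]
    refine (Int.abs_ediv_le_abs _ _).trans ?_
    have h2 := abs_sum_range_le (q := d * d) (N := d * d) (B := X * Z ^ (2 * s + 1))
      (f := fun p => a (p / d) (p % d) * (leVerrier a d (s + 1)).1 (p / d) (p % d))
      (by positivity) le_rfl fun p hp => by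
        rw [abs_mul]
        have hi := div_lt_of_lt_mul_self hp
        have hj := mod_lt_of_lt_mul_self hp
        exact mul_le_mul (ha _ hi _ hj) (hM _ hi _ hj) (abs_nonneg _) (by linarith)
    have h3 : ((d * d : ℕ) * X) * Z ^ (2 * s + 1) ≤ Z * Z ^ (2 * s + 1) :=
      mul_le_mul_of_nonneg_right hZ2 (by positivity)
    have h4 : Z ^ (2 * (s + 1)) = Z * Z ^ (2 * s + 1) := by ring
    rw [h4]
    linarith

/-- `(d + 1)² X` dominates `1 + d X`, `d X` and `d² X`. Partial sums after at most `d` steps cost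
one more factor, hence the exponent `2 * d + 1`. -/
theorem leVerrierBounded_of_abs_le (hX : 1 ≤ X) (ha : ∀ i < d, ∀ j < d, |a i j| ≤ X) {W : ℕ}
    (hW : (((d + 1) * (d + 1) : ℕ) * X) ^ (2 * d + 1) < 2 ^ W) : LeVerrierBounded W a d := by
  set Z : ℤ := ((d + 1) * (d + 1) : ℕ) * X with hZdef
  have hdX : 0 ≤ (d : ℤ) * X := by positivity
  have hddX : 0 ≤ ((d * d : ℕ) : ℤ) * X := by positivity
  have hZ : Z = (d * d : ℕ) * X + 2 * (d * X) + X := by rw [hZdef]; push_cast; ring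
  have hZ1 : 1 + d * X ≤ Z := by linarith
  have hZ2 : ((d * d : ℕ) : ℤ) * X ≤ Z := by linarith
  have hZ3 : (d : ℤ) * X ≤ Z := by linarith
  have hZ0 : 1 ≤ Z := by linarith
  have h := abs_leVerrier_le hX ha hZ1 hZ2
  have key : ∀ {z : ℤ} {e : ℕ}, e ≤ 2 * d + 1 → |z| ≤ Z ^ e → bitLength z ≤ W := fun he hz =>
    bitLength_le_iff_abs.2 ((hz.trans (pow_le_pow_right₀ hZ0 he)).trans_lt hW)
  refine ⟨fun s hs i hi j hj => key (by omega) ((h s).1 i hi j hj),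
    fun s hs => key (by omega) (h s).2, fun s hs i hi j hj q hq => ?_, fun s hs q hq => ?_⟩
  · refine key (e := 2 * s + 1) (by omega) ((abs_sum_range_le (B := X * Z ^ (2 * s))
      (by positivity) hq fun l hl => ?_).trans ?_)
    · rw [abs_mul]
      exact mul_le_mul (ha i hi l hl) ((h s).1 l hl j hj) (abs_nonneg _) (by linarith)
    · rw [pow_succ']
      have : ((d : ℤ) * X) * Z ^ (2 * s) ≤ Z * Z ^ (2 * s) :=
        mul_le_mul_of_nonneg_right hZ3 (by positivity)
      linarith
  · refine key (e := 2 * s + 1) (by omega) ((abs_sum_range_le (B := X * Z ^ (2 * s))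
      (by positivity) hq fun p hp => ?_).trans ?_)
    · rw [abs_mul]
      have hi := div_lt_of_lt_mul_self hp
      have hj := mod_lt_of_lt_mul_self hp
      exact mul_le_mul (ha _ hi _ hj) ((h s).1 _ hi _ hj) (abs_nonneg _) (by linarith)
    · rw [pow_succ']
      have : ((d * d : ℕ) * X) * Z ^ (2 * s) ≤ Z * Z ^ (2 * s) :=
        mul_le_mul_of_nonneg_right hZ2 (by positivity)
      linarith

end LeVerrierBound

/-! ### The greedy test as a comparison of integer powers. -/

section BlockTest

theorem bitLength_mul_pow_le (z y : ℤ) (q : ℕ) :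
    bitLength (z * y ^ q) ≤ bitLength z + q * bitLength y := by
  induction q with
  | zero => simp
  | succ q ih =>
    rw [pow_succ, ← mul_assoc]
    refine (bitLength_mul_le _ _).trans ?_
    rw [add_one_mul]
    omega

/-- Compute `e₀ * b ^ cnt` in `x`. -/
def ramPow (x : ℕ) (cnt e₀ b : RamExpr) : RamProg := ramFold 8 x cnt e₀ (.mul (ramVar x) b)

theorem ramWp_pow {x : ℕ} (hx : 8 ≠ x) {W : ℕ} {σ : RamMem} (hσ : RamBounded W σ)
    {cnt e₀ b : RamExpr} {N : ℕ} {z y : ℤ} (h₀ : e₀.val σ = z) (hN : N ≤ W)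
    (hcnt : ∀ τ, RamAgree [8, x] σ τ → cnt.val τ = N)
    (hb : ∀ τ, RamAgree [8, x] σ τ → b.val τ = y)
    (hW : bitLength z + N * bitLength y ≤ W) :
    RamWp W (ramPow x cnt e₀ b) σ fun τ => RamAgree [8, x] σ τ ∧ τ x 0 = z * y ^ N := by
  refine ramWp_fold hx hN hσ (fun q => z * y ^ q) (fun q hq => ?_) (by simpa using h₀) hcnt ?_
  · have := Nat.mul_le_mul_right (bitLength y) hq
    exact (bitLength_mul_pow_le z y q).trans (by omega)
  · intro q τ _ hτ _ hx
    change τ x 0 * b.val τ = _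
    rw [hx, hb τ hτ, pow_succ, mul_assoc]

/-- The test `2 * r a < r i`, in terms of the ranks `m` and the squared determinants `g` of the
members of the filtration. -/
def BlockTest (g : ℕ → ℤ) (m : ℕ → ℕ) (a i : ℕ) : Prop :=
  -- With `g_{j+1} / g_j = (D r_j) ^ (2 d_j)`, this is the inequality `2 r_a < r_i` raised to the
  -- power `2 d_a d_i` and cleared of denominators; the `4` is `2²`.
  g (a + 1) ^ (m (i + 1) - m i) * (4 ^ (m (i + 1) - m i) * g i) ^ (m (a + 1) - m a) <
    g a ^ (m (i + 1) - m i) * g (i + 1) ^ (m (a + 1) - m a)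

instance (g : ℕ → ℤ) (m : ℕ → ℕ) : DecidableRel (BlockTest g m) :=
  fun _ _ => inferInstanceAs (Decidable (_ < _))

/-- Compute both sides of `BlockTest`. -/
def blockTestProg : RamProg :=
  -- Array `7` holds `i` and `19` holds `a`; `22` and `23` receive the rank differences at `a` and
  -- `i`, and `24` the power of `4`. The right side of the test goes to `20`, the left side to `21`.
  .seq (.write 22 (.const 0)
    (.sub (.read 17 (.add (ramVar 19) (.const 1))) (.read 17 (ramVar 19))))
  (.seq (.write 23 (.const 0)
    (.sub (.read 17 (.add (ramVar 7) (.const 1))) (.read 17 (ramVar 7))))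
  (.seq (ramPow 24 (ramVar 23) (.const 1) (.const 4))
  (.seq (ramPow 20 (ramVar 23) (.const 1) (.read 16 (ramVar 19)))
  (.seq (ramPow 20 (ramVar 22) (ramVar 20) (.read 16 (.add (ramVar 7) (.const 1))))
  (.seq (ramPow 21 (ramVar 23) (.const 1) (.read 16 (.add (ramVar 19) (.const 1))))
    (ramPow 21 (ramVar 22) (ramVar 21) (.mul (ramVar 24) (.read 16 (ramVar 7)))))))))

theorem ramWp_blockTestProg {W : ℕ} {σ : RamMem} (hσ : RamBounded W σ) {g : ℕ → ℤ} {m : ℕ → ℕ}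
    {k a i G M : ℕ} (ha : a < k) (hi : i < k) (hm : Monotone m) (hM : m k ≤ M)
    (hG : ∀ j ≤ k, bitLength (g j) ≤ G) (hW : (M + 1) * (3 * M + 2 * G + 2) ≤ W)
    (h7 : σ 7 0 = i) (h19 : σ 19 0 = a) (h16 : ∀ j ≤ k, σ 16 (j : ℕ) = g j)
    (h17 : ∀ j ≤ k, σ 17 (j : ℕ) = m j) :
    RamWp W blockTestProg σ fun τ => RamAgree [8, 20, 21, 22, 23, 24] σ τ ∧
      τ 20 0 = g a ^ (m (i + 1) - m i) * g (i + 1) ^ (m (a + 1) - m a) ∧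
      τ 21 0 = g (a + 1) ^ (m (i + 1) - m i) *
        (4 ^ (m (i + 1) - m i) * g i) ^ (m (a + 1) - m a) := by
  have hd : ∀ j < k, m (j + 1) - m j ≤ M := fun j hj =>
    (Nat.sub_le _ _).trans ((hm hj).trans hM)
  have hda := hd a ha
  have hdi := hd i hi
  have hga := hG a ha.le
  have hga' := hG (a + 1) ha
  have hgi := hG i hi.le
  have hgi' := hG (i + 1) hi
  have e : ∀ {τ : RamMem}, τ 17 = σ 17 → ∀ j < k,
      τ 17 ((j : ℤ) + 1) - τ 17 j = (m (j + 1) - m j : ℕ) := by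
    intro τ hτ j hj
    have := h17 (j + 1) hj
    push_cast at this
    rw [hτ, this, h17 j hj.le, Nat.cast_sub (hm j.le_succ)]
  set da := m (a + 1) - m a
  set di := m (i + 1) - m i
  have hMW : M ≤ W := by nlinarith
  have b1 : da * G ≤ M * G := Nat.mul_le_mul_right G hda
  have b2 : di * G ≤ M * G := Nat.mul_le_mul_right G hdi
  -- The bit length of the larger side: at most `M` factors `g (a + 1)` and `M` factors `4 ^ di * g
  -- i`, where `4` has three binary digits.
  have b3 : M * (1 + 3 * M + G) + M * G + 1 ≤ W := by nlinarith
  have one : bitLength 1 = 1 := by decide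
  have four : bitLength 4 = 3 := by decide
  have v22 : (RamExpr.sub (.read 17 (.add (ramVar 19) (.const 1))) (.read 17 (ramVar 19))).val σ =
      da := by
    change σ 17 (σ 19 0 + 1) - σ 17 (σ 19 0) = _
    rw [h19, e rfl a ha]
  refine ramWp_seq (ramWp_write hσ ?_ fun hb1 => ?_)
  · rw [v22]
    exact bitLength_natCast_le_of_le (hda.trans hMW)
  rw [v22] at hb1 ⊢
  set σ1 := σ.set 22 (RamExpr.val σ (.const 0)) da
  have s1 : RamAgree [22] σ σ1 := (RamAgree.refl _ _).set (by simp) _ _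
  have s22 : σ1 22 0 = da := RamMem.set_self _ _ _ _
  have v23 : (RamExpr.sub (.read 17 (.add (ramVar 7) (.const 1))) (.read 17 (ramVar 7))).val σ1 =
      di := by
    change σ1 17 (σ1 7 0 + 1) - σ1 17 (σ1 7 0) = _
    rw [s1 7 (by decide), h7, e (s1 17 (by decide)) i hi]
  refine ramWp_seq (ramWp_write hb1 ?_ fun hb2 => ?_)
  · rw [v23]
    exact bitLength_natCast_le_of_le (hdi.trans hMW)
  rw [v23] at hb2 ⊢
  set σ2 := σ1.set 23 (RamExpr.val σ1 (.const 0)) di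
  have s2 : RamAgree [22, 23] σ σ2 := (s1.mono (by simp)).set (by simp) _ _
  have t22 : σ2 22 0 = da := by rw [← s22]; exact congrFun (RamMem.set_of_ne (by decide) _ _) _
  have t23 : σ2 23 0 = di := RamMem.set_self _ _ _ _
  clear_value σ2
  refine ramWp_seq ((ramWp_pow (z := 1) (y := 4) (N := di) (by decide) hb2 rfl (hdi.trans hMW)
    (fun τ hτ => by rw [ramVar_val, hτ 23 (by decide), t23]) (fun _ _ => rfl)
    (by rw [one, four]; nlinarith)).mono ?_)
  rintro τ₁ - ⟨u1, w1⟩ hb3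
  refine ramWp_seq ((ramWp_pow (z := 1) (y := g a) (N := di) (by decide) hb3 rfl (hdi.trans hMW)
    (fun τ hτ => by rw [ramVar_val, hτ 23 (by decide), u1 23 (by decide), t23]) (fun τ hτ => ?_)
    (by rw [one]; have := Nat.mul_le_mul_left di hga; omega)).mono ?_)
  · change τ 16 (τ 19 0) = _
    rw [hτ 16 (by decide), hτ 19 (by decide), u1 16 (by decide), u1 19 (by decide),
      s2 16 (by decide), s2 19 (by decide), h19, h16 a ha.le]
  rintro τ₂ - ⟨u2, w2⟩ hb4
  refine ramWp_seq ((ramWp_pow (e₀ := ramVar 20) (z := 1 * g a ^ di) (y := g (i + 1)) (N := da) (by decide) hb4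
    w2 (hda.trans hMW) (fun τ hτ => by
      rw [ramVar_val, hτ 22 (by decide), u2 22 (by decide), u1 22 (by decide), t22])
    (fun τ hτ => ?_) ?_).mono ?_)
  · change τ 16 (τ 7 0 + 1) = _
    rw [hτ 16 (by decide), hτ 7 (by decide), u2 16 (by decide), u2 7 (by decide),
      u1 16 (by decide), u1 7 (by decide), s2 16 (by decide), s2 7 (by decide), h7]
    exact_mod_cast h16 (i + 1) hi
  · have h1 := bitLength_mul_pow_le 1 (g a) di
    have h2 := Nat.mul_le_mul_left di hga
    have h3 := Nat.mul_le_mul_left da hgi'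
    have h4 : M * G + M * G + 1 ≤ W := by nlinarith
    omega
  rintro τ₃ - ⟨u3, w3⟩ hb5
  refine ramWp_seq ((ramWp_pow (z := 1) (y := g (a + 1)) (N := di) (by decide) hb5 rfl
    (hdi.trans hMW) (fun τ hτ => by
      rw [ramVar_val, hτ 23 (by decide), u3 23 (by decide), u2 23 (by decide),
        u1 23 (by decide), t23])
    (fun τ hτ => ?_) (by rw [one]; have := Nat.mul_le_mul_left di hga'; omega)).mono ?_)
  · change τ 16 (τ 19 0 + 1) = _
    rw [hτ 16 (by decide), hτ 19 (by decide), u3 16 (by decide), u3 19 (by decide),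
      u2 16 (by decide), u2 19 (by decide),
      u1 16 (by decide), u1 19 (by decide), s2 16 (by decide), s2 19 (by decide), h19]
    exact_mod_cast h16 (a + 1) ha
  rintro τ₄ - ⟨u4, w4⟩ hb6
  refine (ramWp_pow (e₀ := ramVar 21) (z := 1 * g (a + 1) ^ di) (y := 4 ^ di * g i) (N := da) (by decide) hb6
    w4 (hda.trans hMW) (fun τ hτ => by
      rw [ramVar_val, hτ 22 (by decide), u4 22 (by decide), u3 22 (by decide), u2 22 (by decide),
        u1 22 (by decide), t22])
    (fun τ hτ => ?_) ?_).mono ?_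
  · change τ 24 0 * τ 16 (τ 7 0) = _
    rw [hτ 24 (by decide), hτ 16 (by decide), hτ 7 (by decide), u4 24 (by decide),
      u4 16 (by decide), u4 7 (by decide), u3 24 (by decide), u3 16 (by decide), u3 7 (by decide),
      u2 24 (by decide), u2 16 (by decide), u2 7 (by decide), w1,
      u1 16 (by decide), u1 7 (by decide), s2 16 (by decide), s2 7 (by decide), h7, h16 i hi.le,
      one_mul]
  · have h1 := bitLength_mul_pow_le 1 (g (a + 1)) di
    have h2 := Nat.mul_le_mul_left di hga'
    have h3 : bitLength (4 ^ di * g i) ≤ 1 + 3 * M + G := by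
      refine (bitLength_mul_le _ _).trans ?_
      have := bitLength_mul_pow_le 1 4 di
      rw [one_mul, one, four] at this
      omega
    have h4 := Nat.mul_le_mul hda h3
    omega
  rintro τ₅ - ⟨u5, w5⟩
  refine ⟨?_, ?_, ?_⟩
  · exact (((((s2.mono (by simp)).trans (u1.mono (by simp))).trans (u2.mono (by simp))).trans
      (u3.mono (by simp))).trans (u4.mono (by simp))).trans (u5.mono (by simp))
  · rw [u5 20 (by decide), u4 20 (by decide), w3, one_mul]
  · rw [w5, one_mul]

end BlockTest

/-! ### The greedy cut as a program. -/

section GreedyProg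

/-- Array `1` holds the list `l`, and array `18` its length. -/
def RamHolds (σ : RamMem) (l : List ℕ) : Prop :=
  σ 18 0 = (l.length : ℤ) ∧ ∀ (j : ℕ) (hj : j < l.length), σ 1 (j : ℕ) = l[j]

theorem RamHolds.of_agree {S : List ℕ} {σ τ : RamMem} {l : List ℕ} (h : RamHolds σ l)
    (hτ : RamAgree S σ τ) (h1 : 1 ∉ S) (h18 : 18 ∉ S) : RamHolds τ l := by
  refine ⟨by rw [hτ 18 h18, h.1], fun j hj => by rw [hτ 1 h1, h.2 j hj]⟩

/-- Append an entry to the list in array `1`. -/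
def appendProg (e : RamExpr) : RamProg :=
  .seq (.write 1 (ramVar 18) e) (.write 18 (.const 0) (.add (ramVar 18) (.const 1)))

theorem ramWp_appendProg {W : ℕ} {σ : RamMem} (hσ : RamBounded W σ) {l : List ℕ}
    (hl : RamHolds σ l) (hlW : l.length < W) {e : RamExpr} {x : ℕ} (hx : e.val σ = x)
    (hxW : x ≤ W) : RamWp W (appendProg e) σ fun τ =>
      RamAgree [1, 18] σ τ ∧ RamHolds τ (l ++ [x]) := by
  have h18 : (ramVar 18).val σ = (l.length : ℕ) := by rw [ramVar_val, hl.1]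
  refine ramWp_seq (ramWp_write hσ ?_ fun hb => ?_)
  · rw [hx]
    exact bitLength_natCast_le_of_le hxW
  rw [hx, h18] at hb ⊢
  have h18' : (RamExpr.add (ramVar 18) (.const 1)).val (σ.set 1 (l.length : ℕ) x) =
      (l.length + 1 : ℕ) := by
    simp only [RamExpr.val]
    rw [RamMem.set_of_ne (by decide), hl.1]
    push_cast
    rfl
  refine ramWp_write hb ?_ ?_
  · rw [h18']
    exact bitLength_natCast_le_of_le hlW
  rw [h18']
  refine ⟨((RamAgree.refl _ _).set (by simp) _ _).set (by simp) _ _, ?_, fun j hj => ?_⟩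
  · rw [show RamExpr.val _ (.const 0) = 0 from rfl, RamMem.set_self]
    simp
  · rw [RamMem.set_of_ne (by decide)]
    rw [List.length_append, List.length_singleton] at hj
    rcases Nat.lt_succ_iff_lt_or_eq.1 hj with h | rfl
    · rw [RamMem.set_self_of_ne (by exact_mod_cast h.ne), hl.2 j h, List.getElem_append_left h]
    · rw [RamMem.set_self]
      simp

/-- Find the cut points, from the squared determinants in array `16` and the ranks in array
`17`. -/
def greedyProg : RamProg :=
  -- The output overwrites the input in array `1`, which is no longer read. Array `19` holds the
  -- start of the current block.
  .seq (.write 1 (.const 0) (.const 0))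
  (.seq (.write 18 (.const 0) (.const 1))
  (.seq (.write 19 (.const 0) (.const 0))
  (.seq (ramFor 7 (ramVar 3) (.seq blockTestProg (.ifPos (.sub (ramVar 20) (ramVar 21))
    (.seq (appendProg (ramVar 7)) (.write 19 (.const 0) (ramVar 7))) .skip)))
  (.seq (.ifPos (ramVar 3) (appendProg (ramVar 3)) .skip)
    (.write 0 (.const 0) (ramVar 18))))))

theorem length_greedyList_le (T : ℕ → ℕ → Prop) [DecidableRel T] (i : ℕ) :
    (greedyList T i).length ≤ i + 1 := by
  induction i with
  | zero => simp [greedyList]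
  | succ i ih =>
    rw [greedyList]
    split_ifs
    · simpa using ih
    · omega

theorem not_blockTest_self {g : ℕ → ℤ} {m : ℕ → ℕ}
    (hg : ∀ j, 0 < g j) (i : ℕ) : ¬ BlockTest g m i i := by
  have h1 : 0 < g i := hg i
  rw [BlockTest, not_lt, mul_pow, ← mul_assoc, mul_comm (g i ^ _)]
  refine mul_le_mul_of_nonneg_right ?_ (by positivity)
  have h2 : 0 < g (i + 1) := hg (i + 1)
  exact le_mul_of_one_le_right (by positivity) (one_le_pow₀ (one_le_pow₀ (by norm_num)))

theorem ramWp_greedyProg {W : ℕ} {σ : RamMem} (hσ : RamBounded W σ) {g : ℕ → ℤ} {m : ℕ → ℕ}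
    {k G M : ℕ} (hm : Monotone m) (hM : m k ≤ M)
    (hG : ∀ j ≤ k, bitLength (g j) ≤ G) (hW : (M + 1) * (3 * M + 2 * G + 2) ≤ W)
    (hk : k + 2 ≤ W) (h3 : σ 3 0 = k) (h16 : ∀ j ≤ k, σ 16 (j : ℕ) = g j)
    (h17 : ∀ j ≤ k, σ 17 (j : ℕ) = m j) :
    RamWp W greedyProg σ fun τ =>
      RamOutput τ ((greedyOut (BlockTest g m) k).map fun i : ℕ => (i : ℤ)) := by
  have one : bitLength 1 = 1 := by decide
  have zero : bitLength 0 = 0 := by decide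
  have last_le : ∀ i, (greedyList (BlockTest g m) i).getLastD 0 ≤ i - 1 := by
    intro i
    induction i with
    | zero => simp [greedyList]
    | succ i ih =>
      rw [greedyList]
      split_ifs
      · simp
      · omega
  refine ramWp_seq (ramWp_write hσ (by simp [RamExpr.val, zero]) fun hb1 => ?_)
  refine ramWp_seq (ramWp_write hb1 (by simp [RamExpr.val, one]; omega) fun hb2 => ?_)
  refine ramWp_seq (ramWp_write hb2 (by simp [RamExpr.val, zero]) fun hb3 => ?_)
  simp only [RamExpr.val] at hb3 ⊢
  refine ramWp_seq ((ramWp_for (N := k) (I := fun i τ =>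
    RamAgree [1, 7, 8, 18, 19, 20, 21, 22, 23, 24] σ τ ∧
    RamHolds τ (greedyList (BlockTest g m) i) ∧
    τ 19 0 = ((greedyList (BlockTest g m) i).getLastD 0 : ℕ))
    (Q := fun τ => RamAgree [1, 7, 8, 18, 19, 20, 21, 22, 23, 24] σ τ ∧
    RamHolds τ (greedyList (BlockTest g m) k))
    (by omega) hb3 ?_ ?_ ?_ ?_).mono ?_)
  · refine ⟨((((RamAgree.refl _ _).set (by simp) _ _).set (by simp) _ _).set (by simp) _ _).set
      (by simp) _ _, ⟨?_, fun j hj => ?_⟩, ?_⟩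
    · rw [RamMem.set_of_ne (by decide), RamMem.set_of_ne (by decide), RamMem.set_self]
      simp [greedyList]
    · simp only [greedyList, List.length_singleton, Nat.lt_one_iff] at hj
      subst hj
      rw [RamMem.set_of_ne (by decide), RamMem.set_of_ne (by decide),
        RamMem.set_of_ne (by decide), Nat.cast_zero, RamMem.set_self]
      simp [greedyList]
    · rw [RamMem.set_of_ne (by decide), RamMem.set_self]
      simp [greedyList]
  · rintro i τ - ⟨hτ, -⟩
    rw [ramVar_val, hτ 3 (by decide), h3]
  · rintro i hi τ hτb ⟨hτ, hl, h19⟩ h7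
    have hlen := length_greedyList_le (BlockTest g m) i
    refine ramWp_seq ((ramWp_blockTestProg hτb (lt_of_le_of_lt (last_le i) (by omega)) hi hm hM hG
      hW h7 h19 (fun j hj => by rw [hτ 16 (by decide), h16 j hj])
      (fun j hj => by rw [hτ 17 (by decide), h17 j hj])).mono ?_)
    rintro υ - ⟨hυ, h20, h21⟩ hυb
    have hl' := hl.of_agree hυ (by decide) (by decide)
    have hval : RamExpr.val υ (.sub (ramVar 20) (ramVar 21)) = υ 20 0 - υ 21 0 := rfl
    refine ramWp_ifPos hυb (fun hpos => ?_) (fun hneg => ?_)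
    · have hT : BlockTest g m ((greedyList (BlockTest g m) i).getLastD 0) i := by
        rw [hval, h20, h21, sub_pos] at hpos
        exact hpos
      have hv7 : (ramVar 7).val υ = i := by rw [ramVar_val, hυ 7 (by decide), h7]
      refine ramWp_seq ((ramWp_appendProg hυb hl' (by omega) hv7 (by omega)).mono ?_)
      rintro ω - ⟨hω, hl''⟩ hωb
      have hv7' : (ramVar 7).val ω = i := by rw [ramVar_val, hω 7 (by decide)]; exact hv7
      refine ramWp_write hωb (by rw [hv7']; exact bitLength_natCast_le_of_le (by omega)) ?_
      rw [hv7']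
      refine ⟨?_, ?_, ?_, ?_⟩
      · rw [RamMem.set_of_ne (by decide)]
        exact hv7'
      · exact (((hτ.trans (hυ.mono (by simp))).trans (hω.mono (by simp))).set (by simp) _ _).set
          (by simp) _ _
      · rw [greedyList, if_pos hT]
        exact hl''.of_agree (S := [19, 7])
          (((RamAgree.refl _ _).set (by simp) _ _).set (by simp) _ _) (by decide) (by decide)
      · rw [greedyList, if_pos hT, RamMem.set_of_ne (by decide), List.getLastD_concat]
        exact RamMem.set_self _ _ _ _
    · have hT : ¬ BlockTest g m ((greedyList (BlockTest g m) i).getLastD 0) i := by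
        rw [hval, h20, h21, sub_nonpos] at hneg
        exact not_lt.2 hneg
      refine ramWp_skip hυb ⟨by rw [hυ 7 (by decide), h7], ?_, ?_, ?_⟩
      · exact (hτ.trans (hυ.mono (by simp))).set (by simp) _ _
      · rw [greedyList, if_neg hT]
        exact hl'.of_agree (S := [7]) ((RamAgree.refl _ _).set (by simp) _ _)
          (by decide) (by decide)
      · rw [greedyList, if_neg hT, RamMem.set_of_ne (by decide), hυ 19 (by decide), h19]
  · rintro τ - ⟨h1, h2, -⟩
    exact ⟨h1, h2⟩
  rintro τ - ⟨hτ, hl⟩ hτb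
  have hv3 : (ramVar 3).val τ = k := by rw [ramVar_val, hτ 3 (by decide), h3]
  have hlen := length_greedyList_le (BlockTest g m) k
  have hlen' : (greedyOut (BlockTest g m) k).length ≤ k + 2 := by
    rw [greedyOut]
    split_ifs
    · simp
    · simpa using hlen
  refine ramWp_seq (RamWp.mono (Q := fun τ => RamHolds τ (greedyOut (BlockTest g m) k))
    (ramWp_ifPos hτb (fun hpos => ?_) (fun hneg => ?_)) ?_)
  · rw [hv3] at hpos
    refine (ramWp_appendProg hτb hl (by omega) hv3 (by omega)).mono ?_
    rintro υ - ⟨-, h⟩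
    rwa [greedyOut, if_neg (by omega)]
  · rw [hv3] at hneg
    obtain rfl : k = 0 := by omega
    exact ramWp_skip hτb hl
  rintro υ - hl' hυb
  have hv18 : (ramVar 18).val υ = ((greedyOut (BlockTest g m) k).length : ℕ) := by
    rw [ramVar_val, hl'.1]
  refine ramWp_write hυb ?_ ⟨?_, fun j => ?_⟩
  · rw [hv18]
    exact bitLength_natCast_le_of_le (hlen'.trans hk)
  · rw [hv18, List.length_map]
    exact RamMem.set_self _ _ _ _
  · have hj : (j : ℕ) < (greedyOut (BlockTest g m) k).length := j.2.trans_eq (List.length_map _)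
    rw [RamMem.set_of_ne (by decide), hl'.2 j hj]
    simp

end GreedyProg

/-! ### The complete program: common denominator, ranks, Gram determinants, cuts. -/

section DetsProg

/-- The position of the first entry of the `i`-th basis. -/
def basisOffset (k n : ℕ) (m : ℕ → ℕ) (i : ℕ) : ℕ :=
  -- The header occupies `k + 3` cells: `n`, `k` and the `k + 1` ranks.
  k + 3 + ∑ j ∈ Finset.range i, 2 * n * m j

/-- The product of the first `q` denominators. -/
def denProd (w : ℤ → ℤ) (k q : ℕ) : ℤ := ∏ p ∈ Finset.range q, w (k + 4 + 2 * p : ℕ)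

/-- The determinant of the Gram matrix of the scaled `i`-th basis. -/
def scaledDet (w : ℤ → ℤ) (k n N : ℕ) (m : ℕ → ℕ) (i : ℕ) : ℤ :=
  (leVerrier (scaledGram w (denProd w k N) (basisOffset k n m i) n) (m i) (m i)).2

/-- Read the dimension and the length of the filtration, and multiply all denominators. -/
def headerProg : RamProg :=
  .seq (.write 2 (.const 0) (.read 1 (.const 0)))
  (.seq (.write 3 (.const 0) (.read 1 (.const 1)))
    (ramFold 8 4 (.div (.sub (ramVar 0) (.add (ramVar 3) (.const 3))) (.const 2)) (.const 1)
      (.mul (ramVar 4) (.read 1 (.add (.add (ramVar 3) (.const 4)) (.mul (.const 2) (ramVar 8)))))))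

/-- Compute the Gram determinants of all scaled bases. -/
def detsProg : RamProg :=
  ramFill 7 16 (.add (ramVar 3) (.const 1))
    (.seq (.write 6 (.const 0) (.read 17 (ramVar 7)))
    (.seq (ramFold 8 5 (ramVar 7) (.add (ramVar 3) (.const 3))
      (.add (ramVar 5) (.mul (.mul (.const 2) (ramVar 2)) (.read 17 (ramVar 8)))))
    (.seq gramProg leVerrierProg))) (ramVar 12)

/-- The whole algorithm. -/
def separationProg : RamProg :=
  .seq headerProg
  (.seq (ramFill 7 17 (.add (ramVar 3) (.const 1)) .skip (.read 1 (.add (.const 2) (ramVar 7))))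
  (.seq detsProg greedyProg))

/-- Bounds for the numbers that occur in `separationProg`. -/
structure SeparationBounded (W : ℕ) (w : ℤ → ℤ) (k n N : ℕ) (m : ℕ → ℕ) : Prop where
  input : ∀ i, bitLength (w i) ≤ W
  length : k + 3 + 2 * N ≤ W
  dim : ∀ i ≤ k, 0 < m i → n ≤ W
  den : ∀ q ≤ N, bitLength (denProd w k q) ≤ W
  offset : ∀ i ≤ k, bitLength (basisOffset k n m i : ℕ) ≤ W
  rank : ∀ i ≤ k, m i * m i ≤ W
  gram : ∀ i ≤ k, ∀ j < m i, ∀ l < m i, ∀ q ≤ n, bitLength (∑ c ∈ Finset.range q,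
    scaledEntry w (denProd w k N) (basisOffset k n m i) n j c *
      scaledEntry w (denProd w k N) (basisOffset k n m i) n l c) ≤ W
  leVerrier : ∀ i ≤ k,
    LeVerrierBounded W (scaledGram w (denProd w k N) (basisOffset k n m i) n) (m i)

theorem ramWp_headerProg {W : ℕ} {σ : RamMem} (hσ : RamBounded W σ) {w : ℤ → ℤ} {k n N : ℕ}
    {m : ℕ → ℕ} (hB : SeparationBounded W w k n N m) (h0 : σ 0 0 = (k + 3 + 2 * N : ℕ))
    (h1 : σ 1 = w) (hn : w 0 = n) (hk : w 1 = k) :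
    RamWp W headerProg σ fun τ => RamAgree [2, 3, 4, 8] σ τ ∧ τ 2 0 = n ∧ τ 3 0 = k ∧
      τ 4 0 = denProd w k N := by
  refine ramWp_seq (ramWp_write hσ ?_ fun hb1 => ?_)
  · change bitLength (σ 1 0) ≤ W
    rw [h1]
    exact hB.input _
  set σ1 := σ.set 2 (RamExpr.val σ (.const 0)) (RamExpr.val σ (.read 1 (.const 0)))
  have a1 : RamAgree [2, 3] σ σ1 := (RamAgree.refl _ _).set (by simp) _ _
  have a2 : σ1 2 0 = n := by
    refine (RamMem.set_self _ _ _ _).trans ?_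
    change σ 1 0 = _
    rw [h1, hn]
  refine ramWp_seq (ramWp_write hb1 ?_ fun hb2 => ?_)
  · change bitLength (σ1 1 1) ≤ W
    rw [a1 1 (by decide), h1]
    exact hB.input _
  set σ2 := σ1.set 3 (RamExpr.val σ1 (.const 0)) (RamExpr.val σ1 (.read 1 (.const 1)))
  have b1 : RamAgree [2, 3] σ σ2 := a1.set (by simp) _ _
  have b2 : σ2 2 0 = n := by
    rw [← a2]
    exact congrFun (RamMem.set_of_ne (by decide) _ _) _
  have b3 : σ2 3 0 = k := by
    refine (RamMem.set_self _ _ _ _).trans ?_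
    change σ1 1 1 = _
    rw [a1 1 (by decide), h1, hk]
  clear_value σ2
  have hlen := hB.length
  refine (ramWp_fold (by decide) (by omega : N ≤ W) hb2 (denProd w k) hB.den ?_ ?_ ?_).mono ?_
  · simp [denProd, RamExpr.val]
  · intro τ hτ
    change (τ 0 0 - (τ 3 0 + 3)) / 2 = _
    rw [hτ 0 (by decide), hτ 3 (by decide), b3, b1 0 (by decide), h0]
    push_cast
    omega
  · intro i τ hi hτ h8 h4
    change τ 4 0 * τ 1 (τ 3 0 + 4 + 2 * τ 8 0) = _
    rw [h4, h8, hτ 1 (by decide), hτ 3 (by decide), b3, b1 1 (by decide), h1, denProd, denProd,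
      Finset.prod_range_succ]
    push_cast
    rfl
  · rintro τ - ⟨hτ, h4⟩
    exact ⟨(b1.mono (by simp)).trans (hτ.mono (by simp)), by rw [hτ 2 (by decide), b2],
      by rw [hτ 3 (by decide), b3], h4⟩

theorem ramWp_detsProg {W : ℕ} {σ : RamMem} (hσ : RamBounded W σ) {w : ℤ → ℤ} {k n N : ℕ}
    {m : ℕ → ℕ} (hB : SeparationBounded W w k n N m) (h1 : σ 1 = w) (h2 : σ 2 0 = n)
    (h3 : σ 3 0 = k) (h4 : σ 4 0 = denProd w k N) (h17 : ∀ i ≤ k, σ 17 (i : ℕ) = m i) :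
    RamWp W detsProg σ fun τ =>
      RamAgree [7, 16, 5, 6, 8, 9, 10, 11, 12, 13, 14, 15] σ τ ∧
      ∀ i ≤ k, τ 16 (i : ℕ) = scaledDet w k n N m i := by
  have hlen := hB.length
  refine (ramWp_fill (N := k + 1) (S := [5, 6, 8, 9, 10, 11, 12, 13, 14, 15]) (by decide)
    (by decide) (by decide) (by omega) hσ (scaledDet w k n N m) (fun i hi =>
      (hB.leVerrier i (by omega)).coeff _ le_rfl) ?_ ?_).mono ?_
  · intro τ hτ
    change τ 3 0 + 1 = _
    rw [hτ 3 (by decide), h3]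
    push_cast
    rfl
  · intro i τ hi hτb hτ h7
    have hi' : i ≤ k := by omega
    have hmW := hB.rank i hi'
    have v6 : RamExpr.val τ (.read 17 (ramVar 7)) = m i := by
      change τ 17 (τ 7 0) = _
      rw [h7, hτ 17 (by decide), h17 i hi']
    refine ramWp_seq (ramWp_write hτb ?_ fun hb1 => ?_)
    · rw [v6]
      exact bitLength_natCast_le_of_le ((Nat.le_mul_self _).trans hmW)
    rw [v6] at hb1 ⊢
    set τ1 := τ.set 6 (RamExpr.val τ (.const 0)) (m i)
    have a1 : RamAgree [6] τ τ1 := (RamAgree.refl _ _).set (by simp) _ _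
    have a6 : τ1 6 0 = m i := RamMem.set_self _ _ _ _
    clear_value τ1
    refine ramWp_seq ((ramWp_fold (by decide) (by omega : i ≤ W) hb1
      (fun q => (basisOffset k n m q : ℕ)) (fun q hq => hB.offset q (by omega)) ?_ ?_ ?_).mono ?_)
    · change τ1 3 0 + 3 = _
      rw [a1 3 (by decide), hτ 3 (by decide), h3]
      simp [basisOffset]
    · intro υ hυ
      rw [ramVar_val, hυ 7 (by decide), a1 7 (by decide), h7]
    · intro q υ hq hυ h8 h5
      change υ 5 0 + 2 * υ 2 0 * υ 17 (υ 8 0) = _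
      rw [h5, h8, hυ 2 (by decide), hυ 17 (by decide), a1 2 (by decide), a1 17 (by decide),
        hτ 2 (by decide), hτ 17 (by decide), h2, h17 q (by omega), basisOffset, basisOffset,
        Finset.sum_range_succ]
      push_cast
      ring
    rintro υ - ⟨hυ, h5⟩ hυb
    have a2 : RamAgree [5, 6, 8] τ υ := (a1.mono (by simp)).trans (hυ.mono (by simp))
    refine ramWp_seq ((ramWp_gramProg hυb (by rw [a2 1 (by decide), hτ 1 (by decide), h1])
      (by rw [a2 2 (by decide), hτ 2 (by decide), h2])
      (by rw [a2 4 (by decide), hτ 4 (by decide), h4]) h5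
      (by rw [hυ 6 (by decide), a6]) (hB.dim i hi') hmW (hB.gram i hi')).mono ?_)
    rintro ω - ⟨hω, h13⟩ hωb
    refine (ramWp_leVerrierProg hωb (by omega) hmW (hB.leVerrier i hi')
      (by rw [hω 6 (by decide), hυ 6 (by decide), a6]) h13).mono ?_
    rintro ψ - ⟨hψ, h12⟩
    exact ⟨((a2.mono (by simp)).trans (hω.mono (by simp))).trans (hψ.mono (by simp)), h12⟩
  · rintro τ - ⟨hτ, h16⟩
    exact ⟨hτ, fun i hi => h16 i (by omega)⟩

/-- The program sees ranks and determinants only up to index `k`, whereas the greedy rule is phrased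
with functions on `ℕ`; `g` and `m'` are free beyond `k`, apart from the monotonicity of `m'`. -/
theorem ramWp_separationProg {W : ℕ} {σ : RamMem} (hσ : RamBounded W σ) {w : ℤ → ℤ} {k n N : ℕ}
    {m : ℕ → ℕ} (hB : SeparationBounded W w k n N m) (h0 : σ 0 0 = (k + 3 + 2 * N : ℕ))
    (h1 : σ 1 = w) (hn : w 0 = n) (hk : w 1 = k) (hwm : ∀ i ≤ k, w (2 + i : ℕ) = m i)
    {g : ℕ → ℤ} {m' : ℕ → ℕ} (hg : ∀ i ≤ k, g i = scaledDet w k n N m i)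
    (hmm' : ∀ i ≤ k, m' i = m i) (hm' : Monotone m') {G M : ℕ} (hM : m k ≤ M)
    (hG : ∀ j ≤ k, bitLength (g j) ≤ G) (hW : (M + 1) * (3 * M + 2 * G + 2) ≤ W) :
    RamWp W separationProg σ fun τ =>
      RamOutput τ ((greedyOut (BlockTest g m') k).map fun i : ℕ => (i : ℤ)) := by
  have hlen := hB.length
  refine ramWp_seq ((ramWp_headerProg hσ hB h0 h1 hn hk).mono ?_)
  rintro τ - ⟨hτ, h2, h3, h4⟩ hτb
  refine ramWp_seq ((ramWp_fill (N := k + 1) (S := []) (by decide) (by decide) (by decide)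
    (by omega) hτb (fun i => m i) (fun i hi => ?_) ?_ ?_).mono ?_)
  · exact bitLength_natCast_le_of_le ((Nat.le_mul_self _).trans (hB.rank i (by omega)))
  · intro υ hυ
    change υ 3 0 + 1 = _
    rw [hυ 3 (by decide), h3]
    push_cast
    rfl
  · intro i υ hi hυb hυ h7
    refine ramWp_skip hυb ⟨RamAgree.refl _ _, ?_⟩
    change υ 1 (2 + υ 7 0) = _
    rw [h7, hυ 1 (by decide), hτ 1 (by decide), h1, ← hwm i (by omega)]
    push_cast
    rfl
  rintro υ - ⟨hυ, h17⟩ hυb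
  refine ramWp_seq ((ramWp_detsProg hυb hB (by rw [hυ 1 (by decide), hτ 1 (by decide), h1])
    (by rw [hυ 2 (by decide), h2]) (by rw [hυ 3 (by decide), h3])
    (by rw [hυ 4 (by decide), h4]) (fun i hi => h17 i (by omega))).mono ?_)
  rintro ω - ⟨hω, h16⟩ hωb
  refine ramWp_greedyProg hωb hm' ((hmm' k le_rfl).trans_le hM) hG hW (by omega)
    (by rw [hω 3 (by decide), hυ 3 (by decide), h3]) (fun j hj => by rw [h16 j hj, hg j hj])
    (fun j hj => by rw [hω 17 (by decide), h17 j (by omega), hmm' j hj])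

end DetsProg

/-! ### Positions of the data in the input, and the scaling to integers. -/

section Encoding

theorem getElem?_flatMap_finRange {β : Type*} {r : ℕ} (f : Fin r → List β) (G : ℕ → ℕ)
    (hG : ∀ i, (f i).length = G i) (i : Fin r) {j : ℕ} (hj : j < G i) :
    ((List.finRange r).flatMap f)[∑ q ∈ Finset.range i, G q + j]? = (f i)[j]? := by
  induction r generalizing G with
  | zero => exact i.elim0
  | succ r ih =>
    rw [List.finRange_succ, List.flatMap_cons, List.flatMap_map]
    refine Fin.cases (fun hj => ?_) (fun i hj => ?_) i hj
    · rw [← hG] at hj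
      simp [List.getElem?_append_left hj]
    · have h0 : (f 0).length = G 0 := hG 0
      rw [Fin.val_succ, Finset.sum_range_succ', List.getElem?_append_right (by omega)]
      rw [← ih (fun i => f i.succ) (fun q => G (q + 1)) (fun i => hG i.succ) i hj]
      congr 1
      omega

theorem length_flatMap_finRange {β : Type*} {r : ℕ} (f : Fin r → List β) (G : ℕ → ℕ)
    (hG : ∀ i, (f i).length = G i) :
    ((List.finRange r).flatMap f).length = ∑ q ∈ Finset.range r, G q := by
  rw [List.length_flatMap, Finset.sum_range, ← List.sum_ofFn, List.ofFn_eq_map]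
  simp_rw [hG]

/-- All coordinates of the basis vectors. -/
def basesEntries (n k : ℕ) (m : Fin (k + 1) → ℕ) (B : ∀ i, Fin (m i) → Fin n → ℚ) : List ℚ :=
  (List.finRange (k + 1)).flatMap fun i =>
    (List.finRange (m i)).flatMap fun j => (List.finRange n).map (B i j)

/-- The concatenation of the numerators and denominators. -/
def encodeRats (l : List ℚ) : List ℤ := l.flatMap fun q => [q.num, (q.den : ℤ)]

theorem length_encodeRats (l : List ℚ) : (encodeRats l).length = 2 * l.length := by
  simp [encodeRats, List.length_flatMap, mul_comm]

theorem getElem?_encodeRats (l : List ℚ) (p : ℕ) :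
    (encodeRats l)[2 * p]? = l[p]?.map Rat.num ∧
      (encodeRats l)[2 * p + 1]? = l[p]?.map fun q => (q.den : ℤ) := by
  induction l generalizing p with
  | nil => simp [encodeRats]
  | cons q l ih =>
    cases p with
    | zero => simp [encodeRats]
    | succ p =>
      have := ih p
      simp only [encodeRats, List.flatMap_cons, List.cons_append, List.nil_append, mul_add, mul_one,
        List.getElem?_cons_succ] at this ⊢
      exact this

/-- After flattening, the `p`-th coordinate of the whole input starts at `k + 3 + 2 * p`, whichever
basis it belongs to. -/
theorem encodeBases_eq (n k : ℕ) (m : Fin (k + 1) → ℕ) (B : ∀ i, Fin (m i) → Fin n → ℚ) :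
    encodeBases n k m B = ([(n : ℤ), (k : ℤ)] ++ (List.finRange (k + 1)).map fun i => (m i : ℤ)) ++
      encodeRats (basesEntries n k m B) := by
  simp only [encodeBases, encodeRats, basesEntries, List.flatMap_assoc, List.flatMap_map]

/-- The extension of a function on `Fin (k + 1)` to `ℕ` that is constant beyond `k`. -/
def extendConst {k : ℕ} {α : Type*} (m : Fin (k + 1) → α) (i : ℕ) : α :=
  m ⟨min i k, by omega⟩

theorem extendConst_val {k : ℕ} {α : Type*} (m : Fin (k + 1) → α) (i : Fin (k + 1)) :
    extendConst m i = m i := by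
  simp only [extendConst]
  congr
  have := i.2
  omega

/-- The number of all coordinates of the basis vectors. -/
def numEntries (n k : ℕ) (m : Fin (k + 1) → ℕ) : ℕ :=
  ∑ i ∈ Finset.range (k + 1), extendConst m i * n

variable {n k : ℕ} {m : Fin (k + 1) → ℕ} {B : ∀ i, Fin (m i) → Fin n → ℚ}

theorem length_basesEntries : (basesEntries n k m B).length = numEntries n k m := by
  refine length_flatMap_finRange _ _ fun i => ?_
  rw [length_flatMap_finRange _ (fun _ => n) fun j => by simp, extendConst_val]
  simp

theorem getElem?_basesEntries (i : Fin (k + 1)) (j : Fin (m i)) (c : Fin n) :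
    (basesEntries n k m B)[∑ q ∈ Finset.range i, extendConst m q * n + (j * n + c)]? =
      some (B i j c) := by
  have hj : (j : ℕ) * n + c < extendConst m i * n := by
    rw [extendConst_val]
    have h1 := Nat.mul_le_mul_right n j.2
    have h2 := c.2
    rw [Nat.succ_mul] at h1
    omega
  have h1 : ∀ i : Fin (k + 1), ((List.finRange (m i)).flatMap fun j =>
      (List.finRange n).map (B i j)).length = extendConst m i * n := by
    intro i
    rw [length_flatMap_finRange _ (fun _ => n) fun j => by simp, extendConst_val]
    simp
  rw [basesEntries, getElem?_flatMap_finRange _ _ h1 i hj]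
  have h2 := getElem?_flatMap_finRange (fun j => (List.finRange n).map (B i j)) (fun _ => n)
    (fun j => by simp) j (j := (c : ℕ)) c.2
  simp only [Finset.sum_const, Finset.card_range, smul_eq_mul] at h2
  rw [h2]
  simp

/-- The contents of the input array. -/
def inputArray (n k : ℕ) (m : Fin (k + 1) → ℕ) (B : ∀ i, Fin (m i) → Fin n → ℚ) : ℤ → ℤ :=
  ramInput (encodeBases n k m B) 1

theorem inputArray_natCast (i : ℕ) : inputArray n k m B i = (encodeBases n k m B).getD i 0 := by
  simp [inputArray, ramInput]

theorem inputArray_dim : inputArray n k m B 0 = n := by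
  have := inputArray_natCast (B := B) 0
  simpa [encodeBases] using this

theorem inputArray_length : inputArray n k m B 1 = k := by
  have := inputArray_natCast (B := B) 1
  simpa [encodeBases] using this

theorem inputArray_rank {i : ℕ} (hi : i ≤ k) :
    inputArray n k m B (2 + i : ℕ) = extendConst m i := by
  have h := extendConst_val m ⟨i, by omega⟩
  simp only at h
  rw [inputArray_natCast, h, encodeBases_eq, List.getD_eq_getElem?_getD, List.append_assoc,
    List.getElem?_append_right (by simp), List.getElem?_append_left (by simp; omega)]
  simp [show i < k + 1 by omega]

theorem length_encodeBases : (encodeBases n k m B).length = k + 3 + 2 * numEntries n k m := by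
  rw [encodeBases_eq, List.length_append, length_encodeRats, length_basesEntries]
  simp

theorem inputArray_num {p : ℕ} {q : ℚ} (h : (basesEntries n k m B)[p]? = some q) :
    inputArray n k m B (k + 3 + 2 * p : ℕ) = q.num := by
  rw [inputArray_natCast, encodeBases_eq, List.getD_eq_getElem?_getD,
    List.getElem?_append_right (by simp)]
  have h1 : k + 3 + 2 * p - ([(n : ℤ), (k : ℤ)] ++
      (List.finRange (k + 1)).map fun i => (m i : ℤ)).length = 2 * p := by
    simp
  rw [h1, (getElem?_encodeRats _ _).1, h]
  rfl

theorem inputArray_den {p : ℕ} {q : ℚ} (h : (basesEntries n k m B)[p]? = some q) :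
    inputArray n k m B (k + 4 + 2 * p : ℕ) = q.den := by
  rw [inputArray_natCast, encodeBases_eq, List.getD_eq_getElem?_getD,
    List.getElem?_append_right (by simp; omega)]
  have h1 : k + 4 + 2 * p - ([(n : ℤ), (k : ℤ)] ++
      (List.finRange (k + 1)).map fun i => (m i : ℤ)).length = 2 * p + 1 := by
    simp
    omega
  rw [h1, (getElem?_encodeRats _ _).2, h]
  rfl

theorem basisOffset_eq (i : ℕ) : basisOffset k n (extendConst m) i =
    k + 3 + 2 * ∑ q ∈ Finset.range i, extendConst m q * n := by
  rw [basisOffset, Finset.mul_sum]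
  congr 1
  exact Finset.sum_congr rfl fun q _ => by ring

/-- The product of all denominators. -/
def commonDen (n k : ℕ) (m : Fin (k + 1) → ℕ) (B : ∀ i, Fin (m i) → Fin n → ℚ) : ℤ :=
  denProd (inputArray n k m B) k (numEntries n k m)

theorem commonDen_pos : 0 < commonDen n k m B := by
  rw [commonDen, denProd]
  refine Finset.prod_pos fun p hp => ?_
  rw [Finset.mem_range, ← length_basesEntries (B := B)] at hp
  rw [inputArray_den (List.getElem?_eq_getElem hp)]
  exact_mod_cast Rat.den_pos _

/-- Each denominator is a factor of the common one, so the integer division is exact. -/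
theorem scaledEntry_eq (i : Fin (k + 1)) (j : Fin (m i)) (c : Fin n) :
    (scaledEntry (inputArray n k m B) (commonDen n k m B) (basisOffset k n (extendConst m) i) n j c
      : ℚ) = commonDen n k m B * B i j c := by
  have h := getElem?_basesEntries (B := B) i j c
  have h1 := inputArray_num h
  have h2 := inputArray_den h
  set p := ∑ q ∈ Finset.range (i : ℕ), extendConst m q * n + (j * n + c)
  have hp : p < numEntries n k m := by
    rw [← length_basesEntries (B := B)]
    exact (List.getElem?_eq_some_iff.1 h).1
  have h3 : ((B i j c).den : ℤ) ∣ commonDen n k m B := by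
    rw [← h2]
    exact Finset.dvd_prod_of_mem (fun p : ℕ => inputArray n k m B (k + 4 + 2 * p : ℕ))
      (Finset.mem_range.2 hp)
  have e1 : basisOffset k n (extendConst m) i + 2 * (j * n + c) = k + 3 + 2 * p := by
    rw [basisOffset_eq]
    ring
  have e2 : k + 3 + 2 * p + 1 = k + 4 + 2 * p := by ring
  rw [scaledEntry, e1, e2, h1, h2]
  obtain ⟨z, hz⟩ := h3
  have hd : ((B i j c).den : ℤ) ≠ 0 := by exact_mod_cast (B i j c).den_nz
  have hd' : ((B i j c).den : ℚ) ≠ 0 := by exact_mod_cast (B i j c).den_nz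
  rw [hz, Int.mul_ediv_cancel_left _ hd]
  nth_rewrite 3 [← Rat.num_div_den (B i j c)]
  push_cast
  field_simp

end Encoding

/-! ### Polynomial bounds in the encoding length. -/

section EncodingBounds

theorem two_mul_length_le_encodingLength (l : List ℤ) : 2 * l.length ≤ encodingLength l := by
  induction l with
  | nil => simp
  | cons z l ih =>
    simp only [encodingLength, List.map_cons, List.sum_cons, List.length_cons] at ih ⊢
    omega

theorem bitLength_le_encodingLength {l : List ℤ} {z : ℤ} (hz : z ∈ l) :
    bitLength z ≤ encodingLength l := by
  have := List.single_le_sum (fun x _ => Nat.zero_le x) _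
    (List.mem_map_of_mem (f := fun z => bitLength z + 2) hz)
  exact (Nat.le_add_right _ _).trans this

theorem bitLength_getD_le (l : List ℤ) (i : ℕ) : bitLength (l.getD i 0) ≤ encodingLength l := by
  by_cases hi : i < l.length
  · rw [List.getD_eq_getElem _ _ hi]
    exact bitLength_le_encodingLength (List.getElem_mem hi)
  · rw [List.getD_eq_default _ _ (not_lt.1 hi)]
    exact Nat.zero_le _

/-- A bound for the bit lengths of the coefficients in the Faddeev–LeVerrier algorithm, for inputs
of length `S`. -/
def detBound (S : ℕ) : ℕ := (2 * S ^ 2 + 5 * S + 2) * (2 * S + 1) + 1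

/-- A bound for all numbers and loops in the algorithm, for inputs of length `S`. -/
def separationBound (S : ℕ) : ℕ := (S + 1) * (3 * S + 2 * detBound S + 2)

theorem exists_polynomial_separationBound :
    ∃ p : Polynomial ℕ, ∀ S, separationBound S = p.eval S := by
  refine ⟨(Polynomial.X + 1) * (3 * Polynomial.X + 2 * ((2 * Polynomial.X ^ 2 + 5 * Polynomial.X + 2)
    * (2 * Polynomial.X + 1) + 1) + 2), fun S => ?_⟩
  simp [separationBound, detBound]

theorem detBound_le_separationBound (S : ℕ) : detBound S ≤ separationBound S := by
  rw [separationBound]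
  nlinarith [Nat.zero_le (S * detBound S)]

theorem le_detBound (S : ℕ) : 2 * S ^ 2 + 5 * S + 3 ≤ detBound S := by
  rw [detBound]
  nlinarith [Nat.zero_le (S ^ 3), Nat.zero_le (S ^ 2)]

theorem bitLength_prod_range_le {f : ℕ → ℤ} {S : ℕ} (hf : ∀ p, bitLength (f p) ≤ S) (q : ℕ) :
    bitLength (∏ p ∈ Finset.range q, f p) ≤ 1 + q * S := by
  induction q with
  | zero => simp [show bitLength 1 = 1 by decide]
  | succ q ih =>
    rw [Finset.prod_range_succ, add_one_mul]
    have := bitLength_mul_le (∏ p ∈ Finset.range q, f p) (f q)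
    have := hf q
    omega

variable {n k : ℕ} {m : Fin (k + 1) → ℕ} {B : ∀ i, Fin (m i) → Fin n → ℚ}

theorem bitLength_inputArray_le (i : ℤ) :
    bitLength (inputArray n k m B i) ≤ encodingLength (encodeBases n k m B) := by
  simp only [inputArray, ramInput, one_ne_zero, false_and, if_false, true_and]
  split_ifs
  · exact bitLength_getD_le _ _
  · exact Nat.zero_le _

theorem length_le_encodingLength :
    2 * (k + 3 + 2 * numEntries n k m) ≤ encodingLength (encodeBases n k m B) := by
  rw [← length_encodeBases (B := B)]
  exact two_mul_length_le_encodingLength _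

theorem ramBounded_ramInput :
    RamBounded (encodingLength (encodeBases n k m B)) (ramInput (encodeBases n k m B)) := by
  intro a i
  simp only [ramInput]
  split_ifs
  · refine bitLength_natCast_le_of_le ?_
    have := two_mul_length_le_encodingLength (encodeBases n k m B)
    omega
  · exact bitLength_getD_le _ _
  · exact Nat.zero_le _

theorem extendConst_mul_le_numEntries {i : ℕ} (hi : i ≤ k) :
    extendConst m i * n ≤ numEntries n k m :=
  Finset.single_le_sum (f := fun i => extendConst m i * n) (fun _ _ => Nat.zero_le _)
    (Finset.mem_range.2 (by omega))

/-- Ranks and dimension are encoded in binary, but each product `m i * n` is at most the number of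
encoded coordinates. As `n > 0` whenever a vector is present, this bounds the ranks, and `n` too if
some rank is positive. -/
theorem separationBounded (hmn : ∀ i, 0 < m i → 0 < n) :
    SeparationBounded (separationBound (encodingLength (encodeBases n k m B)))
        (inputArray n k m B) k n (numEntries n k m) (extendConst m) ∧
      (∀ i ≤ k, extendConst m i ≤ encodingLength (encodeBases n k m B)) ∧
      ∀ i ≤ k, bitLength (scaledDet (inputArray n k m B) k n (numEntries n k m) (extendConst m) i) ≤
        detBound (encodingLength (encodeBases n k m B)) := by
  have hS := length_le_encodingLength (B := B)
  have hw := bitLength_inputArray_le (B := B)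
  set S := encodingLength (encodeBases n k m B)
  set N := numEntries n k m
  have hW := detBound_le_separationBound S
  have hW' := le_detBound S
  have hm : ∀ i ≤ k, extendConst m i ≤ S := by
    intro i hi
    rcases Nat.eq_zero_or_pos (extendConst m i) with h | h
    · omega
    · have h1 := extendConst_mul_le_numEntries (m := m) (n := n) hi
      have h2 := Nat.le_mul_of_pos_right (extendConst m i) (hmn _ h)
      omega
  have hn : ∀ i ≤ k, 0 < extendConst m i → n ≤ S := by
    intro i hi h
    have h1 := extendConst_mul_le_numEntries (m := m) (n := n) hi
    have h2 := Nat.le_mul_of_pos_left n h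
    omega
  have hden : ∀ q ≤ N, bitLength (denProd (inputArray n k m B) k q) ≤ 1 + S ^ 2 := by
    intro q hq
    refine (bitLength_prod_range_le (fun p => hw _) q).trans ?_
    have := Nat.mul_le_mul_right S (show q ≤ S by omega)
    rw [sq]
    omega
  have hentry : ∀ o j c, |scaledEntry (inputArray n k m B) (denProd (inputArray n k m B) k N) o n j
      c| ≤ 2 ^ (S ^ 2 + S + 1) := by
    intro o j c
    refine (bitLength_le_iff_abs.1 ?_).le
    refine (bitLength_mul_le _ _).trans ?_
    have h1 := bitLength_div_le (denProd (inputArray n k m B) k N)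
      (inputArray n k m B (o + 2 * (j * n + c) + 1 : ℕ))
    have h2 := hden N le_rfl
    have h3 := hw (o + 2 * (j * n + c) : ℕ)
    omega
  -- At most `S ≤ 2 ^ S` products of two scaled entries, each entry at most `2 ^ (S² + S + 1)`.
  have hgram : ∀ o j l, n ≤ S → ∀ q ≤ n, |∑ c ∈ Finset.range q,
      scaledEntry (inputArray n k m B) (denProd (inputArray n k m B) k N) o n j c *
      scaledEntry (inputArray n k m B) (denProd (inputArray n k m B) k N) o n l c| ≤
      2 ^ (2 * S ^ 2 + 3 * S + 2) := by
    intro o j l hnS q hq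
    refine (abs_sum_range_le (B := 2 ^ (2 * (S ^ 2 + S + 1))) (by positivity) hq
      fun c hc => ?_).trans ?_
    · rw [abs_mul, two_mul, pow_add]
      exact mul_le_mul (hentry _ _ _) (hentry _ _ _) (abs_nonneg _) (by positivity)
    · rw [show 2 * S ^ 2 + 3 * S + 2 = S + 2 * (S ^ 2 + S + 1) by ring, pow_add _ S]
      refine mul_le_mul_of_nonneg_right ?_ (by positivity)
      exact_mod_cast hnS.trans Nat.lt_two_pow_self.le
  have hlv : ∀ i ≤ k, LeVerrierBounded (detBound S) (scaledGram (inputArray n k m B)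
      (denProd (inputArray n k m B) k N) (basisOffset k n (extendConst m) i) n)
      (extendConst m i) := by
    intro i hi
    have hd := hm i hi
    refine leVerrierBounded_of_abs_le (X := 2 ^ (2 * S ^ 2 + 3 * S + 2))
      (one_le_pow₀ (by norm_num)) (fun j hj l hl => hgram _ _ _ (hn i hi (by omega)) n le_rfl) ?_
    set d := extendConst m i
    have h1 : ((d + 1) * (d + 1) : ℕ) ≤ 2 ^ (2 * S) := by
      have : d + 1 ≤ 2 ^ S := (Nat.succ_le_succ hd).trans Nat.lt_two_pow_self
      rw [two_mul, pow_add]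
      exact Nat.mul_le_mul this this
    have h2 : (((d + 1) * (d + 1) : ℕ) * 2 ^ (2 * S ^ 2 + 3 * S + 2) : ℤ) ≤
        2 ^ (2 * S ^ 2 + 5 * S + 2) := by
      rw [show 2 * S ^ 2 + 5 * S + 2 = 2 * S + (2 * S ^ 2 + 3 * S + 2) by ring, pow_add _ (2 * S)]
      exact mul_le_mul_of_nonneg_right (by exact_mod_cast h1) (by positivity)
    refine (pow_le_pow_left₀ (by positivity) h2 _).trans_lt ?_
    rw [← pow_mul]
    refine pow_lt_pow_right₀ (by norm_num) (Nat.lt_succ_of_le ?_)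
    exact Nat.mul_le_mul_left _ (by omega)
  refine ⟨⟨fun i => (hw i).trans (by omega), by omega, fun i hi h => (hn i hi h).trans (by omega),
    fun q hq => (hden q hq).trans (by omega), fun i hi => ?_, fun i hi => ?_,
    fun i hi j hj l hl q hq => ?_, fun i hi => ?_⟩, hm, fun i hi => (hlv i hi).coeff _ le_rfl⟩
  · refine bitLength_natCast_le_of_le ?_
    rw [basisOffset_eq]
    have : ∑ q ∈ Finset.range i, extendConst m q * n ≤ N :=
      Finset.sum_le_sum_of_subset (Finset.range_mono (by omega))
    omega
  · have := Nat.mul_le_mul (hm i hi) (hm i hi)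
    rw [← sq S] at this
    omega
  · refine bitLength_le_iff_abs.2 ((hgram _ _ _ (hn i hi (by omega)) q hq).trans_lt ?_)
    exact pow_lt_pow_right₀ (by norm_num) (by omega)
  · exact ⟨fun s hs i hi j hj => ((hlv _ ‹_›).matrix s hs i hi j hj).trans hW,
      fun s hs => ((hlv _ hi).coeff s hs).trans hW,
      fun s hs i hi j hj q hq => ((hlv _ ‹_›).product s hs i hi j hj q hq).trans hW,
      fun s hs q hq => ((hlv _ hi).trace s hs q hq).trans hW⟩

end EncodingBounds

/-! ### Integer Gram determinants and normalized determinants of rational lattices. -/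

section RatLattice

variable {n : ℕ}

/-- A vector with rational coordinates. -/
def ratVec (b : Fin n → ℚ) : EuclideanSpace ℝ (Fin n) := WithLp.toLp 2 fun c => ((b c : ℚ) : ℝ)

theorem linearIndependent_ratVec {m : ℕ} {b : Fin m → Fin n → ℚ} (hb : LinearIndependent ℚ b) :
    LinearIndependent ℝ fun j => ratVec (b j) := by
  have h := (linearIndependent_algebraMap_comp_iff (R := ℚ) (S := ℝ) (v := b)).2 hb
  have h2 := h.map' (WithLp.linearEquiv 2 ℝ (Fin n → ℝ)).symm.toLinearMap (LinearEquiv.ker _)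
  exact h2

theorem isLattice_ratLattice {m : ℕ} {b : Fin m → Fin n → ℚ} (hb : LinearIndependent ℚ b) :
    IsLattice (ratLattice b) := isLattice_of_span_eq (linearIndependent_ratVec hb) rfl

theorem latticeRank_ratLattice {m : ℕ} {b : Fin m → Fin n → ℚ} (hb : LinearIndependent ℚ b) :
    latticeRank (ratLattice b) = m := by
  rw [latticeRank_eq_of_span_eq (L := ratLattice b) (linearIndependent_ratVec hb) rfl,
    Fintype.card_fin]

variable {k : ℕ} {m : Fin (k + 1) → ℕ} {B : ∀ i, Fin (m i) → Fin n → ℚ}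

theorem scaledDet_eq (hB : ∀ i, LinearIndependent ℚ (B i)) (i : Fin (k + 1)) :
    (scaledDet (inputArray n k m B) k n (numEntries n k m) (extendConst m) i : ℝ) =
      ((commonDen n k m B : ℝ) ^ m i * latticeDet (ratLattice (B i))) ^ 2 := by
  have hg : ∀ j l : Fin (m i), (scaledGram (inputArray n k m B) (commonDen n k m B)
      (basisOffset k n (extendConst m) i) n j l : ℝ) =
      Matrix.gram ℝ (fun j => (commonDen n k m B : ℝ) • ratVec (B i j)) j l := by
    intro j l
    rw [Matrix.gram_apply, PiLp.inner_apply, scaledGram, Finset.sum_range]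
    push_cast
    refine Finset.sum_congr rfl fun c _ => ?_
    have e : ∀ j : Fin (m i), (scaledEntry (inputArray n k m B) (commonDen n k m B)
        (basisOffset k n (extendConst m) i) n j c : ℝ) =
        commonDen n k m B * (B i j c : ℝ) := fun j => by
      exact_mod_cast congrArg (Rat.cast : ℚ → ℝ) (scaledEntry_eq i j c)
    rw [e, e]
    simp [ratVec]
    ring
  rw [scaledDet, leVerrier_det (scaledGram_comm _ _ _ _), extendConst_val, mul_pow, ← pow_mul,
    mul_comm (m i), pow_mul, latticeDet_sq_of_span_eq (L := ratLattice (B i)) (linearIndependent_ratVec (hB i)) rfl]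
  have h := det_gram_smul (fun j => ratVec (B i j)) (commonDen n k m B : ℝ)
  rw [Fintype.card_fin] at h
  rw [← h]
  refine ((Int.castRingHom ℝ).map_det _).trans ?_
  congr 1
  ext j l
  exact hg j l

theorem scaledDet_pos (hB : ∀ i, LinearIndependent ℚ (B i)) {i : ℕ} (hi : i ≤ k) :
    0 < scaledDet (inputArray n k m B) k n (numEntries n k m) (extendConst m) i := by
  have h := scaledDet_eq hB ⟨i, by omega⟩
  have h1 := (isLattice_ratLattice (hB ⟨i, by omega⟩)).det_pos
  have h2 : (0 : ℝ) < commonDen n k m B := by exact_mod_cast commonDen_pos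
  have h3 : (0 : ℝ) < scaledDet (inputArray n k m B) k n (numEntries n k m) (extendConst m) i := by
    rw [h]
    positivity
  exact_mod_cast h3

/-- The rank difference is the rank of the quotient, whose determinant is that power of its
normalized determinant. Thus the irrational number enters only through a ratio of integers. -/
theorem scaledDet_succ (hB : ∀ i, LinearIndependent ℚ (B i))
    (hp : ∀ i : Fin k, IsPrimitive (ratLattice (B i.castSucc)) (ratLattice (B i.succ)))
    (i : Fin k) : m i.castSucc ≤ m i.succ ∧
    (scaledDet (inputArray n k m B) k n (numEntries n k m) (extendConst m) (i + 1 : ℕ) : ℝ) =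
      scaledDet (inputArray n k m B) k n (numEntries n k m) (extendConst m) i *
        ((commonDen n k m B) * quotNormDet (fun i => ratLattice (B i)) i) ^
          (2 * (m i.succ - m i.castSucc)) := by
  obtain ⟨h1, h2⟩ := (hp i).rank_eq_and_det_eq (isLattice_ratLattice (hB i.succ))
  rw [latticeRank_ratLattice (hB _), latticeRank_ratLattice (hB _)] at h1
  have h3 := ((hp i).isLattice_quotLattice (isLattice_ratLattice (hB i.succ))).normDet_pow_rank
  refine ⟨by omega, ?_⟩
  have h4 := scaledDet_eq hB i.succ
  have h5 := scaledDet_eq hB i.castSucc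
  rw [Fin.val_succ] at h4
  rw [Fin.val_castSucc] at h5
  have h6 : m i.succ - m i.castSucc =
      latticeRank (quotLattice (ratLattice (B i.succ)) (ratLattice (B i.castSucc))) := by omega
  have h7 := congrArg (fun d => (commonDen n k m B : ℝ) ^ d) h1
  simp only [pow_add] at h7
  rw [h4, h5, h2, ← h3, h6, h7, quotNormDet]
  ring

/-- The integer test decides whether a new block starts. -/
theorem blockTest_iff_of_pow {g : ℕ → ℤ} {m : ℕ → ℕ} {a i : ℕ} {D ra ri : ℝ} (hD : 0 < D)
    (hra : 0 < ra) (hri : 0 < ri) (hga : 0 < g a) (hgi : 0 < g i) (hma : m a < m (a + 1))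
    (hmi : m i < m (i + 1))
    (ha : (g (a + 1) : ℝ) = g a * (D * ra) ^ (2 * (m (a + 1) - m a)))
    (hi : (g (i + 1) : ℝ) = g i * (D * ri) ^ (2 * (m (i + 1) - m i))) :
    BlockTest g m a i ↔ 2 * ra < ri := by
  rw [BlockTest, ← Int.cast_lt (R := ℝ)]
  push_cast
  rw [ha, hi]
  have hga' : (0 : ℝ) < g a := by exact_mod_cast hga
  have hgi' : (0 : ℝ) < g i := by exact_mod_cast hgi
  obtain ⟨da, hda⟩ : ∃ d, d = m (a + 1) - m a := ⟨_, rfl⟩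
  obtain ⟨di, hdi⟩ : ∃ d, d = m (i + 1) - m i := ⟨_, rfl⟩
  rw [← hda, ← hdi]
  -- This common factor cancels, leaving `(2 * ra) ^ (2 * di * da) < ri ^ (2 * di * da)`.
  have hc : (0 : ℝ) < (g a : ℝ) ^ di * (g i : ℝ) ^ da * D ^ (2 * di * da) := by positivity
  have e1 : ((g a : ℝ) * (D * ra) ^ (2 * da)) ^ di * (4 ^ di * g i) ^ da =
      ((g a : ℝ) ^ di * (g i : ℝ) ^ da * D ^ (2 * di * da)) * (2 * ra) ^ (2 * di * da) := by
    rw [show (4 : ℝ) = 2 ^ 2 by norm_num, mul_pow 2 ra, ← pow_mul 2 2]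
    ring
  have e2 : (g a : ℝ) ^ di * (g i * (D * ri) ^ (2 * di)) ^ da =
      ((g a : ℝ) ^ di * (g i : ℝ) ^ da * D ^ (2 * di * da)) * ri ^ (2 * di * da) := by
    ring
  rw [e1, e2, mul_lt_mul_iff_right₀ hc]
  refine pow_lt_pow_iff_left₀ (by positivity) hri.le ?_
  have : 0 < da := by omega
  have : 0 < di := by omega
  positivity

end RatLattice

/-! ### Correctness and running time of the algorithm. -/

section Algorithm

theorem exists_separation_algorithm : ∃ (P : RamProg) (p : Polynomial ℕ),
    ∀ (n k : ℕ) (m : Fin (k + 1) → ℕ) (B : ∀ i, Fin (m i) → Fin n → ℚ) (t : ℝ),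
    1 ≤ t → (∀ i, LinearIndependent ℚ (B i)) →
    IsStableFiltration t (ratLattice (B (Fin.last k))) (fun i => ratLattice (B i)) →
    ∃ (k' : ℕ) (l : Fin (k' + 1) → Fin (k + 1)),
      l 0 = 0 ∧ l (Fin.last k') = Fin.last k ∧ StrictMono l ∧
      IsWellSeparatedFiltration (2 * t) (ratLattice (B (Fin.last k)))
        ((fun i => ratLattice (B i)) ∘ l) ∧
      ∃ (c : ℕ) (σ : RamMem),
        RamExec P (ramInput (encodeBases n k m B)) c σ ∧
        RamOutput σ (List.ofFn fun j => ((l j : ℕ) : ℤ)) ∧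
        c ≤ p.eval (encodingLength (encodeBases n k m B)) := by
  obtain ⟨p, hp⟩ := separationProg.exists_polynomial_costBound
  obtain ⟨q, hq⟩ := exists_polynomial_separationBound
  refine ⟨separationProg, p.comp q, fun n k m B t ht hB hF => ?_⟩
  have hL := isLattice_ratLattice (hB (Fin.last k))
  -- In dimension zero every vector vanishes, so an independent family is empty.
  have hmn : ∀ i, 0 < m i → 0 < n := by
    intro i hi
    by_contra hn
    obtain rfl : n = 0 := by omega
    exact (hB i).ne_zero ⟨0, hi⟩ (Subsingleton.elim _ _)
  obtain ⟨hbd, hmS, hgS⟩ := separationBounded (B := B) hmn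
  have hpos := fun i (hi : i ≤ k) => scaledDet_pos hB hi
  have hsucc := scaledDet_succ hB hF.primitive
  have hw0 : ramInput (encodeBases n k m B) 0 0 = (k + 3 + 2 * numEntries n k m : ℕ) := by
    simp [ramInput, length_encodeBases]
  set S := encodingLength (encodeBases n k m B)
  -- Constant continuation beyond `k` keeps `g` positive everywhere, as irreflexivity of the test is
  -- needed for all natural numbers.
  obtain ⟨g, hg⟩ : ∃ g : ℕ → ℤ, g = fun i =>
    scaledDet (inputArray n k m B) k n (numEntries n k m) (extendConst m) (min i k) := ⟨_, rfl⟩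
  have hgk : ∀ i ≤ k, g i =
      scaledDet (inputArray n k m B) k n (numEntries n k m) (extendConst m) i := by
    intro i hi
    rw [hg]
    simp only [min_eq_left hi]
  have hgpos : ∀ i, 0 < g i := fun i => by
    rw [hg]
    exact hpos _ (min_le_right _ _)
  have hmmono : Monotone m := Fin.monotone_iff_le_succ.2 fun i => (hsucc i).1
  have hm' : Monotone (extendConst m) := fun i j hij => hmmono (Fin.mk_le_mk.2 (by omega))
  have hmlt : ∀ i : Fin k, m i.castSucc < m i.succ := by
    intro i
    have h1 := ((hF.primitive i).rank_eq_and_det_eq (isLattice_ratLattice (hB i.succ))).1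
    have h2 := ((hF.primitive i).isLattice_quotLattice (isLattice_ratLattice (hB i.succ))).rank_pos
      (quotLattice_ne_bot (hF.primitive i) (hF.strictMono i.castSucc_lt_succ).ne)
    rw [latticeRank_ratLattice (hB _), latticeRank_ratLattice (hB _)] at h1
    omega
  have hD : (0 : ℝ) < commonDen n k m B := by exact_mod_cast commonDen_pos
  have hm1 : ∀ i : Fin k, extendConst m i = m i.castSucc := fun i => extendConst_val m i.castSucc
  have hm2 : ∀ i : Fin k, extendConst m (i + 1) = m i.succ := fun i => extendConst_val m i.succ
  have hstep : ∀ i : Fin k, (g (i + 1) : ℝ) = g i *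
      (commonDen n k m B * quotNormDet (fun i => ratLattice (B i)) i) ^
        (2 * (extendConst m (i + 1) - extendConst m i)) := by
    intro i
    rw [hgk _ i.2, hgk _ i.2.le, hm1, hm2]
    exact (hsucc i).2
  obtain ⟨k', l, hl, hout⟩ := exists_isGreedyCut (k := k)
    (r := quotNormDet fun i => ratLattice (B i)) (not_blockTest_self hgpos) fun a i =>
      blockTest_iff_of_pow (m := extendConst m) hD (hF.quotNormDet_pos hL a)
        (hF.quotNormDet_pos hL i) (hgpos _) (hgpos _)
        (by rw [hm1, hm2]; exact hmlt a) (by rw [hm1, hm2]; exact hmlt i) (hstep a) (hstep i)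
  refine ⟨k', l, hl.zero, hl.last, hl.strictMono,
    hl.isWellSeparatedFiltration ht hL hF, ?_⟩
  have hSW : S ≤ separationBound S := by
    have := detBound_le_separationBound S
    have := le_detBound S
    omega
  obtain ⟨τ, c, h1, h2, -, h3⟩ := ramWp_separationProg
    (fun a i => (ramBounded_ramInput (B := B) a i).trans hSW) hbd hw0 rfl inputArray_dim
    inputArray_length (fun i hi => inputArray_rank hi) hgk (fun _ _ => rfl) hm' (hmS k le_rfl)
    (fun j hj => by rw [hgk j hj]; exact hgS j hj) le_rfl
  refine ⟨c, τ, h1, ?_, ?_⟩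
  · rw [← hout, List.map_ofFn] at h3
    exact h3
  · rw [Polynomial.eval_comp, ← hq, ← hp]
    exact h2

end Algorithm
/-- (1) Every `t`-stable filtration of a lattice has a subsequence `F ∘ l`, containing the first and
the last member, that is a well-separated `2t`-stable filtration. (2) One algorithm finds the
indices `l 0 < ⋯ < l k'` of such a subsequence in polynomial time, for filtrations of rational
lattices that are given by bases of the members. (3) Every lattice has a well-separated `2`-stable
filtration. -/
theorem theorem2p3 :
    (∀ (n k : ℕ) (t : ℝ) (L : Submodule ℤ (EuclideanSpace ℝ (Fin n)))
      (F : Fin (k + 1) → Submodule ℤ (EuclideanSpace ℝ (Fin n))),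
      1 ≤ t → IsLattice L → IsStableFiltration t L F →
      ∃ (k' : ℕ) (l : Fin (k' + 1) → Fin (k + 1)),
        l 0 = 0 ∧ l (Fin.last k') = Fin.last k ∧ StrictMono l ∧
        IsWellSeparatedFiltration (2 * t) L (F ∘ l)) ∧
    (∃ (P : RamProg) (p : Polynomial ℕ),
      ∀ (n k : ℕ) (m : Fin (k + 1) → ℕ) (B : ∀ i, Fin (m i) → Fin n → ℚ) (t : ℝ),
      1 ≤ t → (∀ i, LinearIndependent ℚ (B i)) →
      IsStableFiltration t (ratLattice (B (Fin.last k))) (fun i => ratLattice (B i)) →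
      ∃ (k' : ℕ) (l : Fin (k' + 1) → Fin (k + 1)),
        l 0 = 0 ∧ l (Fin.last k') = Fin.last k ∧ StrictMono l ∧
        IsWellSeparatedFiltration (2 * t) (ratLattice (B (Fin.last k)))
          ((fun i => ratLattice (B i)) ∘ l) ∧
        ∃ (c : ℕ) (σ : RamMem),
          RamExec P (ramInput (encodeBases n k m B)) c σ ∧
          RamOutput σ (List.ofFn fun j => ((l j : ℕ) : ℤ)) ∧
          c ≤ p.eval (encodingLength (encodeBases n k m B))) ∧
    (∀ (n : ℕ) (L : Submodule ℤ (EuclideanSpace ℝ (Fin n))), IsLattice L →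
      ∃ (k : ℕ) (F : Fin (k + 1) → Submodule ℤ (EuclideanSpace ℝ (Fin n))),
        IsWellSeparatedFiltration 2 L F) := by
  refine ⟨fun n k t L F ht hL hF => ?_, exists_separation_algorithm,
    fun n L hL => hL.exists_wellSeparated_two⟩
  exact exists_wellSeparated ht hL hF
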